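/- Let $N\ge 1$, let $\omega\in\mathbb{C}$ be a primitive $N$-th root of unity, and write $\mathbb{Z}_N=\mathbb{Z}/N\mathbb{Z}$. A coaction $\rho$ of $C(\mathbb{Z}_N)$ on a unital C*-algebra $X$ is written as a family $(\rho_t)_{t\in\mathbb{Z}_N}$, using $X\otimes C(\mathbb{Z}_N)=C(\mathbb{Z}_N,X)$; an element $x$ is homogeneous of degree $d$ if $\rho_t(x)=\omega^{td}x$ for all $t$. The algebra $C(\mathbb{Z}_N)$, with generator $z(t)=\omega^t$, coacts on itself by its comultiplication, so that $z$ has degree $1$. Braided tensor products. Represent $(X,\rho^X)$ and $(Y,\rho^Y)$ faithfully and $\mathbb{Z}_N$-equivariantly on Hilbert spaces $L^X$, $L^Y$ carrying unitary representations of $\mathbb{Z}_N$. Let $c: L^X\otimes L^Y\to L^Y\otimes L^X$ be the unitary with $c(\xi\otimes\eta)=\omega^{pq}\,\eta\otimes\xi$ for $\xi,\eta$ of degrees $p,q$. Then $X\boxtimes Y\subset B(L^X\otimes L^Y)$ is the C*-algebra generated by $j_1(x)=x\otimes 1$ and $j_2(y)=c^{-1}(y\otimes 1)c$, $x\in X$,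 $y\in Y$. The representation of $\mathbb{Z}_N$ on $L^X\otimes L^Y$ is the diagonal one. The embeddings into an iterated product are $j_1,j_2,j_3$, and $\otimes$ between C*-algebras is the minimal (spatial) tensor product. The anyonic free unitary quantum group $U_N^+(R)$. The algebra $C(U_N^+(R))$ is the universal unital C*-algebra with generators $u_{ij}$, $i,j\in\mathbb{Z}_N$, subject to the relations that the matrices $u=(u_{ij})$ and $\overline{u}_R=(\omega^{-i(j-i)}u_{ij}^*)$ are unitary. Its coaction is $\rho_t(u_{ij})=\omega^{t(j-i)}u_{ij}$, and its comultiplication is the unique $\mathbb{Z}_N$-equivariant unital $*$-homomorphism $\Delta: C(U_N^+(R))\to C(U_N^+(R))\boxtimes C(U_N^+(R))$ with $\Delta(u_{ij})=\sum_k j_1(u_{ik})\,j_2(u_{kj})$. The bosonization $U_N^+(R)\rtimes\mathbb{Z}_N$ consists of the C*-algebra $C(\mathbb{Z}_N)\boxtimes C(U_N^+(R))$ with the comultiplication $\Delta_{\rtimes}=\psi\circ(\mathrm{id}\boxtimes\Delta)$. Here $\mathrm{id}\boxtimes\Delta$ is the unital $*$-homomorphism $C(\mathbb{Z}_N)\boxtimes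 C(U_N^+(R))\to C(\mathbb{Z}_N)\boxtimes C(U_N^+(R))\boxtimes C(U_N^+(R))$ that sends $j_1(f)j_2(x)$ to $j_1(f)\,j_2(\Delta(x))$, the second factor of the target being $C(U_N^+(R))\boxtimes C(U_N^+(R))$. The map $$\psi: C(\mathbb{Z}_N)\boxtimes C(U_N^+(R))\boxtimes C(U_N^+(R))\to \bigl(C(\mathbb{Z}_N)\boxtimes C(U_N^+(R))\bigr)\otimes\bigl(C(\mathbb{Z}_N)\boxtimes C(U_N^+(R))\bigr)$$ is the unital $*$-homomorphism with $\psi(j_1(f))=(j_1\otimes j_1)\Delta_{\mathbb{Z}_N}(f)$, $\psi(j_2(x))=(j_2\otimes j_1)(\rho(x))$ and $\psi(j_3(x))=1\otimes j_2(x)$. Theorem. For every choice of faithful equivariant representations of $C(\mathbb{Z}_N)$ and $C(U_N^+(R))$, the following hold. (a) The C*-algebra $C(U_N^+(R)\rtimes\mathbb{Z}_N)=C(\mathbb{Z}_N)\boxtimes C(U_N^+(R))$, with the elements $z:=j_1(z)$ and $u_{ij}:=j_2(u_{ij})$, is the universal unital C*-algebra generated by elements $z$ and $u_{ij}$, $i,j\in\mathbb{Z}_N$,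 subject to (1) $zz^*=z^*z=1=z^N$; (2) $zu_{ij}=\omega^{j-i}u_{ij}z$ for all $i,j$; (3) $u=(u_{ij})$ and $\overline{u}_R=(\omega^{-i(j-i)}u_{ij}^*)$ are unitary. (b) The homomorphisms $\Delta$ and $\Delta_{\rtimes}$ described above exist and are unique, and $$\Delta_{\rtimes}(z)=z\otimes z,\qquad \Delta_{\rtimes}(u_{ij})=\sum_{k\in\mathbb{Z}_N}u_{ik}\otimes z^{k-i}u_{kj}\qquad(i,j\in\mathbb{Z}_N).$$ -/

import Mathlib

open scoped TensorProduct

noncomputable section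

namespace Anyonic

/-! ### The free unital complex star-algebra on a set of generators -/

/-- The underlying algebra of the free unital `*`-algebra on `G`: noncommutative polynomials in
the letters `inl g` (standing for `g`) and `inr g` (standing for the adjoint of `g`). -/
def FreeStar (G : Type) : Type := FreeAlgebra ℂ (G ⊕ G)

namespace FreeStar

variable {G : Type}

instance : Ring (FreeStar G) := inferInstanceAs (Ring (FreeAlgebra ℂ (G ⊕ G)))
instance : Algebra ℂ (FreeStar G) := inferInstanceAs (Algebra ℂ (FreeAlgebra ℂ (G ⊕ G)))

/-- The letters. -/
def letter (x : G ⊕ G) : FreeStar G := FreeAlgebra.ι ℂ x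

/-- The generator attached to `g`. -/
def gen (g : G) : FreeStar G := letter (Sum.inl g)

/-- Evaluation of noncommutative polynomials. -/
def liftAlg {A : Type*} [Ring A] [Algebra ℂ A] (f : G ⊕ G → A) : FreeStar G →ₐ[ℂ] A :=
  FreeAlgebra.lift ℂ f

theorem liftAlg_letter {A : Type*} [Ring A] [Algebra ℂ A] (f : G ⊕ G → A) (x : G ⊕ G) :
    liftAlg f (letter x) = f x :=
  FreeAlgebra.lift_ι_apply f x

theorem induction {p : FreeStar G → Prop} (hc : ∀ c : ℂ, p (algebraMap ℂ _ c))
    (hl : ∀ x, p (letter x)) (hm : ∀ a b, p a → p b → p (a * b))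
    (ha : ∀ a b, p a → p b → p (a + b)) (a : FreeStar G) : p a :=
  FreeAlgebra.induction ℂ (G ⊕ G) hc hl hm ha a

/-- The opposite algebra with conjugated scalars: an algebra homomorphism into it is a
conjugate-linear antimultiplicative map. -/
def ConjOp (G : Type) : Type := (FreeStar G)ᵐᵒᵖ

instance : Ring (ConjOp G) := inferInstanceAs (Ring (FreeStar G)ᵐᵒᵖ)

instance : Algebra ℂ (ConjOp G) :=
  RingHom.toAlgebra' (S := ConjOp G)
    ((algebraMap ℂ (FreeStar G)ᵐᵒᵖ).comp (starRingEnd ℂ))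
    (fun c x => Algebra.commutes (A := (FreeStar G)ᵐᵒᵖ) (starRingEnd ℂ c) x)

/-- The adjoint of a letter. -/
def adjLetter (x : G ⊕ G) : ConjOp G := MulOpposite.op (letter x.swap)

/-- The involution, as a homomorphism: it exchanges the letters `inl g` and `inr g`. -/
def starHom : FreeStar G →ₐ[ℂ] ConjOp G := liftAlg adjLetter

instance : Star (FreeStar G) := ⟨fun a => MulOpposite.unop (starHom a)⟩

theorem star_def (a : FreeStar G) : star a = MulOpposite.unop (starHom a) := rfl

theorem star_letter (x : G ⊕ G) : star (letter x) = letter x.swap := by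
  rw [star_def, starHom, liftAlg_letter]
  rfl

theorem star_algebraMap (c : ℂ) :
    star (algebraMap ℂ (FreeStar G) c) = algebraMap ℂ (FreeStar G) (starRingEnd ℂ c) := by
  rw [star_def, AlgHom.commutes]
  rfl

theorem star_add' (a b : FreeStar G) : star (a + b) = star a + star b := by
  rw [star_def, map_add]
  rfl

theorem star_mul' (a b : FreeStar G) : star (a * b) = star b * star a := by
  rw [star_def, map_mul]
  rfl

instance : StarRing (FreeStar G) where
  star_involutive a := by
    induction a using induction with
    | hc c => rw [star_algebraMap, star_algebraMap, Complex.conj_conj]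
    | hl x => rw [star_letter, star_letter, Sum.swap_swap]
    | hm a b ha hb => rw [star_mul', star_mul', ha, hb]
    | ha a b ha hb => rw [star_add', star_add', ha, hb]
  star_mul := star_mul'
  star_add := star_add'

instance : StarModule ℂ (FreeStar G) where
  star_smul c a := by
    rw [Algebra.smul_def, star_mul, star_algebraMap, Algebra.smul_def, Algebra.commutes]
    rfl

/-- The universal property of the free unital `*`-algebra. -/
def eval {A : Type*} [Ring A] [StarRing A] [Algebra ℂ A] [StarModule ℂ A] (d : G → A) :
    FreeStar G →⋆ₐ[ℂ] A :=
  { liftAlg (Sum.elim d fun g => star (d g)) with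
    map_star' := fun a => by
      change liftAlg _ _ = star (liftAlg _ _)
      induction a using induction with
      | hc c => rw [star_algebraMap, AlgHom.commutes, AlgHom.commutes, ← algebraMap_star_comm]; rfl
      | hl x => rw [star_letter, liftAlg_letter, liftAlg_letter]; cases x <;> simp
      | hm a b ha hb => rw [star_mul', map_mul, ha, hb, map_mul, star_mul]
      | ha a b ha hb => rw [star_add', map_add, ha, hb, map_add, star_add] }

theorem eval_gen {A : Type*} [Ring A] [StarRing A] [Algebra ℂ A] [StarModule ℂ A] (d : G → A)
    (g : G) : eval d (gen g) = d g :=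
  liftAlg_letter _ _

theorem hom_ext {A : Type*} [Ring A] [StarRing A] [Algebra ℂ A] [StarModule ℂ A]
    {f f' : FreeStar G →⋆ₐ[ℂ] A} (h : ∀ g, f (gen g) = f' (gen g)) : f = f' := by
  ext a
  induction a using induction with
  | hc c => rw [AlgHomClass.commutes, AlgHomClass.commutes]
  | hl x =>
    rcases x with g | g
    · exact h g
    · have : (letter (Sum.inr g) : FreeStar G) = star (gen g) := by
        rw [gen, star_letter]; rfl
      rw [this, map_star, map_star, h]
  | hm a b ha hb => rw [map_mul, ha, hb, map_mul]
  | ha a b ha hb => rw [map_add, ha, hb, map_add]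

end FreeStar

/-! ### C*-seminorms and their completions -/

/-- A C*-seminorm on a unital complex `*`-algebra. -/
structure CStarSeminorm (F : Type) [Ring F] [StarRing F] [Algebra ℂ F] extends Seminorm ℂ F where
  mul_le' : ∀ a b, toFun (a * b) ≤ toFun a * toFun b
  star_mul_self' : ∀ a, toFun (star a * a) = toFun a * toFun a

namespace CStarSeminorm

variable {F : Type} [Ring F] [StarRing F] [Algebra ℂ F]

instance : CoeFun (CStarSeminorm F) fun _ => F → ℝ := ⟨fun p => p.toFun⟩

theorem nonneg (p : CStarSeminorm F) (a : F) : 0 ≤ p a := apply_nonneg p.toSeminorm a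

theorem star_le (p : CStarSeminorm F) (a : F) : p (star a) = p a := by
  have key : ∀ b : F, p b ≤ p (star b) := fun b => by
    have h := p.mul_le' (star b) b
    rw [p.star_mul_self'] at h
    rcases (p.nonneg b).eq_or_lt with h0 | h0
    · rw [← h0]; exact p.nonneg _
    · exact le_of_mul_le_mul_right h h0
  refine le_antisymm ?_ (key a)
  have := key (star a)
  rwa [star_star] at this

/-- The algebra `F` with the topology of a C*-seminorm. -/
@[nolint unusedArguments]
def Pre (_ : CStarSeminorm F) : Type := F

variable (p : CStarSeminorm F)

instance : Ring p.Pre := inferInstanceAs (Ring F)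
instance : StarRing p.Pre := inferInstanceAs (StarRing F)
instance : Algebra ℂ p.Pre := inferInstanceAs (Algebra ℂ F)
instance [StarModule ℂ F] : StarModule ℂ p.Pre := inferInstanceAs (StarModule ℂ F)

/-- The seminorm, on `p.Pre`. -/
def preSeminorm : RingSeminorm p.Pre where
  toFun := p.toFun
  map_zero' := p.map_zero'
  add_le' := p.add_le'
  neg' := p.neg'
  mul_le' := p.mul_le'

instance : SeminormedRing p.Pre := p.preSeminorm.toSeminormedRing

theorem norm_pre (a : p.Pre) : ‖a‖ = p a := rfl

instance : NormedAlgebra ℂ p.Pre where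
  norm_smul_le c a := (p.smul' c a).le

instance : NormedStarGroup p.Pre where
  norm_star_le a := (p.star_le a).le

/-- The C*-algebra obtained from a C*-seminorm by separation and completion. -/
def Compl : Type := UniformSpace.Completion p.Pre

open UniformSpace

instance : NormedRing p.Compl := inferInstanceAs (NormedRing (Completion p.Pre))
instance : CompleteSpace p.Compl := inferInstanceAs (CompleteSpace (Completion p.Pre))

instance : Algebra ℂ p.Compl := inferInstanceAs (Algebra ℂ (Completion p.Pre))

instance : NormedAlgebra ℂ p.Compl where
  norm_smul_le c a := norm_smul_le (β := Completion p.Pre) c a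

/-- The canonical map into the completion. -/
def toCompl : F →ₐ[ℂ] p.Compl where
  toFun a := Completion.coe' (α := p.Pre) a
  map_one' := Completion.coe_one p.Pre
  map_mul' a b := Completion.coe_mul (α := p.Pre) a b
  map_zero' := Completion.coe_zero (α := p.Pre)
  map_add' a b := Completion.coe_add (α := p.Pre) a b
  commutes' _ := rfl

theorem norm_toCompl (a : F) : ‖p.toCompl a‖ = p a := Completion.norm_coe (E := p.Pre) a

theorem denseRange_toCompl : DenseRange p.toCompl := Completion.denseRange_coe (α := p.Pre)

theorem compl_ind {P : p.Compl → Prop} (hP : IsClosed {a | P a}) (h : ∀ a : F, P (p.toCompl a))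
    (a : p.Compl) : P a :=
  Completion.induction_on (α := p.Pre) a hP h

instance : Star p.Compl := ⟨Completion.map (star : p.Pre → p.Pre)⟩

theorem star_toCompl (a : F) : star (p.toCompl a) = p.toCompl (star a) :=
  Completion.map_coe (f := (star : p.Pre → p.Pre))
    (star_isometry (E := p.Pre)).uniformContinuous a

theorem continuous_star' : Continuous (star : p.Compl → p.Compl) :=
  Completion.continuous_map (f := (star : p.Pre → p.Pre))

instance [StarModule ℂ F] : CStarAlgebra p.Compl :=
  { (inferInstance : NormedRing p.Compl), (inferInstance : CompleteSpace p.Compl),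
    (inferInstance : NormedAlgebra ℂ p.Compl) with
    star := star
    star_involutive := fun a => by
      have hs := p.continuous_star'
      refine p.compl_ind (P := fun a => star (star a) = a)
        (isClosed_eq (hs.comp hs) continuous_id) (fun a => ?_) a
      rw [star_toCompl, star_toCompl, star_star]
    star_mul := fun a b => by
      have hs := p.continuous_star'
      refine p.compl_ind (P := fun a => star (a * b) = star b * star a)
        (isClosed_eq (hs.comp (continuous_mul_const b)) (continuous_const.mul hs)) (fun a => ?_) a
      refine p.compl_ind (P := fun b => star (p.toCompl a * b) = star b * star (p.toCompl a))
        (isClosed_eq (hs.comp (continuous_const_mul _)) (hs.mul continuous_const)) (fun b => ?_) b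
      rw [← map_mul, star_toCompl, star_toCompl, star_toCompl, star_mul, map_mul]
    star_add := fun a b => by
      have hs := p.continuous_star'
      refine p.compl_ind (P := fun a => star (a + b) = star a + star b)
        (isClosed_eq (by fun_prop) (by fun_prop)) (fun a => ?_) a
      refine p.compl_ind (P := fun b => star (p.toCompl a + b) = star (p.toCompl a) + star b)
        (isClosed_eq (by fun_prop) (by fun_prop)) (fun b => ?_) b
      rw [← map_add, star_toCompl, star_toCompl, star_toCompl, star_add, map_add]
    norm_mul_self_le := fun a => by
      have hs := p.continuous_star'
      refine p.compl_ind (P := fun a => ‖a‖ * ‖a‖ ≤ ‖star a * a‖)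
        (isClosed_le (by fun_prop) (by fun_prop)) (fun a => ?_) a
      rw [star_toCompl, ← map_mul, norm_toCompl, norm_toCompl]
      exact (p.star_mul_self' a).ge
    star_smul := fun c a => by
      have hs := p.continuous_star'
      refine p.compl_ind (P := fun a => star (c • a) = star c • star a)
        (isClosed_eq (hs.comp (continuous_const_smul c)) (hs.const_smul (star c)))
        (fun a => ?_) a
      rw [← map_smul, star_toCompl, star_toCompl, star_smul, map_smul] }

/-- The canonical `*`-homomorphism into the completion. -/
def mkStar [StarModule ℂ F] : F →⋆ₐ[ℂ] p.Compl :=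
  { p.toCompl with map_star' := fun a => (p.star_toCompl a).symm }

theorem mkStar_apply [StarModule ℂ F] (a : F) : p.mkStar a = p.toCompl a := rfl

theorem continuous_pre {A : Type*} [CStarAlgebra A] (f : F →⋆ₐ[ℂ] A) (hf : ∀ a, ‖f a‖ ≤ p a) :
    Continuous (fun a : p.Pre => f a) :=
  AddMonoidHomClass.continuous_of_bound (E := p.Pre) (f : F →+ A) 1
    (fun a => by rw [one_mul]; exact hf a)

/-- Extension of a contractive `*`-homomorphism to the completion. -/
def extend [StarModule ℂ F] {A : Type*} [CStarAlgebra A] (f : F →⋆ₐ[ℂ] A) (hf : ∀ a, ‖f a‖ ≤ p a) :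
    p.Compl →⋆ₐ[ℂ] A :=
  have hc := p.continuous_pre f hf
  let e : Completion p.Pre →+* A :=
    Completion.extensionHom (α := p.Pre) ((f : F →ₐ[ℂ] A) : F →+* A) hc
  have he : ∀ a : F, e (Completion.coe' (α := p.Pre) a) = f a := fun a =>
    Completion.extensionHom_coe (α := p.Pre) ((f : F →ₐ[ℂ] A) : F →+* A) hc a
  have hec : Continuous e := Completion.continuous_extension
  { toFun := e
    map_one' := map_one e
    map_mul' := map_mul e
    map_zero' := map_zero e
    map_add' := map_add e
    commutes' := fun c => (he (algebraMap ℂ F c)).trans (AlgHomClass.commutes f c)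
    map_star' := fun a => by
      have hs := p.continuous_star'
      refine p.compl_ind (P := fun a => e (star a : p.Compl) = star (e a))
        (isClosed_eq (hec.comp hs) (continuous_star.comp hec)) (fun a => ?_) a
      rw [star_toCompl]
      exact (he (star a)).trans ((map_star f a).trans (congrArg star (he a).symm)) }

theorem extend_toCompl [StarModule ℂ F] {A : Type*} [CStarAlgebra A] (f : F →⋆ₐ[ℂ] A) (hf : ∀ a, ‖f a‖ ≤ p a) (a : F) :
    p.extend f hf (p.toCompl a) = f a :=
  Completion.extensionHom_coe (α := p.Pre) ((f : F →ₐ[ℂ] A) : F →+* A) (p.continuous_pre f hf) a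

/-- The C*-seminorm induced by a `*`-homomorphism into a C*-algebra. -/
def ofHom {A : Type*} [CStarAlgebra A] (f : F →⋆ₐ[ℂ] A) : CStarSeminorm F where
  toFun a := ‖f a‖
  map_zero' := by simp
  add_le' a b := by rw [map_add]; exact norm_add_le _ _
  neg' a := by rw [map_neg, norm_neg]
  smul' c a := by rw [map_smul, norm_smul]
  mul_le' a b := by rw [map_mul]; exact norm_mul_le _ _
  star_mul_self' a := by rw [map_mul, map_star, CStarRing.norm_star_mul_self]

theorem ofHom_apply {A : Type*} [CStarAlgebra A] (f : F →⋆ₐ[ℂ] A) (a : F) :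
    ofHom f a = ‖f a‖ := rfl

end CStarSeminorm

/-! ### The universal unital C*-algebra on generators and relations -/

/-- A C*-seminorm on the free `*`-algebra that vanishes on the relators `R`; equivalently, a
C*-seminorm on the universal unital `*`-algebra with generators `G` and relations `R`. -/
abbrev AdmissibleSeminorm {G : Type} (R : Set (FreeStar G)) : Type :=
  {p : CStarSeminorm (FreeStar G) // ∀ r ∈ R, p r = 0}

/-- The relations bound the generators uniformly in all C*-seminorms, so that there is a largest
one. -/
def IsBoundedRel {G : Type} (R : Set (FreeStar G)) : Prop :=
  ∀ g : G, ∃ C : ℝ, ∀ p : AdmissibleSeminorm R, p.1 (FreeStar.gen g) ≤ C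

namespace Universal

variable {G : Type} {R : Set (FreeStar G)}

theorem bddAbove (hR : IsBoundedRel R) (a : FreeStar G) :
    BddAbove (Set.range fun p : AdmissibleSeminorm R => p.1 a) := by
  suffices h : ∃ C : ℝ, 0 ≤ C ∧ ∀ p : AdmissibleSeminorm R, p.1 a ≤ C by
    obtain ⟨C, -, hC⟩ := h
    exact ⟨C, by rintro _ ⟨p, rfl⟩; exact hC p⟩
  induction a using FreeStar.induction with
  | hc c =>
    refine ⟨‖c‖, norm_nonneg c, fun p => ?_⟩
    have h1 : p.1 (1 : FreeStar G) ≤ 1 := by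
      have h := p.1.star_mul_self' 1
      rw [star_one, mul_one] at h
      nlinarith [p.1.nonneg 1]
    rw [Algebra.algebraMap_eq_smul_one, p.1.smul']
    exact mul_le_of_le_one_right (norm_nonneg c) h1
  | hl x =>
    rcases x with g | g
    · obtain ⟨C, hC⟩ := hR g
      exact ⟨max C 0, le_max_right _ _, fun p => (hC p).trans (le_max_left _ _)⟩
    · obtain ⟨C, hC⟩ := hR g
      refine ⟨max C 0, le_max_right _ _, fun p => ?_⟩
      have : (FreeStar.letter (Sum.inr g) : FreeStar G) = star (FreeStar.gen g) := by
        rw [FreeStar.gen, FreeStar.star_letter]; rfl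
      rw [this, p.1.star_le]
      exact (hC p).trans (le_max_left _ _)
  | hm a b ha hb =>
    obtain ⟨C, hC0, hC⟩ := ha
    obtain ⟨D, hD0, hD⟩ := hb
    exact ⟨C * D, mul_nonneg hC0 hD0, fun p => (p.1.mul_le' a b).trans
      (mul_le_mul (hC p) (hD p) (p.1.nonneg b) hC0)⟩
  | ha a b ha hb =>
    obtain ⟨C, hC0, hC⟩ := ha
    obtain ⟨D, hD0, hD⟩ := hb
    exact ⟨C + D, add_nonneg hC0 hD0, fun p => (p.1.add_le' a b).trans (add_le_add (hC p) (hD p))⟩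

instance : Nonempty (AdmissibleSeminorm R) :=
  ⟨⟨{ toSeminorm := 0
      mul_le' := fun _ _ => by
        change (0 : ℝ) ≤ 0 * 0
        simp
      star_mul_self' := fun _ => by
        change (0 : ℝ) = 0 * 0
        simp }, fun _ _ => rfl⟩⟩

/-- The largest C*-seminorm on the `*`-algebra with generators `G` and relations `R`. -/
def maxSeminorm (hR : IsBoundedRel R) : CStarSeminorm (FreeStar G) where
  toFun a := ⨆ p : AdmissibleSeminorm R, p.1 a
  map_zero' := by
    have : ∀ p : AdmissibleSeminorm R, p.1 (0 : FreeStar G) = 0 := fun p => p.1.map_zero'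
    simp [this]
  add_le' a b := ciSup_le fun p => (p.1.add_le' a b).trans
    (add_le_add (le_ciSup (bddAbove hR a) p) (le_ciSup (bddAbove hR b) p))
  neg' a := iSup_congr fun p => p.1.neg' a
  smul' c a := by
    rw [Real.mul_iSup_of_nonneg (norm_nonneg c)]
    exact iSup_congr fun p => p.1.smul' c a
  mul_le' a b := ciSup_le fun p => (p.1.mul_le' a b).trans
    (mul_le_mul (le_ciSup (bddAbove hR a) p) (le_ciSup (bddAbove hR b) p) (p.1.nonneg b)
      (Real.iSup_nonneg fun p => p.1.nonneg a))
  star_mul_self' a := by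
    apply le_antisymm
    · refine ciSup_le fun p => ?_
      rw [p.1.star_mul_self' a]
      have h := le_ciSup (bddAbove hR a) p
      exact mul_self_le_mul_self (p.1.nonneg a) h
    · have h0 : 0 ≤ ⨆ p : AdmissibleSeminorm R, p.1 (star a * a) :=
        Real.iSup_nonneg fun p => p.1.nonneg _
      have h : (⨆ p : AdmissibleSeminorm R, p.1 a)
          ≤ √(⨆ p : AdmissibleSeminorm R, p.1 (star a * a)) := by
        refine ciSup_le fun p => Real.le_sqrt_of_sq_le ?_
        rw [pow_two, ← p.1.star_mul_self' a]
        exact le_ciSup (bddAbove hR (star a * a)) p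
      calc _ ≤ _ := mul_self_le_mul_self (Real.iSup_nonneg fun p => p.1.nonneg a) h
        _ = _ := Real.mul_self_sqrt h0

theorem le_maxSeminorm (hR : IsBoundedRel R) (p : AdmissibleSeminorm R) (a : FreeStar G) :
    p.1 a ≤ maxSeminorm hR a :=
  le_ciSup (bddAbove hR a) p

theorem maxSeminorm_rel (hR : IsBoundedRel R) {r : FreeStar G} (hr : r ∈ R) :
    maxSeminorm hR r = 0 := by
  have : ∀ p : AdmissibleSeminorm R, p.1 r = 0 := fun p => p.2 r hr
  change (⨆ p : AdmissibleSeminorm R, p.1 r) = 0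
  simp [this]

end Universal

/-- The universal unital C*-algebra with generators `G` and relations `R`: the completion of the
universal unital `*`-algebra in its largest C*-seminorm. -/
def UniversalCStar {G : Type} {R : Set (FreeStar G)} (hR : IsBoundedRel R) : Type :=
  (Universal.maxSeminorm hR).Compl

instance {G : Type} {R : Set (FreeStar G)} (hR : IsBoundedRel R) :
    CStarAlgebra (UniversalCStar hR) :=
  inferInstanceAs (CStarAlgebra (Universal.maxSeminorm hR).Compl)

namespace Universal

variable {G : Type} {R : Set (FreeStar G)} (hR : IsBoundedRel R)

/-- The canonical homomorphism. -/
def toUniversal : FreeStar G →⋆ₐ[ℂ] UniversalCStar hR := (maxSeminorm hR).mkStar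

/-- The canonical generators. -/
def gen (g : G) : UniversalCStar hR := toUniversal hR (FreeStar.gen g)

theorem toUniversal_rel {r : FreeStar G} (hr : r ∈ R) : toUniversal hR r = 0 := by
  have h : ‖toUniversal hR r‖ = 0 :=
    ((maxSeminorm hR).norm_toCompl r).trans (maxSeminorm_rel hR hr)
  exact norm_eq_zero.mp h

/-- The universal property: existence. -/
def lift {A : Type*} [CStarAlgebra A] (d : G → A) (hd : ∀ r ∈ R, FreeStar.eval d r = 0) :
    UniversalCStar hR →⋆ₐ[ℂ] A :=
  (maxSeminorm hR).extend (FreeStar.eval d) fun a =>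
    le_maxSeminorm hR ⟨CStarSeminorm.ofHom (FreeStar.eval d), fun r hr => by
      rw [CStarSeminorm.ofHom_apply, hd r hr, norm_zero]⟩ a

theorem lift_gen {A : Type*} [CStarAlgebra A] (d : G → A)
    (hd : ∀ r ∈ R, FreeStar.eval d r = 0) (g : G) : lift hR d hd (gen hR g) = d g :=
  ((maxSeminorm hR).extend_toCompl _ _ _).trans (FreeStar.eval_gen d g)

/-- The universal property: uniqueness. -/
theorem hom_ext {A : Type*} [CStarAlgebra A] {f f' : UniversalCStar hR →⋆ₐ[ℂ] A}
    (h : ∀ g, f (gen hR g) = f' (gen hR g)) : f = f' := by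
  have hF : f.comp (toUniversal hR) = f'.comp (toUniversal hR) :=
    FreeStar.hom_ext h
  have hc : ∀ e : UniversalCStar hR →⋆ₐ[ℂ] A, Continuous e := fun e =>
    AddMonoidHomClass.continuous_of_bound e 1 fun a => by
      rw [one_mul]; exact NonUnitalStarAlgHom.norm_apply_le e a
  ext a
  refine (maxSeminorm hR).compl_ind (P := fun a => f a = f' a)
    (isClosed_eq (hc f) (hc f')) (fun a => ?_) a
  exact DFunLike.congr_fun hF a

end Universal

/-! ### Roots of unity and actions of the cyclic group -/

/-- `ω ^ a` for `a` in `ℤ/N` (well defined when `ω ^ N = 1`). -/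
def rootPow {N : ℕ} (ω : ℂ) (a : ZMod N) : ℂ := ω ^ a.val

section Roots

variable {N : ℕ} [NeZero N] {ω : ℂ}

theorem rootPow_add (hω : IsPrimitiveRoot ω N) (a b : ZMod N) : rootPow ω (a + b) = rootPow ω a * rootPow ω b := by
  rw [rootPow, rootPow, rootPow, ← pow_add, ZMod.val_add, ← pow_mod_orderOf ω (a.val + b.val),
    ← hω.eq_orderOf]

theorem rootPow_mul_conj (hω : IsPrimitiveRoot ω N) (a : ZMod N) : rootPow ω a * starRingEnd ℂ (rootPow ω a) = 1 := by
  rw [Complex.mul_conj, Complex.normSq_eq_norm_sq, rootPow, norm_pow,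
    hω.norm'_eq_one (NeZero.ne N)]
  simp

theorem rootPow_neg (hω : IsPrimitiveRoot ω N) (a : ZMod N) : rootPow ω (-a) = starRingEnd ℂ (rootPow ω a) := by
  have h0 : rootPow ω a * rootPow ω (-a) = 1 := by
    rw [← rootPow_add hω, add_neg_cancel, rootPow, ZMod.val_zero, pow_zero]
  have h1 := rootPow_mul_conj hω a
  have hne : rootPow ω a ≠ 0 := left_ne_zero_of_mul_eq_one h0
  exact mul_left_cancel₀ hne (h0.trans h1.symm)

end Roots

/-- A coaction of `C(ℤ/N)` on a unital C*-algebra `X`, as a unital `*`-homomorphism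
`ρ : X → C(ℤ/N, X) = X ⊗ C(ℤ/N)`, with value `ρ x t` of `ρ x` at `t`. -/
structure CyclicCoaction (N : ℕ) [NeZero N] (X : Type*) [CStarAlgebra X] where
  /-- The homomorphism `ρ`. -/
  hom : X →⋆ₐ[ℂ] (ZMod N → X)
  /-- `(ρ ⊗ id) ρ = (id ⊗ Δ) ρ`, evaluated at `(s, t)`. -/
  coassoc : ∀ (x : X) (s t : ZMod N), hom (hom x t) s = hom x (s + t)
  /-- `ρ(X) (1 ⊗ C(ℤ/N))` spans a dense subspace of `X ⊗ C(ℤ/N)`. -/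
  podles : closure (Submodule.span ℂ {y : ZMod N → X | ∃ (x : X) (f : ZMod N → ℂ),
    y = hom x * fun t => algebraMap ℂ X (f t)} : Set (ZMod N → X)) = Set.univ

/-- A coaction from an action of the group `ℤ/N` by automorphisms. -/
def CyclicCoaction.ofAction {N : ℕ} [NeZero N] {X : Type*} [CStarAlgebra X]
    (hom : X →⋆ₐ[ℂ] (ZMod N → X)) (coassoc : ∀ (x : X) (s t : ZMod N), hom (hom x t) s = hom x (s + t))
    (zero : ∀ x, hom x 0 = x) : CyclicCoaction N X where
  hom := hom
  coassoc := coassoc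
  podles := by
    refine Set.eq_univ_of_forall fun h => subset_closure ?_
    have : h = ∑ t : ZMod N, hom (hom (h t) (-t)) *
        fun s => algebraMap ℂ X ((Pi.single t 1 : ZMod N → ℂ) s) := by
      ext s
      rw [Finset.sum_apply, Finset.sum_eq_single s]
      · simp [coassoc, zero]
      · intro t _ hts
        simp [Pi.single_eq_of_ne (Ne.symm hts)]
      · simp
    rw [this]
    exact Submodule.sum_mem _ fun t _ => Submodule.subset_span ⟨_, _, rfl⟩

/-- The coaction of `C(ℤ/N)` on itself by its comultiplication `Δ(f)(s, t) = f (s + t)`. -/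
def cyclicCoaction (N : ℕ) [NeZero N] : CyclicCoaction N (ZMod N → ℂ) :=
  CyclicCoaction.ofAction
    { toFun := fun f t s => f (s + t)
      map_one' := rfl
      map_mul' := fun _ _ => rfl
      map_zero' := rfl
      map_add' := fun _ _ => rfl
      commutes' := fun _ => rfl
      map_star' := fun _ => rfl }
    (fun f s t => by
      funext r
      change f (r + s + t) = f (r + (s + t))
      rw [add_assoc])
    (fun f => by
      funext r
      change f (r + 0) = f r
      rw [add_zero])

/-- The generator `z(t) = ω ^ t` of `C(ℤ/N)`. -/
def zFun (N : ℕ) [NeZero N] (ω : ℂ) : ZMod N → ℂ := fun t => rootPow ω t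

/-! ### The C*-algebra of the anyonic free unitary quantum group -/

/-- The matrix `(ω ^ (-i (j - i)) u_ij^*)`. -/
def conjMatrix {N : ℕ} (ω : ℂ) {A : Type*} [Ring A] [StarRing A] [Algebra ℂ A]
    (u : Matrix (ZMod N) (ZMod N) A) : Matrix (ZMod N) (ZMod N) A :=
  Matrix.of fun i j => rootPow ω (-(i * (j - i))) • star (u i j)

/-- The matrices `u` and `(ω ^ (-i (j - i)) u_ij^*)` are unitary. -/
def IsAnyonicUnitary {N : ℕ} [NeZero N] (ω : ℂ) {A : Type*} [Ring A] [StarRing A] [Algebra ℂ A]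
    (u : Matrix (ZMod N) (ZMod N) A) : Prop :=
  u ∈ unitary (Matrix (ZMod N) (ZMod N) A) ∧ conjMatrix ω u ∈ unitary (Matrix (ZMod N) (ZMod N) A)

/-- The matrix of generators of the free `*`-algebra. -/
def genMatrix (N : ℕ) : Matrix (ZMod N) (ZMod N) (FreeStar (ZMod N × ZMod N)) :=
  Matrix.of fun i j => FreeStar.gen (i, j)

/-- The relators saying that the matrix `m` is unitary. -/
def unitaryRelators {N : ℕ} [NeZero N] {F : Type} [Ring F] [StarRing F]
    (m : Matrix (ZMod N) (ZMod N) F) : Set F :=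
  {r | ∃ i j, r = (star m * m - 1) i j ∨ r = (m * star m - 1) i j}

/-- The relators saying that `u` and `(ω ^ (-i (j - i)) u_ij^*)` are unitary. -/
def freeUnitaryRelators (N : ℕ) [NeZero N] (ω : ℂ) : Set (FreeStar (ZMod N × ZMod N)) :=
  unitaryRelators (genMatrix N) ∪ unitaryRelators (conjMatrix ω (genMatrix N))

theorem unitaryRelators_map_iff {N : ℕ} [NeZero N] {F : Type} {A : Type*} [Ring F] [StarRing F]
    [Algebra ℂ F] [Ring A] [StarRing A] [Algebra ℂ A] (f : F →⋆ₐ[ℂ] A)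
    (m : Matrix (ZMod N) (ZMod N) F) :
    (∀ r ∈ unitaryRelators m, f r = 0) ↔ m.map f ∈ unitary (Matrix (ZMod N) (ZMod N) A) := by
  have h1 : ∀ i j, f ((star m * m - 1) i j) = (star (m.map f) * m.map f - 1) i j := fun i j => by
    simp [Matrix.mul_apply, Matrix.star_apply, Matrix.one_apply, apply_ite f, map_star f]
  have h2 : ∀ i j, f ((m * star m - 1) i j) = (m.map f * star (m.map f) - 1) i j := fun i j => by
    simp [Matrix.mul_apply, Matrix.star_apply, Matrix.one_apply, apply_ite f, map_star f]
  rw [Unitary.mem_iff, ← sub_eq_zero, ← sub_eq_zero (a := m.map f * _)]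
  constructor
  · intro h
    constructor
    · ext i j
      rw [← h1]
      exact h _ ⟨i, j, Or.inl rfl⟩
    · ext i j
      rw [← h2]
      exact h _ ⟨i, j, Or.inr rfl⟩
  · rintro ⟨h, h'⟩ r ⟨i, j, rfl | rfl⟩
    · rw [h1, h]; rfl
    · rw [h2, h']; rfl

theorem conjMatrix_map {N : ℕ} (ω : ℂ) {F A : Type*} [Ring F] [StarRing F]
    [Algebra ℂ F] [Ring A] [StarRing A] [Algebra ℂ A] (f : F →⋆ₐ[ℂ] A)
    (m : Matrix (ZMod N) (ZMod N) F) : (conjMatrix ω m).map f = conjMatrix ω (m.map f) := by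
  ext i j
  simp [conjMatrix, map_star]

theorem freeUnitaryRelators_map_iff {N : ℕ} [NeZero N] (ω : ℂ) {A : Type*} [Ring A] [StarRing A]
    [Algebra ℂ A] (f : FreeStar (ZMod N × ZMod N) →⋆ₐ[ℂ] A) :
    (∀ r ∈ freeUnitaryRelators N ω, f r = 0) ↔ IsAnyonicUnitary ω ((genMatrix N).map f) := by
  rw [IsAnyonicUnitary, ← conjMatrix_map, ← unitaryRelators_map_iff, ← unitaryRelators_map_iff]
  constructor
  · intro h
    exact ⟨fun r hr => h r (Or.inl hr), fun r hr => h r (Or.inr hr)⟩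
  · rintro ⟨h, h'⟩ r (hr | hr)
    · exact h r hr
    · exact h' r hr

/-- Entries of unitary matrices over a C*-algebra are contractions. -/
theorem norm_entry_le_one {ι A : Type*} [Fintype ι] [DecidableEq ι] [CStarAlgebra A]
    {m : Matrix ι ι A} (hm : m ∈ unitary (Matrix ι ι A)) (i j : ι) : ‖m i j‖ ≤ 1 := by
  let _ := CStarAlgebra.spectralOrder A
  have _ := CStarAlgebra.spectralOrderedRing A
  have h : ∑ k, star (m k j) * m k j = 1 := by
    have := congrFun (congrFun (Unitary.mem_iff.mp hm).1 j) j
    simpa [Matrix.mul_apply, Matrix.star_apply] using this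
  have hle : star (m i j) * m i j ≤ 1 := by
    rw [← h]
    exact Finset.single_le_sum (f := fun k => star (m k j) * m k j)
      (fun k _ => star_mul_self_nonneg _) (Finset.mem_univ i)
  have hn := (CStarAlgebra.norm_le_one_iff_of_nonneg _ (star_mul_self_nonneg (m i j))).mpr hle
  rw [CStarRing.norm_star_mul_self] at hn
  nlinarith [norm_nonneg (m i j)]

theorem freeUnitary_bounded (N : ℕ) [NeZero N] (ω : ℂ) :
    IsBoundedRel (freeUnitaryRelators N ω) := by
  rintro ⟨i, j⟩
  refine ⟨1, fun p => ?_⟩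
  have h : ∀ r ∈ freeUnitaryRelators N ω, p.1.mkStar r = 0 := fun r hr => by
    rw [← norm_eq_zero, CStarSeminorm.mkStar_apply, CStarSeminorm.norm_toCompl]
    exact p.2 r hr
  have hu := ((freeUnitaryRelators_map_iff ω _).mp h).1
  have := norm_entry_le_one hu i j
  rwa [Matrix.map_apply, CStarSeminorm.mkStar_apply, CStarSeminorm.norm_toCompl] at this

/-- The universal unital C*-algebra generated by the entries of a matrix `u` such that `u` and
`(ω ^ (-i (j - i)) u_ij^*)` are unitary. -/
def FreeUnitary (N : ℕ) [NeZero N] (ω : ℂ) : Type :=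
  UniversalCStar (freeUnitary_bounded N ω)

instance (N : ℕ) [NeZero N] (ω : ℂ) : CStarAlgebra (FreeUnitary N ω) :=
  inferInstanceAs (CStarAlgebra (UniversalCStar (freeUnitary_bounded N ω)))

/-- The generators `u_ij`. -/
def FreeUnitary.u (N : ℕ) [NeZero N] (ω : ℂ) :
    Matrix (ZMod N) (ZMod N) (FreeUnitary N ω) :=
  Matrix.of fun i j => Universal.gen (freeUnitary_bounded N ω) (i, j)

theorem FreeUnitary.isAnyonicUnitary (N : ℕ) [NeZero N] (ω : ℂ) :
    IsAnyonicUnitary ω (FreeUnitary.u N ω) :=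
  (freeUnitaryRelators_map_iff ω (Universal.toUniversal (freeUnitary_bounded N ω))).mp
    fun _ hr => Universal.toUniversal_rel (freeUnitary_bounded N ω) hr

theorem eval_relators {N : ℕ} [NeZero N] (ω : ℂ) {A : Type*} [CStarAlgebra A]
    (d : Matrix (ZMod N) (ZMod N) A) (hd : IsAnyonicUnitary ω d) :
    ∀ r ∈ freeUnitaryRelators N ω, FreeStar.eval (fun g => d g.1 g.2) r = 0 := by
  rw [freeUnitaryRelators_map_iff]
  convert hd
  ext i j
  exact FreeStar.eval_gen _ _

/-- The universal property of `FreeUnitary`. -/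
def FreeUnitary.lift {N : ℕ} [NeZero N] (ω : ℂ) {A : Type*} [CStarAlgebra A]
    (d : Matrix (ZMod N) (ZMod N) A) (hd : IsAnyonicUnitary ω d) : FreeUnitary N ω →⋆ₐ[ℂ] A :=
  Universal.lift (freeUnitary_bounded N ω) (fun g => d g.1 g.2) (eval_relators ω d hd)

theorem FreeUnitary.lift_u {N : ℕ} [NeZero N] (ω : ℂ) {A : Type*} [CStarAlgebra A]
    (d : Matrix (ZMod N) (ZMod N) A) (hd : IsAnyonicUnitary ω d) (i j : ZMod N) :
    FreeUnitary.lift ω d hd (FreeUnitary.u N ω i j) = d i j :=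
  Universal.lift_gen _ _ _ _

theorem FreeUnitary.hom_ext {N : ℕ} [NeZero N] (ω : ℂ) {A : Type*} [CStarAlgebra A]
    {f f' : FreeUnitary N ω →⋆ₐ[ℂ] A}
    (h : ∀ i j, f (FreeUnitary.u N ω i j) = f' (FreeUnitary.u N ω i j)) : f = f' :=
  Universal.hom_ext _ fun g => h g.1 g.2

/-- The matrix `(ω ^ (t (j - i)) u_ij)`, as a function of `t`. -/
def rotatedMatrix (N : ℕ) [NeZero N] (ω : ℂ) :
    Matrix (ZMod N) (ZMod N) (ZMod N → FreeUnitary N ω) :=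
  Matrix.of fun i j t => rootPow ω (t * (j - i)) • FreeUnitary.u N ω i j

theorem rotatedMatrix_isAnyonicUnitary {N : ℕ} [NeZero N] {ω : ℂ} (hω : IsPrimitiveRoot ω N) :
    IsAnyonicUnitary ω (rotatedMatrix N ω) := by
  have hu := FreeUnitary.isAnyonicUnitary N ω
  set X := FreeUnitary N ω
  let M := Matrix (ZMod N) (ZMod N) (ZMod N → X)
  -- constant functions
  have hconst : ∀ m : Matrix (ZMod N) (ZMod N) X, m ∈ unitary (Matrix (ZMod N) (ZMod N) X) →
      (Matrix.of fun i j _ => m i j : M) ∈ unitary M := fun m hm => by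
    rw [Unitary.mem_iff] at hm ⊢
    constructor
    · ext i j t
      have := congrFun (congrFun hm.1 i) j
      simp only [Matrix.mul_apply, Matrix.star_apply, Matrix.one_apply] at this
      simp only [Matrix.mul_apply, Matrix.star_apply, Matrix.one_apply, Matrix.of_apply,
        Finset.sum_apply, Pi.mul_apply, Pi.star_apply, this]
      split_ifs <;> rfl
    · ext i j t
      have := congrFun (congrFun hm.2 i) j
      simp only [Matrix.mul_apply, Matrix.star_apply, Matrix.one_apply] at this
      simp only [Matrix.mul_apply, Matrix.star_apply, Matrix.one_apply, Matrix.of_apply,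
        Finset.sum_apply, Pi.mul_apply, Pi.star_apply, this]
      split_ifs <;> rfl
  let α : ZMod N → ZMod N → X := fun i t => algebraMap ℂ X (rootPow ω (t * i))
  have hα : ∀ i, star (α i) * α i = 1 ∧ α i * star (α i) = 1 := fun i => by
    constructor
    · ext t
      simp only [α, Pi.mul_apply, Pi.star_apply, ← algebraMap_star_comm, ← map_mul, Pi.one_apply]
      rw [mul_comm]
      exact (congrArg _ (rootPow_mul_conj hω _)).trans (map_one _)
    · ext t
      simp only [α, Pi.mul_apply, Pi.star_apply, ← algebraMap_star_comm, ← map_mul, Pi.one_apply]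
      exact (congrArg _ (rootPow_mul_conj hω _)).trans (map_one _)
  have hD : (Matrix.diagonal α : M) ∈ unitary M := by
    rw [Unitary.mem_iff, Matrix.star_eq_conjTranspose, Matrix.diagonal_conjTranspose,
      Matrix.diagonal_mul_diagonal, Matrix.diagonal_mul_diagonal]
    constructor
    · rw [← Matrix.diagonal_one]
      congr 1
      funext i
      exact (hα i).1
    · rw [← Matrix.diagonal_one]
      congr 1
      funext i
      exact (hα i).2
  have hD' := Unitary.star_mem hD
  have hsplit : ∀ i j t : ZMod N,
      rootPow ω (t * (j - i)) = rootPow ω (t * j) * starRingEnd ℂ (rootPow ω (t * i)) :=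
    fun i j t => by rw [← rootPow_neg hω, ← rootPow_add hω]; congr 1; ring
  constructor
  · convert mul_mem (mul_mem hD' (hconst _ hu.1)) hD using 1
    ext i j t
    rw [Matrix.mul_diagonal, Matrix.star_eq_conjTranspose, Matrix.diagonal_conjTranspose,
      Matrix.diagonal_mul]
    simp only [rotatedMatrix, α, Matrix.of_apply, Pi.mul_apply, Pi.star_apply,
      ← algebraMap_star_comm, ← Algebra.commutes (rootPow ω (t * j)), ← Algebra.smul_def, smul_smul,
      hsplit]
    rfl
  · convert mul_mem (mul_mem hD (hconst _ hu.2)) hD' using 1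
    ext i j t
    rw [Matrix.star_eq_conjTranspose, Matrix.diagonal_conjTranspose, Matrix.mul_diagonal,
      Matrix.diagonal_mul]
    simp only [rotatedMatrix, conjMatrix, α, Matrix.of_apply, Pi.mul_apply, Pi.star_apply,
      Pi.smul_apply, star_smul, ← algebraMap_star_comm,
      ← Algebra.commutes (star (rootPow ω (t * j))), ← Algebra.smul_def, smul_smul, hsplit]
    congr 1
    simp only [star_mul', starRingEnd_apply, star_star]
    ring

/-- The homomorphism `ρ(u_ij) = (t ↦ ω ^ (t (j - i)) u_ij)`. -/
def rotation {N : ℕ} [NeZero N] {ω : ℂ} (hω : IsPrimitiveRoot ω N) :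
    FreeUnitary N ω →⋆ₐ[ℂ] (ZMod N → FreeUnitary N ω) :=
  FreeUnitary.lift ω (rotatedMatrix N ω) (rotatedMatrix_isAnyonicUnitary hω)

theorem rotation_u {N : ℕ} [NeZero N] {ω : ℂ} (hω : IsPrimitiveRoot ω N) (i j t : ZMod N) :
    rotation hω (FreeUnitary.u N ω i j) t = rootPow ω (t * (j - i)) • FreeUnitary.u N ω i j := by
  rw [rotation, FreeUnitary.lift_u]
  rfl

/-- Evaluation at a point, as a `*`-homomorphism. -/
def evalAt {N : ℕ} (X : Type*) [CStarAlgebra X] (t : ZMod N) : (ZMod N → X) →⋆ₐ[ℂ] X where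
  toFun h := h t
  map_one' := rfl
  map_mul' _ _ := rfl
  map_zero' := rfl
  map_add' _ _ := rfl
  commutes' _ := rfl
  map_star' _ := rfl

theorem evalAt_apply {N : ℕ} {X : Type*} [CStarAlgebra X] (t : ZMod N) (h : ZMod N → X) :
    evalAt X t h = h t := rfl

theorem rotation_rotation {N : ℕ} [NeZero N] {ω : ℂ} (hω : IsPrimitiveRoot ω N)
    (x : FreeUnitary N ω) (s t : ZMod N) :
    rotation hω (rotation hω x t) s = rotation hω x (s + t) := by
  have h : ((evalAt _ s).comp (rotation hω)).comp ((evalAt _ t).comp (rotation hω)) =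
      (evalAt _ (s + t)).comp (rotation hω) := by
    refine FreeUnitary.hom_ext ω fun i j => ?_
    simp only [StarAlgHom.comp_apply, evalAt_apply]
    rw [rotation_u, rotation_u, map_smul, Pi.smul_apply, rotation_u, smul_smul, ← rootPow_add hω]
    congr 2
    ring
  have h' := DFunLike.congr_fun h x
  simpa only [StarAlgHom.comp_apply, evalAt_apply] using h'

theorem rotation_zero {N : ℕ} [NeZero N] {ω : ℂ} (hω : IsPrimitiveRoot ω N)
    (x : FreeUnitary N ω) : rotation hω x 0 = x := by
  have h : (evalAt _ 0).comp (rotation hω) = StarAlgHom.id ℂ (FreeUnitary N ω) := by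
    refine FreeUnitary.hom_ext ω fun i j => ?_
    rw [StarAlgHom.comp_apply, evalAt_apply, rotation_u, zero_mul, rootPow, ZMod.val_zero,
      pow_zero, one_smul, StarAlgHom.coe_id, id_eq]
  have h' := DFunLike.congr_fun h x
  simpa only [StarAlgHom.comp_apply, evalAt_apply, StarAlgHom.coe_id, id_eq] using h'

/-- The coaction `ρ_t(u_ij) = ω ^ (t (j - i)) u_ij` of `C(ℤ/N)`. -/
def freeUnitaryCoaction {N : ℕ} [NeZero N] {ω : ℂ} (hω : IsPrimitiveRoot ω N) :
    CyclicCoaction N (FreeUnitary N ω) :=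
  CyclicCoaction.ofAction (rotation hω) (rotation_rotation hω) (rotation_zero hω)

/-! ### Hilbert space tensor products and spatial tensor products -/

section Hilbert

variable {L L' L'' M M' M'' : Type*}
  [NormedAddCommGroup L] [InnerProductSpace ℂ L] [NormedAddCommGroup L'] [InnerProductSpace ℂ L']
  [NormedAddCommGroup L''] [InnerProductSpace ℂ L'']
  [NormedAddCommGroup M] [InnerProductSpace ℂ M] [NormedAddCommGroup M'] [InnerProductSpace ℂ M']
  [NormedAddCommGroup M''] [InnerProductSpace ℂ M'']

/-- The Hilbert space tensor product. -/
def HTensor (L M : Type*) [NormedAddCommGroup L] [InnerProductSpace ℂ L]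
    [NormedAddCommGroup M] [InnerProductSpace ℂ M] : Type _ :=
  UniformSpace.Completion (L ⊗[ℂ] M)

instance : NormedAddCommGroup (HTensor L M) :=
  inferInstanceAs (NormedAddCommGroup (UniformSpace.Completion (L ⊗[ℂ] M)))

instance : InnerProductSpace ℂ (HTensor L M) :=
  inferInstanceAs (InnerProductSpace ℂ (UniformSpace.Completion (L ⊗[ℂ] M)))

instance : CompleteSpace (HTensor L M) :=
  inferInstanceAs (CompleteSpace (UniformSpace.Completion (L ⊗[ℂ] M)))

variable (L M) in
/-- The canonical embedding of the algebraic tensor product. -/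
def tensorEmb : L ⊗[ℂ] M →ₗᵢ[ℂ] HTensor L M :=
  UniformSpace.Completion.toComplₗᵢ (𝕜 := ℂ) (E := L ⊗[ℂ] M)

/-- The elementary tensor `ξ ⊗ η`. -/
def vecTensor (ξ : L) (η : M) : HTensor L M := tensorEmb L M (ξ ⊗ₜ[ℂ] η)

/-- Extension of a bounded operator to the completion. -/
def extendOp (S : L ⊗[ℂ] M →L[ℂ] L' ⊗[ℂ] M') : HTensor L M →L[ℂ] HTensor L' M' :=
  S.completion

theorem extendOp_apply (S : L ⊗[ℂ] M →L[ℂ] L' ⊗[ℂ] M') (x : L ⊗[ℂ] M) :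
    extendOp S (tensorEmb L M x) = tensorEmb L' M' (S x) :=
  S.completion_apply_coe x

/-- The tensor product `S ⊗ T` of bounded operators. -/
def opTensor (S : L →L[ℂ] L') (T : M →L[ℂ] M') : HTensor L M →L[ℂ] HTensor L' M' :=
  extendOp (TensorProduct.mapL S T)

theorem opTensor_vecTensor (S : L →L[ℂ] L') (T : M →L[ℂ] M') (ξ : L) (η : M) :
    opTensor S T (vecTensor ξ η) = vecTensor (S ξ) (T η) := by
  rw [opTensor, vecTensor, extendOp_apply, TensorProduct.mapL_tmul, vecTensor]

theorem inner_vecTensor (ξ ξ' : L) (η η' : M) :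
    inner ℂ (vecTensor ξ η) (vecTensor ξ' η') = inner ℂ ξ ξ' * inner ℂ η η' := by
  rw [vecTensor, vecTensor, LinearIsometry.inner_map_map, TensorProduct.inner_tmul]

theorem denseRange_tensorEmb : DenseRange (tensorEmb L M) :=
  UniformSpace.Completion.denseRange_coe (α := L ⊗[ℂ] M)

/-- Bounded (semilinear) operators that agree on elementary tensors are equal. -/
theorem op_ext {K : Type*} [NormedAddCommGroup K] [InnerProductSpace ℂ K] {c : ℂ →+* ℂ}
    {S T : HTensor L M →SL[c] K} (h : ∀ ξ η, S (vecTensor ξ η) = T (vecTensor ξ η)) : S = T := by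
  refine DFunLike.coe_injective (denseRange_tensorEmb.equalizer S.continuous T.continuous ?_)
  funext x
  simp only [Function.comp_apply]
  induction x using TensorProduct.induction_on with
  | zero => rw [map_zero, map_zero, map_zero]
  | tmul ξ η => exact h ξ η
  | add x y hx hy => rw [map_add, map_add, map_add, hx, hy]

theorem opTensor_comp (S : L →L[ℂ] L') (S' : L' →L[ℂ] L'') (T : M →L[ℂ] M') (T' : M' →L[ℂ] M'') :
    opTensor S' T' ∘L opTensor S T = opTensor (S' ∘L S) (T' ∘L T) :=
  op_ext fun ξ η => by simp [opTensor_vecTensor]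

theorem opTensor_one : opTensor (1 : L →L[ℂ] L) (1 : M →L[ℂ] M) = 1 :=
  op_ext fun ξ η => by simp [opTensor_vecTensor]

theorem opTensor_star [CompleteSpace L] [CompleteSpace M] (S : L →L[ℂ] L) (T : M →L[ℂ] M) :
    star (opTensor S T) = opTensor (star S) (star T) := by
  refine op_ext fun ξ η => ?_
  refine (InnerProductSpace.toDual ℂ (HTensor L M)).injective (op_ext fun ξ' η' => ?_)
  simp only [InnerProductSpace.toDual_apply_apply]
  rw [ContinuousLinearMap.star_eq_adjoint, ContinuousLinearMap.adjoint_inner_left,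
    opTensor_vecTensor, opTensor_vecTensor, inner_vecTensor, inner_vecTensor,
    ContinuousLinearMap.star_eq_adjoint, ContinuousLinearMap.star_eq_adjoint,
    ContinuousLinearMap.adjoint_inner_left, ContinuousLinearMap.adjoint_inner_left]

variable (L M) in
/-- The flip `ξ ⊗ η ↦ η ⊗ ξ`. -/
def tensorFlip : HTensor L M →L[ℂ] HTensor M L :=
  extendOp (TensorProduct.commIsometry ℂ L M).toContinuousLinearEquiv.toContinuousLinearMap

theorem tensorFlip_vecTensor (ξ : L) (η : M) : tensorFlip L M (vecTensor ξ η) = vecTensor η ξ := by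
  rw [tensorFlip, vecTensor, extendOp_apply]
  rfl

variable [CompleteSpace L] [CompleteSpace M]

/-- The spatial (minimal) tensor product of C*-algebras of operators: the C*-algebra generated by
the operators `x ⊗ y`. -/
def spatialTensor (X : StarSubalgebra ℂ (L →L[ℂ] L)) (Y : StarSubalgebra ℂ (M →L[ℂ] M)) :
    StarSubalgebra ℂ (HTensor L M →L[ℂ] HTensor L M) :=
  (StarAlgebra.adjoin ℂ {T | ∃ x ∈ X, ∃ y ∈ Y, T = opTensor x y}).topologicalClosure

/-! ### Braided tensor products -/

variable {N : ℕ} [NeZero N]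

/-- Unitary representations of `ℤ/N`. -/
abbrev CyclicRep (N : ℕ) (L : Type*) [NormedAddCommGroup L] [InnerProductSpace ℂ L]
    [CompleteSpace L] : Type _ :=
  Multiplicative (ZMod N) →* unitary (L →L[ℂ] L)

/-- The unitary operator `π(t)`. -/
def CyclicRep.op (π : CyclicRep N L) (t : ZMod N) : L →L[ℂ] L := (π (Multiplicative.ofAdd t)).1

/-- The tensor product representation `π(t) ⊗ σ(t)`. -/
def CyclicRep.tensor (π : CyclicRep N L) (σ : CyclicRep N M) : CyclicRep N (HTensor L M) where
  toFun t := ⟨opTensor (π t).1 (σ t).1, by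
    rw [Unitary.mem_iff, opTensor_star]
    constructor
    · refine (opTensor_comp _ _ _ _).trans ?_
      refine (congrArg₂ opTensor (Unitary.mem_iff.mp (π t).2).1
        (Unitary.mem_iff.mp (σ t).2).1).trans opTensor_one
    · refine (opTensor_comp _ _ _ _).trans ?_
      refine (congrArg₂ opTensor (Unitary.mem_iff.mp (π t).2).2
        (Unitary.mem_iff.mp (σ t).2).2).trans opTensor_one⟩
  map_one' := Subtype.ext (by simpa using opTensor_one)
  map_mul' s t := Subtype.ext (by
    rw [map_mul, map_mul]
    exact (opTensor_comp _ _ _ _).symm)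

/-- The projection onto the spectral subspace `{ξ | π(t) ξ = ω ^ (t p) ξ for all t}`. -/
def spectralProj (ω : ℂ) (π : CyclicRep N L) (p : ZMod N) : L →L[ℂ] L :=
  (N : ℂ)⁻¹ • ∑ t : ZMod N, rootPow ω (-(t * p)) • π.op t

/-- The braiding `ξ ⊗ η ↦ ω ^ (p q) η ⊗ ξ` for `ξ` of degree `p` and `η` of degree `q`. -/
def braiding (ω : ℂ) (π : CyclicRep N L) (σ : CyclicRep N M) : HTensor L M →L[ℂ] HTensor M L :=
  ∑ p : ZMod N, ∑ q : ZMod N,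
    rootPow ω (p * q) • (tensorFlip L M ∘L opTensor (spectralProj ω π p) (spectralProj ω σ q))

/-- The dual braiding `η ⊗ ξ ↦ ω ^ (-p q) ξ ⊗ η` for `ξ` of degree `p` and `η` of degree `q`. -/
def dualBraiding (ω : ℂ) (π : CyclicRep N L) (σ : CyclicRep N M) :
    HTensor M L →L[ℂ] HTensor L M :=
  ∑ p : ZMod N, ∑ q : ZMod N,
    rootPow ω (-(p * q)) • (tensorFlip M L ∘L opTensor (spectralProj ω σ q) (spectralProj ω π p))

/-- The embedding `j₁(x) = x ⊗ 1`. -/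
def leftOp (M : Type*) [NormedAddCommGroup M] [InnerProductSpace ℂ M] (x : L →L[ℂ] L) :
    HTensor L M →L[ℂ] HTensor L M :=
  opTensor x 1

/-- The embedding `j₂(y)`: the operator `y ⊗ 1` on `M ⊗ L`, conjugated by the braiding. -/
def rightOp (ω : ℂ) (π : CyclicRep N L) (σ : CyclicRep N M) (y : M →L[ℂ] M) :
    HTensor L M →L[ℂ] HTensor L M :=
  dualBraiding ω π σ ∘L opTensor y 1 ∘L braiding ω π σ

/-- The braided tensor product `X ⊠ Y` of C*-algebras of operators: the C*-algebra generated by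
`j₁(X)` and `j₂(Y)`. -/
def braidedTensor (ω : ℂ) (π : CyclicRep N L) (σ : CyclicRep N M)
    (X : StarSubalgebra ℂ (L →L[ℂ] L)) (Y : StarSubalgebra ℂ (M →L[ℂ] M)) :
    StarSubalgebra ℂ (HTensor L M →L[ℂ] HTensor L M) :=
  (StarAlgebra.adjoin ℂ (leftOp M '' X ∪ rightOp ω π σ '' Y)).topologicalClosure

instance (ω : ℂ) (π : CyclicRep N L) (σ : CyclicRep N M)
    (X : StarSubalgebra ℂ (L →L[ℂ] L)) (Y : StarSubalgebra ℂ (M →L[ℂ] M)) :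
    CStarAlgebra (braidedTensor ω π σ X Y) :=
  StarSubalgebra.cstarAlgebra _ (h_closed := StarSubalgebra.isClosed_topologicalClosure _)

/-- The embedding `j₁ : X → X ⊠ Y`. -/
def braidedTensor.left {ω : ℂ} {π : CyclicRep N L} {σ : CyclicRep N M}
    {X : StarSubalgebra ℂ (L →L[ℂ] L)} {Y : StarSubalgebra ℂ (M →L[ℂ] M)} (x : X) :
    braidedTensor ω π σ X Y :=
  ⟨leftOp M x.1, StarSubalgebra.le_topologicalClosure _
    (StarAlgebra.subset_adjoin ℂ _ (Or.inl ⟨x.1, x.2, rfl⟩))⟩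

/-- The embedding `j₂ : Y → X ⊠ Y`. -/
def braidedTensor.right {ω : ℂ} {π : CyclicRep N L} {σ : CyclicRep N M}
    {X : StarSubalgebra ℂ (L →L[ℂ] L)} {Y : StarSubalgebra ℂ (M →L[ℂ] M)} (y : Y) :
    braidedTensor ω π σ X Y :=
  ⟨rightOp ω π σ y.1, StarSubalgebra.le_topologicalClosure _
    (StarAlgebra.subset_adjoin ℂ _ (Or.inr ⟨y.1, y.2, rfl⟩))⟩

theorem sum_rootPow {ω : ℂ} (hω : IsPrimitiveRoot ω N) (a : ZMod N) :
    ∑ t : ZMod N, rootPow ω (t * a) = if a = 0 then (N : ℂ) else 0 := by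
  split_ifs with h
  · simp [h, rootPow, ZMod.card]
  · have hne : rootPow ω a ≠ 1 := by
      refine hω.pow_ne_one_of_pos_of_lt ?_ (ZMod.val_lt a)
      exact fun h0 => h ((ZMod.val_eq_zero a).mp h0)
    have hS : (∑ t : ZMod N, rootPow ω (t * a)) * rootPow ω a =
        ∑ t : ZMod N, rootPow ω (t * a) := by
      rw [Finset.sum_mul]
      refine (Finset.sum_congr rfl fun t _ => ?_).trans
        (Equiv.sum_comp (Equiv.addRight (1 : ZMod N)) fun t => rootPow ω (t * a))
      rw [← rootPow_add hω, Equiv.coe_addRight, add_mul, one_mul]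
    have : (∑ t : ZMod N, rootPow ω (t * a)) * (rootPow ω a - 1) = 0 := by
      rw [mul_sub, hS, mul_one, sub_self]
    exact (mul_eq_zero.mp this).resolve_right (sub_ne_zero.mpr hne)

theorem spectralProj_apply {ω : ℂ} (hω : IsPrimitiveRoot ω N) (π : CyclicRep N L) {ξ : L}
    {p : ZMod N} (hξ : ∀ t, π.op t ξ = rootPow ω (t * p) • ξ) (q : ZMod N) :
    spectralProj ω π q ξ = if p = q then ξ else 0 := by
  have h : ∀ t : ZMod N, (rootPow ω (-(t * q)) • π.op t) ξ = rootPow ω (t * (p - q)) • ξ :=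
    fun t => by
      rw [smul_apply, hξ, smul_smul, ← rootPow_add hω]
      congr 2
      ring
  rw [spectralProj, smul_apply, sum_apply,
    Finset.sum_congr rfl fun t _ => h t, ← Finset.sum_smul, sum_rootPow hω, smul_smul]
  by_cases hpq : p = q
  · rw [if_pos (sub_eq_zero.mpr hpq), if_pos hpq,
      inv_mul_cancel₀ (Nat.cast_ne_zero.mpr (NeZero.ne N)), one_smul]
  · rw [if_neg (sub_ne_zero.mpr hpq), if_neg hpq, mul_zero, zero_smul]

/-- The braidings on homogeneous vectors. -/
theorem braiding_vecTensor {ω : ℂ} (hω : IsPrimitiveRoot ω N) (π : CyclicRep N L)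
    (σ : CyclicRep N M) {ξ : L} {η : M} {p q : ZMod N} (hξ : ∀ t, π.op t ξ = rootPow ω (t * p) • ξ)
    (hη : ∀ t, σ.op t η = rootPow ω (t * q) • η) :
    braiding ω π σ (vecTensor ξ η) = rootPow ω (p * q) • vecTensor η ξ ∧
      dualBraiding ω π σ (vecTensor η ξ) = rootPow ω (-(p * q)) • vecTensor ξ η := by
  have z1 : ∀ ξ : L, vecTensor ξ (0 : M) = 0 := fun ξ => by
    rw [vecTensor, TensorProduct.tmul_zero, map_zero]
  have z2 : ∀ η : M, vecTensor (0 : L) η = 0 := fun η => by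
    rw [vecTensor, TensorProduct.zero_tmul, map_zero]
  have z3 : ∀ η : M, vecTensor η (0 : L) = 0 := fun ξ => by
    rw [vecTensor, TensorProduct.tmul_zero, map_zero]
  have z4 : ∀ ξ : L, vecTensor (0 : M) ξ = 0 := fun η => by
    rw [vecTensor, TensorProduct.zero_tmul, map_zero]
  constructor
  · rw [braiding, sum_apply, Finset.sum_eq_single p,
      sum_apply, Finset.sum_eq_single q]
    · simp [opTensor_vecTensor, tensorFlip_vecTensor, spectralProj_apply hω π hξ,
        spectralProj_apply hω σ hη]
    · intro q' _ hq
      simp [opTensor_vecTensor, spectralProj_apply hω σ hη, Ne.symm hq, z1]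
    · simp
    · intro p' _ hp
      rw [sum_apply]
      refine Finset.sum_eq_zero fun q' _ => ?_
      simp [opTensor_vecTensor, spectralProj_apply hω π hξ, Ne.symm hp, z2]
    · simp
  · rw [dualBraiding, sum_apply, Finset.sum_eq_single p,
      sum_apply, Finset.sum_eq_single q]
    · simp [opTensor_vecTensor, tensorFlip_vecTensor, spectralProj_apply hω π hξ,
        spectralProj_apply hω σ hη]
    · intro q' _ hq
      simp [opTensor_vecTensor, spectralProj_apply hω σ hη, Ne.symm hq, z4]
    · simp
    · intro p' _ hp
      rw [sum_apply]
      refine Finset.sum_eq_zero fun q' _ => ?_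
      simp [opTensor_vecTensor, spectralProj_apply hω π hξ, Ne.symm hp, z3]
    · simp

end Hilbert

/-! ### Equivariant representations and bosonization -/

/-- A faithful `ℤ/N`-equivariant representation of a `ℤ/N`-C*-algebra `(X, ρ)` on a Hilbert space
`L` with a unitary representation of `ℤ/N`. -/
structure EquivariantRep {N : ℕ} [NeZero N] {X : Type*} [CStarAlgebra X] (ρ : CyclicCoaction N X)
    (L : Type*) [NormedAddCommGroup L] [InnerProductSpace ℂ L] [CompleteSpace L] where
  /-- The representation of `ℤ/N`. -/
  rep : CyclicRep N L
  /-- The representation of `X`. -/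
  hom : X →⋆ₐ[ℂ] (L →L[ℂ] L)
  injective : Function.Injective hom
  equivariant : ∀ (t : ZMod N) (x : X), hom (ρ.hom x t) = rep.op t * hom x * star (rep.op t)

section Bosonization

variable {N : ℕ} [NeZero N] {X Y : Type*} [CStarAlgebra X] [CStarAlgebra Y]
  {ρ : CyclicCoaction N X} {τ : CyclicCoaction N Y}
  {L M K : Type*} [NormedAddCommGroup L] [InnerProductSpace ℂ L] [CompleteSpace L]
  [NormedAddCommGroup M] [InnerProductSpace ℂ M] [CompleteSpace M]
  [NormedAddCommGroup K] [InnerProductSpace ℂ K] [CompleteSpace K]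

/-- The braided tensor product `X ⊠ Y` of two represented `ℤ/N`-C*-algebras. -/
abbrev boxTensor (ω : ℂ) (r : EquivariantRep ρ L) (s : EquivariantRep τ M) :
    StarSubalgebra ℂ (HTensor L M →L[ℂ] HTensor L M) :=
  braidedTensor ω r.rep s.rep r.hom.range s.hom.range

/-- The embedding `j₁ : X → X ⊠ Y`. -/
def j₁ (ω : ℂ) (r : EquivariantRep ρ L) (s : EquivariantRep τ M) (x : X) : boxTensor ω r s :=
  braidedTensor.left (r.hom.rangeRestrict x)

/-- The embedding `j₂ : Y → X ⊠ Y`. -/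
def j₂ (ω : ℂ) (r : EquivariantRep ρ L) (s : EquivariantRep τ M) (y : Y) : boxTensor ω r s :=
  braidedTensor.right (s.hom.rangeRestrict y)

/-- The iterated braided tensor product `X ⊠ (Y ⊠ Y)`. -/
abbrev tripleTensor (ω : ℂ) (r : EquivariantRep ρ L) (s : EquivariantRep τ M) :
    StarSubalgebra ℂ (HTensor L (HTensor M M) →L[ℂ] HTensor L (HTensor M M)) :=
  braidedTensor ω r.rep (s.rep.tensor s.rep) r.hom.range (boxTensor ω s s)

/-- `Δ_B` is the comultiplication of the bosonization of `(X, ρ, Δ)`: the composition of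
`Φ = id ⊠ Δ : C(ℤ/N) ⊠ X → C(ℤ/N) ⊠ X ⊠ X` with the homomorphism
`Ψ : C(ℤ/N) ⊠ X ⊠ X → (C(ℤ/N) ⊠ X) ⊗ (C(ℤ/N) ⊠ X)` determined by
`Ψ j₁(f) = (j₁ ⊗ j₁) Δ_{ℤ/N}(f)`, `Ψ j₂(x) = (j₂ ⊗ j₁) ρ(x)` and `Ψ j₃(x) = 1 ⊗ j₂(x)`.
Elements of `A ⊗ C(ℤ/N)` are written as `∑ t, a_t ⊗ δ_t`. -/
def IsBosonizationComult (ω : ℂ) (r : EquivariantRep (cyclicCoaction N) L)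
    (s : EquivariantRep ρ M) (Δ : X →⋆ₐ[ℂ] boxTensor ω s s)
    (Δ_B : boxTensor ω r s →⋆ₐ[ℂ] spatialTensor (boxTensor ω r s) (boxTensor ω r s)) : Prop :=
  ∃ (Φ : boxTensor ω r s →⋆ₐ[ℂ] tripleTensor ω r s)
    (Ψ : tripleTensor ω r s →⋆ₐ[ℂ] spatialTensor (boxTensor ω r s) (boxTensor ω r s)),
    (∀ (f : ZMod N → ℂ) (x : X), Φ (j₁ ω r s f * j₂ ω r s x) =
      braidedTensor.left (r.hom.rangeRestrict f) * braidedTensor.right (Δ x)) ∧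
    (∀ f : ZMod N → ℂ, (Ψ (braidedTensor.left (r.hom.rangeRestrict f))).1 =
      ∑ t : ZMod N, opTensor (j₁ ω r s ((cyclicCoaction N).hom f t)).1
        (j₁ ω r s (Pi.single t 1)).1) ∧
    (∀ x : X, (Ψ (braidedTensor.right (j₁ ω s s x))).1 =
      ∑ t : ZMod N, opTensor (j₂ ω r s (ρ.hom x t)).1 (j₁ ω r s (Pi.single t 1)).1) ∧
    (∀ x : X, (Ψ (braidedTensor.right (j₂ ω s s x))).1 = opTensor 1 (j₂ ω r s x).1) ∧
    Δ_B = Ψ.comp Φ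

end Bosonization

/-! ### The anyonic free unitary quantum group and the relations of its bosonization -/

/-- `Δ` is the comultiplication of the anyonic free unitary quantum group: the equivariant
homomorphism with `Δ(u_ij) = ∑ k, j₁(u_ik) j₂(u_kj)`. -/
def IsFreeUnitaryComult {N : ℕ} [NeZero N] {ω : ℂ} (hω : IsPrimitiveRoot ω N)
    {M : Type*} [NormedAddCommGroup M] [InnerProductSpace ℂ M] [CompleteSpace M]
    (s : EquivariantRep (freeUnitaryCoaction hω) M)
    (Δ : FreeUnitary N ω →⋆ₐ[ℂ] boxTensor ω s s) : Prop :=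
  (∀ i j, Δ (FreeUnitary.u N ω i j) =
    ∑ k, j₁ ω s s (FreeUnitary.u N ω i k) * j₂ ω s s (FreeUnitary.u N ω k j)) ∧
  ∀ (t : ZMod N) (x : FreeUnitary N ω), (Δ ((freeUnitaryCoaction hω).hom x t)).1 =
    (s.rep.tensor s.rep).op t * (Δ x).1 * star ((s.rep.tensor s.rep).op t)

/-- The relations: `z` is unitary with `z ^ N = 1`, `z u_ij = ω ^ (j - i) u_ij z`, and the matrices
`u` and `(ω ^ (-i (j - i)) u_ij^*)` are unitary. -/
structure BosonizationRelations {N : ℕ} [NeZero N] (ω : ℂ) {B : Type*} [Ring B] [StarRing B]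
    [Algebra ℂ B] (z : B) (u : Matrix (ZMod N) (ZMod N) B) : Prop where
  mul_star : z * star z = 1
  star_mul : star z * z = 1
  pow : z ^ N = 1
  comm : ∀ i j, z * u i j = rootPow ω (j - i) • (u i j * z)
  unitary : IsAnyonicUnitary ω u

/-- `B` is the universal unital C*-algebra generated by `z` and `u_ij` subject to these
relations. -/
structure IsUniversalBosonization.{u, w} {N : ℕ} [NeZero N] (ω : ℂ) {B : Type u} [CStarAlgebra B] (z : B)
    (u : Matrix (ZMod N) (ZMod N) B) : Prop where
  relations : BosonizationRelations ω z u
  generates : (StarAlgebra.adjoin ℂ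
    ({z} ∪ {b | ∃ i j, b = u i j})).topologicalClosure = ⊤
  universal : ∀ (D : Type w) [CStarAlgebra D] (z' : D) (u' : Matrix (ZMod N) (ZMod N) D),
    BosonizationRelations ω z' u' →
      ∃! φ : B →⋆ₐ[ℂ] D, φ z = z' ∧ ∀ i j, φ (u i j) = u' i j

end Anyonic

end

universe u v w

open Anyonic

/-!
For commuting unitary representations of `ℤ/N`, the bicharacter `ω ^ (p q)` defines a unitary, which
composed with the flip is the braiding `c`. Conjugating by it gives `j₂ y = π (-e) ⊗ y` for `y` of
degree `e`, where `π` is the representation on the left leg, and the unitaries `j₁ χ_k` of the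
characters of `ℤ/N` implement on `j₂ X` the action that corresponds to the coaction of `X`.
Conjugation by `π ⊗ 1` fixes `j₂ X` and scales `j₁ χ_k` by characters, so taking spectral components
shows that `∑ j₂ x_k · j₁ χ_k` determines the `x_k` and that these sums form a closed `*`-algebra.
Hence `C(ℤ/N) ⊠ X` is the crossed product of `X` by `ℤ/N`, which gives both the universal property
of the bosonization and the homomorphism `id ⊠ Δ`.

The homomorphism `ψ` extends to all bounded operators: distribute the three tensor legs over the two
copies of `L ⊗ M`, then conjugate by two bicharacter unitaries. On the images of elements `x` of
degree `d` in the first two legs it is `j x ↦ j x ⊗ j₁ χ_d`, and the formula for the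
comultiplication is read off from the degrees `k - i` of the `u i k`.
-/

noncomputable section

namespace Anyonic

open scoped CStarAlgebra

variable {N : ℕ} {ω : ℂ}

/-! ### Unitary representations and bicharacters -/

theorem rootPow_zero : rootPow ω (0 : ZMod N) = 1 := by
  rw [rootPow, ZMod.val_zero, pow_zero]

/-- The vector `v` is homogeneous of degree `d` for the representation `α` of `ℤ/N`, that is, `ℤ/N`
acts on it through the character `t ↦ ω ^ (t d)`. -/
def IsHomogeneous {V : Type*} [AddCommGroup V] [Module ℂ V] (ω : ℂ)
    (α : Representation ℂ (Multiplicative (ZMod N)) V) (d : ZMod N) (v : V) : Prop :=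
  ∀ t, α (.ofAdd t) v = rootPow ω (t * d) • v

theorem IsHomogeneous.sum {V ι : Type*} [AddCommGroup V] [Module ℂ V]
    {α : Representation ℂ (Multiplicative (ZMod N)) V} {d : ZMod N} {s : Finset ι} {v : ι → V}
    (h : ∀ i ∈ s, IsHomogeneous ω α d (v i)) : IsHomogeneous ω α d (∑ i ∈ s, v i) := fun t => by
  rw [map_sum, Finset.smul_sum]
  exact Finset.sum_congr rfl fun i hi => h i hi t

section UnitaryRepresentations

theorem coe_map_inv {G B : Type*} [Group G] [Ring B] [StarRing B]
    (u : G →* unitary B) (g : G) :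
    (u g⁻¹ : B) = star (u g : B) := by
  rw [map_inv]
  rfl

theorem commute_coe_rep {G B : Type*} [CommMonoid G] [Ring B] [StarRing B] (u : G →* unitary B)
    (g h : G) : Commute (u g : B) (u h) :=
  congrArg Subtype.val ((Commute.all g h).map u).eq

variable {G B : Type*} [Monoid G] [Ring B] [StarRing B] [Algebra ℂ B]

/-- The representation on a `B`-module given by a unitary representation in `B`. -/
def smulRep (u : G →* unitary B) (V : Type*) [AddCommGroup V] [Module ℂ V]
    [Module B V] [IsScalarTower ℂ B V] : Representation ℂ G V :=
  ((Algebra.lsmul ℂ ℂ V : B →ₐ[ℂ] Module.End ℂ V) : B →* Module.End ℂ V).comp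
    ((unitary B).subtype.comp u)

/-- The action on `B` by conjugation with a unitary representation in `B`. -/
def conjRep (u : G →* unitary B) : Representation ℂ G B where
  toFun g := LinearMap.mulLeftRight ℂ ((u g : B), star (u g : B))
  map_one' := by ext; simp
  map_mul' g h := by ext; simp [mul_assoc]

theorem smulRep_apply {V : Type*} [AddCommGroup V] [Module ℂ V] [Module B V]
    [IsScalarTower ℂ B V] (u : G →* unitary B) (g : G) (x : V) :
    smulRep u V g x = (u g : B) • x := rfl

theorem conjRep_apply (u : G →* unitary B) (g : G) (b : B) :
    conjRep u g b = u g * b * star (u g : B) := rfl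

/-- Conjugation by a unitary element, as a homomorphism. -/
def conjHom (c : unitary B) : B →⋆ₐ[ℂ] B :=
  ((Unitary.conjStarAlgAut ℂ B c : B ≃⋆ₐ[ℂ] B) : B →⋆ₐ[ℂ] B)

theorem conjHom_apply (c : unitary B) (b : B) : conjHom c b = c * b * star (c : B) := rfl

theorem conjHom_injective (c : unitary B) : Function.Injective (conjHom c) :=
  (Unitary.conjStarAlgAut ℂ B c).injective

theorem isHomogeneous_conjRep_iff {u : Multiplicative (ZMod N) →* unitary B} {d : ZMod N} {b : B} :
    IsHomogeneous ω (conjRep u) d b ↔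
      ∀ t, (u (.ofAdd t) : B) * b = rootPow ω (t * d) • (b * u (.ofAdd t)) := by
  refine forall_congr' fun t => ?_
  rw [conjRep_apply, ← smul_mul_assoc]
  constructor <;> intro h
  · rw [← h, mul_assoc, Unitary.coe_star_mul_self, mul_one]
  · rw [h, mul_assoc, Unitary.mul_star_self_of_mem (u _).2, mul_one]

theorem isHomogeneous_conjRep_zero_iff {u : Multiplicative (ZMod N) →* unitary B} {b : B} :
    IsHomogeneous ω (conjRep u) 0 b ↔ ∀ g, Commute (u g : B) b := by
  simp only [isHomogeneous_conjRep_iff, mul_zero, rootPow_zero, one_smul]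
  exact Multiplicative.ofAdd.forall_congr_left

variable {A : Type*} [Ring A] [StarRing A] [Algebra ℂ A]

/-- The image of a unitary representation under a `*`-homomorphism. -/
def mapRep (f : A →⋆ₐ[ℂ] B) (u : G →* unitary A) : G →* unitary B :=
  (Unitary.map (⟨f, map_star f⟩ : A →⋆* B)).toMonoidHom.comp u

theorem coe_mapRep (f : A →⋆ₐ[ℂ] B) (u : G →* unitary A) (g : G) :
    (mapRep f u g : B) = f (u g) := rfl

theorem IsHomogeneous.mapRep {u : Multiplicative (ZMod N) →* unitary A} {d : ZMod N} {a : A}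
    (ha : IsHomogeneous ω (conjRep u) d a) (f : A →⋆ₐ[ℂ] B) :
    IsHomogeneous ω (conjRep (Anyonic.mapRep f u)) d (f a) :=
  isHomogeneous_conjRep_iff.2 fun t => by
    rw [coe_mapRep, ← map_mul, isHomogeneous_conjRep_iff.1 ha, map_smul, map_mul]

end UnitaryRepresentations

variable [NeZero N]

theorem star_rootPow (hω : IsPrimitiveRoot ω N) (a : ZMod N) :
    star (rootPow ω a) = rootPow ω (-a) :=
  (rootPow_neg hω a).symm

theorem inv_mul_sum_rootPow (hω : IsPrimitiveRoot ω N) (a : ZMod N) :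
    (N : ℂ)⁻¹ * ∑ t : ZMod N, rootPow ω (t * a) = if a = 0 then 1 else 0 := by
  rw [sum_rootPow hω, mul_ite, mul_zero, inv_mul_cancel₀ (NeZero.ne _)]

section CyclicRepresentations

variable {B : Type*} [Ring B] [StarRing B]

/-- The representation `k ↦ z ^ k` of `ℤ/N` given by a unitary element with `z ^ N = 1`. -/
def powRep {z : B} (hz : z ∈ unitary B) (hzN : z ^ N = 1) :
    Multiplicative (ZMod N) →* unitary B where
  toFun k := ⟨z, hz⟩ ^ (k.toAdd : ZMod N).val
  map_one' := by rw [toAdd_one, ZMod.val_zero, pow_zero]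
  map_mul' k l := by
    have h : (⟨z, hz⟩ : unitary B) ^ N = 1 := Subtype.ext hzN
    rw [toAdd_mul, ZMod.val_add, ← pow_eq_pow_mod _ h, pow_add]

theorem powRep_one {z : B} (hz : z ∈ unitary B)
    (hzN : z ^ N = 1) : (powRep hz hzN (.ofAdd 1) : B) = z := by
  change z ^ (1 : ZMod N).val = z
  obtain rfl | hN := eq_or_ne N 1
  · rw [← pow_one z, hzN, one_pow]
  · have : Fact (1 < N) := ⟨by have := NeZero.ne N; omega⟩
    rw [ZMod.val_one, pow_one]

theorem coe_eq_pow (v : Multiplicative (ZMod N) →* unitary B) (k : ZMod N) :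
    (v (.ofAdd k) : B) = (v (.ofAdd 1) : B) ^ k.val := by
  rw [← SubmonoidClass.coe_pow, ← map_pow, ← ofAdd_nsmul, nsmul_one, ZMod.natCast_zmod_val]

theorem IsHomogeneous.mul (hω : IsPrimitiveRoot ω N) [Algebra ℂ B]
    {u : Multiplicative (ZMod N) →* unitary B} {d e : ZMod N} {a b : B}
    (ha : IsHomogeneous ω (conjRep u) d a) (hb : IsHomogeneous ω (conjRep u) e b) :
    IsHomogeneous ω (conjRep u) (d + e) (a * b) :=
  isHomogeneous_conjRep_iff.2 fun t => by
    rw [← mul_assoc, isHomogeneous_conjRep_iff.1 ha, smul_mul_assoc, mul_assoc,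
      isHomogeneous_conjRep_iff.1 hb, mul_smul_comm, smul_smul, mul_assoc, mul_add, rootPow_add hω]

theorem isHomogeneous_conjRep_iff_generator (hω : IsPrimitiveRoot ω N) [Algebra ℂ B]
    {v : Multiplicative (ZMod N) →* unitary B} {d : ZMod N} {b : B} :
    IsHomogeneous ω (conjRep v) d b ↔
      (v (.ofAdd 1) : B) * b = rootPow ω d • (b * v (.ofAdd 1)) := by
  rw [isHomogeneous_conjRep_iff]
  refine ⟨fun h => one_mul d ▸ h 1, fun h t => ?_⟩
  have hpow (n : ℕ) : (v (.ofAdd 1) : B) ^ n * b =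
      rootPow ω ((n : ZMod N) * d) • (b * (v (.ofAdd 1) : B) ^ n) := by
    induction n with
    | zero => rw [pow_zero, one_mul, mul_one, Nat.cast_zero, zero_mul, rootPow_zero, one_smul]
    | succ n ih =>
      rw [pow_succ, mul_assoc, h, mul_smul_comm, ← mul_assoc, ih, smul_mul_assoc, smul_smul,
        ← rootPow_add hω, mul_assoc, Nat.cast_succ, add_one_mul, add_comm d]
  rw [coe_eq_pow, hpow, ZMod.natCast_zmod_val]

end CyclicRepresentations

section Spectral

variable {V W : Type*} [AddCommGroup V] [Module ℂ V] [AddCommGroup W] [Module ℂ W]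
  {α : Representation ℂ (Multiplicative (ZMod N)) V}

/-- The projection onto the homogeneous vectors of degree `d`. -/
def spectralPart (ω : ℂ) (α : Representation ℂ (Multiplicative (ZMod N)) V) (d : ZMod N) :
    V →ₗ[ℂ] V :=
  (N : ℂ)⁻¹ • ∑ t, rootPow ω (-(t * d)) • α (.ofAdd t)

theorem spectralPart_apply (d : ZMod N) (v : V) :
    spectralPart ω α d v = (N : ℂ)⁻¹ • ∑ t, rootPow ω (-(t * d)) • α (.ofAdd t) v := by
  simp only [spectralPart, LinearMap.smul_apply, LinearMap.sum_apply]

theorem isHomogeneous_spectralPart (hω : IsPrimitiveRoot ω N) (d : ZMod N) (v : V) :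
    IsHomogeneous ω α d (spectralPart ω α d v) := fun t => by
  rw [spectralPart_apply, map_smul, smul_comm, map_sum, Finset.smul_sum (r := rootPow ω (t * d)),
    ← Equiv.sum_comp (Equiv.addLeft t) fun s => rootPow ω (t * d) • _]
  congr 1
  refine Finset.sum_congr rfl fun s _ => ?_
  rw [map_smul, ← Module.End.mul_apply, ← map_mul, ← ofAdd_add, smul_smul, Equiv.coe_addLeft,
    ← rootPow_add hω]
  congr 2
  ring

theorem IsHomogeneous.spectralPart_eq (hω : IsPrimitiveRoot ω N) {d : ZMod N} {v : V}
    (hv : IsHomogeneous ω α d v) (c : ZMod N) :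
    spectralPart ω α c v = if d = c then v else 0 := by
  have h t : rootPow ω (-(t * c)) • α (.ofAdd t) v = rootPow ω (t * (d - c)) • v := by
    rw [hv t, smul_smul, ← rootPow_add hω, mul_sub, neg_add_eq_sub]
  rw [spectralPart_apply, Finset.sum_congr rfl fun t _ => h t, ← Finset.sum_smul, smul_smul,
    inv_mul_sum_rootPow hω]
  simp only [ite_smul, one_smul, zero_smul, sub_eq_zero]

theorem sum_spectralPart (hω : IsPrimitiveRoot ω N) (v : V) : ∑ d, spectralPart ω α d v = v := by
  have h (t : ZMod N) :
      (N : ℂ)⁻¹ * ∑ d : ZMod N, rootPow ω (-(t * d)) = if t = 0 then 1 else 0 := by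
    simpa only [mul_neg, mul_comm, neg_eq_zero] using inv_mul_sum_rootPow hω (-t)
  simp only [spectralPart_apply]
  rw [← Finset.smul_sum, Finset.sum_comm]
  simp only [← Finset.sum_smul, Finset.smul_sum, smul_smul, h, ite_smul, one_smul, zero_smul,
    Finset.sum_ite_eq', Finset.mem_univ, if_true, ofAdd_zero, map_one, Module.End.one_apply]

theorem isHomogeneous_induction (hω : IsPrimitiveRoot ω N)
    (α : Representation ℂ (Multiplicative (ZMod N)) V) {P : V → Prop}
    (add : ∀ v w, P v → P w → P (v + w)) (homogeneous : ∀ d v, IsHomogeneous ω α d v → P v)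
    (v : V) : P v := by
  rw [← sum_spectralPart hω v (α := α)]
  refine Finset.sum_induction _ P add (homogeneous 0 0 fun t => ?_) fun d _ =>
    homogeneous d _ (isHomogeneous_spectralPart hω d v)
  rw [map_zero, smul_zero]

theorem linearMap_ext_of_isHomogeneous (hω : IsPrimitiveRoot ω N)
    (α : Representation ℂ (Multiplicative (ZMod N)) V) {f g : V →ₗ[ℂ] W}
    (h : ∀ d v, IsHomogeneous ω α d v → f v = g v) : f = g :=
  LinearMap.ext <| isHomogeneous_induction hω α
    (fun v w hv hw => by rw [map_add, map_add, hv, hw]) h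

end Spectral

section Bicharacter

variable {B V : Type*} [Ring B] [StarRing B] [Algebra ℂ B]
  [AddCommGroup V] [Module ℂ V] [Module B V] [IsScalarTower ℂ B V]
  {u v : Multiplicative (ZMod N) →* unitary B}

/-- The unitary attached to the bicharacter `ω ^ (p q)` of `ℤ/N` and two commuting unitary
representations: it acts by `ω ^ (p q)` on vectors of degree `p` for `u` and `q` for `v`. -/
def bichar (ω : ℂ) (u v : Multiplicative (ZMod N) →* unitary B) : B :=
  (N : ℂ)⁻¹ • ∑ s, ∑ t, rootPow ω (-(s * t)) • ((u (.ofAdd s) : B) * v (.ofAdd t))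

theorem bichar_comm (huv : ∀ g h, Commute (u g : B) (v h)) : bichar ω u v = bichar ω v u := by
  rw [bichar, bichar, Finset.sum_comm]
  simp only [mul_comm, (huv _ _).eq]

theorem bichar_smul (hω : IsPrimitiveRoot ω N) (huv : ∀ g h, Commute (u g : B) (v h)) {p : ZMod N}
    {x : V} (hx : IsHomogeneous ω (smulRep u V) p x) :
    bichar ω u v • x = (v (.ofAdd p) : B) • x := by
  have h (s t : ZMod N) : (rootPow ω (-(s * t)) • ((u (.ofAdd s) : B) * v (.ofAdd t))) • x =
      rootPow ω (s * (p - t)) • (v (.ofAdd t) : B) • x := by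
    rw [smul_assoc, (huv _ _).eq, mul_smul, ← smulRep_apply u, hx, smul_comm _ (rootPow ω _),
      smul_smul, ← rootPow_add hω, mul_sub, neg_add_eq_sub]
  simp only [bichar, smul_assoc, Finset.sum_smul, h]
  rw [Finset.sum_comm]
  simp only [← Finset.sum_smul, Finset.smul_sum, smul_smul, inv_mul_sum_rootPow hω, sub_eq_zero,
    ite_smul, one_smul, zero_smul, Finset.sum_ite_eq, Finset.mem_univ, if_true]

theorem commute_bichar {b : B} (hu : ∀ g, Commute b (u g : B)) (hv : ∀ g, Commute b (v g : B)) :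
    Commute b (bichar ω u v) :=
  (Commute.sum_right _ _ _ fun _ _ => Commute.sum_right _ _ _ fun _ _ =>
    ((hu _).mul_right (hv _)).smul_right _).smul_right _

theorem bichar_mul_of_isHomogeneous_left (hω : IsPrimitiveRoot ω N)
    (huv : ∀ g h, Commute (u g : B) (v h)) {d : ZMod N} {b : B}
    (hb : IsHomogeneous ω (conjRep u) d b) (hvb : ∀ g, Commute (v g : B) b) :
    bichar ω u v * b = b * v (.ofAdd d) * bichar ω u v := by
  have h (s t : ZMod N) :
      rootPow ω (-(s * (t + d))) • ((u (.ofAdd s) : B) * v (.ofAdd (t + d))) * b =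
        b * v (.ofAdd d) * (rootPow ω (-(s * t)) • ((u (.ofAdd s) : B) * v (.ofAdd t))) := by
    have hub : (u (.ofAdd s) : B) * b = rootPow ω (s * d) • (b * u (.ofAdd s)) :=
      isHomogeneous_conjRep_iff.1 hb s
    have hv : (v (.ofAdd (t + d)) : B) = v (.ofAdd d) * v (.ofAdd t) := by
      rw [add_comm, ofAdd_add, map_mul, Submonoid.coe_mul]
    rw [smul_mul_assoc, mul_assoc, (hvb _).eq, ← mul_assoc, hub, smul_mul_assoc, smul_smul,
      ← rootPow_add hω, mul_smul_comm, hv]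
    congr 1
    · congr 1
      ring
    · rw [mul_assoc, mul_assoc, (huv _ _).left_comm]
  rw [bichar, smul_mul_assoc, mul_smul_comm, Finset.sum_mul, Finset.mul_sum]
  congr 1
  refine Finset.sum_congr rfl fun s _ => ?_
  rw [Finset.mul_sum, Finset.sum_mul, ← Equiv.sum_comp (Equiv.addRight d)]
  exact Finset.sum_congr rfl fun t _ => h s t

variable [StarModule ℂ B]

theorem star_bichar (hω : IsPrimitiveRoot ω N)
    (huv : ∀ g h, Commute (u g : B) (v h)) :
    star (bichar ω u v) = bichar ω u (v.comp invMonoidHom) := by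
  have h (s t : ZMod N) : star (rootPow ω (-(s * t)) • ((u (.ofAdd s) : B) * v (.ofAdd t))) =
      rootPow ω (-(-s * t)) • ((u (.ofAdd (-s)) : B) * v (.ofAdd (-t))) := by
    rw [star_smul, star_mul, ← coe_map_inv, ← coe_map_inv, (huv _ _).eq, star_rootPow hω, neg_mul]
    rfl
  simp only [bichar, star_smul, star_sum, h, star_inv₀, star_natCast]
  exact congrArg ((N : ℂ)⁻¹ • ·) (Equiv.sum_comp (Equiv.neg (ZMod N)) fun s =>
    ∑ t, rootPow ω (-(s * t)) • ((u (.ofAdd s) : B) * v (.ofAdd (-t))))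

theorem star_bichar_mul_self (hω : IsPrimitiveRoot ω N)
    (huv : ∀ g h, Commute (u g : B) (v h)) : star (bichar ω u v) * bichar ω u v = 1 := by
  have key : LinearMap.mulLeft ℂ (star (bichar ω u v) * bichar ω u v) = LinearMap.id := by
    refine linearMap_ext_of_isHomogeneous hω (smulRep u B) fun p b hb => ?_
    have hvb : IsHomogeneous ω (smulRep u B) p ((v (.ofAdd p) : B) * b) := fun t => by
      rw [smulRep_apply, smul_eq_mul, (huv _ _).left_comm, ← smul_eq_mul (u _ : B),
        ← smulRep_apply u, hb, mul_smul_comm]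
    have hCb : bichar ω u v * b = v (.ofAdd p) * b := bichar_smul hω huv hb
    have hCvb : bichar ω u (v.comp invMonoidHom) * (v (.ofAdd p) * b) =
        v (.ofAdd p)⁻¹ * (v (.ofAdd p) * b) := bichar_smul hω (fun g h => huv g h⁻¹) hvb
    rw [LinearMap.mulLeft_apply, mul_assoc, hCb, star_bichar hω huv, hCvb, coe_map_inv,
      ← mul_assoc, Unitary.coe_star_mul_self, one_mul, LinearMap.id_apply]
  simpa only [LinearMap.mulLeft_apply, mul_one, LinearMap.id_apply] using LinearMap.congr_fun key 1

theorem bichar_mem_unitary (hω : IsPrimitiveRoot ω N)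
    (huv : ∀ g h, Commute (u g : B) (v h)) : bichar ω u v ∈ unitary B := by
  have hinv : (v.comp invMonoidHom).comp invMonoidHom = v :=
    MonoidHom.ext fun g => congrArg v (inv_inv g)
  have h := star_bichar_mul_self (v := v.comp invMonoidHom) hω fun g h => huv g h⁻¹
  rw [star_bichar hω fun g h => huv g h⁻¹, hinv, ← star_bichar hω huv] at h
  exact ⟨star_bichar_mul_self hω huv, h⟩

/-- Conjugation by the bicharacter unitary of two commuting representations. -/
def conjBichar (hω : IsPrimitiveRoot ω N) (huv : ∀ g h, Commute (u g : B) (v h)) : B →⋆ₐ[ℂ] B :=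
  conjHom ⟨bichar ω u v, bichar_mem_unitary hω huv⟩

theorem conjBichar_apply (hω : IsPrimitiveRoot ω N) (huv : ∀ g h, Commute (u g : B) (v h)) (b : B) :
    conjBichar hω huv b = bichar ω u v * b * star (bichar ω u v) := rfl

theorem conjBichar_of_commute (hω : IsPrimitiveRoot ω N) (huv : ∀ g h, Commute (u g : B) (v h))
    {b : B} (hub : ∀ g, Commute (u g : B) b) (hvb : ∀ g, Commute (v g : B) b) :
    conjBichar hω huv b = b := by
  rw [conjBichar_apply, ← (commute_bichar (fun g => (hub g).symm) fun g => (hvb g).symm).eq,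
    mul_assoc, Unitary.mul_star_self_of_mem (bichar_mem_unitary hω huv), mul_one]

theorem conjBichar_of_isHomogeneous_left (hω : IsPrimitiveRoot ω N)
    (huv : ∀ g h, Commute (u g : B) (v h)) {d : ZMod N} {b : B}
    (hb : IsHomogeneous ω (conjRep u) d b) (hvb : ∀ g, Commute (v g : B) b) :
    conjBichar hω huv b = b * v (.ofAdd d) := by
  rw [conjBichar_apply, bichar_mul_of_isHomogeneous_left hω huv hb hvb, mul_assoc,
    Unitary.mul_star_self_of_mem (bichar_mem_unitary hω huv), mul_one]

theorem conjBichar_of_isHomogeneous_right (hω : IsPrimitiveRoot ω N)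
    (huv : ∀ g h, Commute (u g : B) (v h)) {d : ZMod N} {b : B}
    (hb : IsHomogeneous ω (conjRep v) d b) (hub : ∀ g, Commute (u g : B) b) :
    conjBichar hω huv b = b * u (.ofAdd d) := by
  rw [conjBichar_apply, bichar_comm huv]
  exact conjBichar_of_isHomogeneous_left hω (fun g h => (huv h g).symm) hb hub

theorem star_bichar_conj_of_isHomogeneous_right (hω : IsPrimitiveRoot ω N)
    (huv : ∀ g h, Commute (u g : B) (v h)) {d : ZMod N} {b : B}
    (hb : IsHomogeneous ω (conjRep v) d b) (hub : ∀ g, Commute (u g : B) b) :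
    star (bichar ω u v) * b * bichar ω u v = u (.ofAdd (-d)) * b := by
  have hC := Unitary.star_mul_self_of_mem (bichar_mem_unitary hω huv)
  have hb' : IsHomogeneous ω (conjRep v) d (u (.ofAdd (-d)) * b) :=
    isHomogeneous_conjRep_iff.2 fun t => by
      rw [← (huv _ _).left_comm, isHomogeneous_conjRep_iff.1 hb, mul_smul_comm, mul_assoc]
  have hconj : conjBichar hω huv (u (.ofAdd (-d)) * b) = b := by
    rw [conjBichar_of_isHomogeneous_right hω huv hb' fun g =>
      (commute_coe_rep u _ _).mul_right (hub g), mul_assoc, ← (hub _).eq, ← mul_assoc, ofAdd_neg,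
      coe_map_inv, Unitary.coe_star_mul_self, one_mul]
  calc star (bichar ω u v) * b * bichar ω u v
      = star (bichar ω u v) * (bichar ω u v * (u (.ofAdd (-d)) * b) * star (bichar ω u v)) *
          bichar ω u v := by rw [← conjBichar_apply hω huv, hconj]
    _ = star (bichar ω u v) * bichar ω u v * (u (.ofAdd (-d)) * b) *
          (star (bichar ω u v) * bichar ω u v) := by simp only [mul_assoc]
    _ = u (.ofAdd (-d)) * b := by rw [hC, one_mul, mul_one]

end Bicharacter

/-! ### The braiding -/

section OperatorTensor

variable {L L' M M' : Type*}
  [NormedAddCommGroup L] [InnerProductSpace ℂ L] [NormedAddCommGroup L'] [InnerProductSpace ℂ L']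
  [NormedAddCommGroup M] [InnerProductSpace ℂ M] [NormedAddCommGroup M'] [InnerProductSpace ℂ M']

variable (L M) in
/-- The bilinear map `(ξ, η) ↦ ξ ⊗ η` into the Hilbert space tensor product. -/
def vecTensorₗ : L →ₗ[ℂ] M →ₗ[ℂ] HTensor L M :=
  (TensorProduct.mk ℂ L M).compr₂ (tensorEmb L M).toLinearMap

theorem vecTensorₗ_apply (ξ : L) (η : M) : vecTensorₗ L M ξ η = vecTensor ξ η := rfl

theorem norm_vecTensor (ξ : L) (η : M) : ‖vecTensor ξ η‖ = ‖ξ‖ * ‖η‖ := by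
  rw [vecTensor, LinearIsometry.norm_map, TensorProduct.norm_tmul]

theorem continuous_vecTensor : Continuous fun p : L × M => vecTensor p.1 p.2 :=
  (LinearMap.mkContinuous₂ (vecTensorₗ L M) 1 fun ξ η => by
    rw [vecTensorₗ_apply, norm_vecTensor, one_mul]).continuous₂

theorem opTensor_vecTensorₗ (S : L →L[ℂ] L') (T : M →L[ℂ] M') (ξ : L) (η : M) :
    opTensor S T (vecTensorₗ L M ξ η) = vecTensorₗ L' M' (S ξ) (T η) :=
  opTensor_vecTensor S T ξ η

theorem opTensor_mul (a b : L →L[ℂ] L) (c d : M →L[ℂ] M) :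
    opTensor a c * opTensor b d = opTensor (a * b) (c * d) := opTensor_comp _ _ _ _

theorem commute_opTensor {a a' : L →L[ℂ] L} {b b' : M →L[ℂ] M} (ha : Commute a a')
    (hb : Commute b b') : Commute (opTensor a b) (opTensor a' b') := by
  rw [commute_iff_eq, opTensor_mul, opTensor_mul, ha.eq, hb.eq]

/-- The bilinear map `(S, T) ↦ S ⊗ T` on bounded operators. -/
def opTensorₗ : (L →L[ℂ] L') →ₗ[ℂ] (M →L[ℂ] M') →ₗ[ℂ] (HTensor L M →L[ℂ] HTensor L' M') :=
  LinearMap.mk₂ ℂ opTensor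
    (fun a b c => op_ext fun ξ η => by
      simp only [← vecTensorₗ_apply, opTensor_vecTensorₗ, add_apply, map_add, LinearMap.add_apply])
    (fun k a c => op_ext fun ξ η => by
      simp only [← vecTensorₗ_apply, opTensor_vecTensorₗ, smul_apply, map_smul,
        LinearMap.smul_apply])
    (fun a c d => op_ext fun ξ η => by
      simp only [← vecTensorₗ_apply, opTensor_vecTensorₗ, add_apply, map_add])
    (fun k a c => op_ext fun ξ η => by
      simp only [← vecTensorₗ_apply, opTensor_vecTensorₗ, smul_apply, map_smul])

theorem opTensorₗ_apply (a : L →L[ℂ] L') (c : M →L[ℂ] M') : opTensorₗ a c = opTensor a c := rfl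

theorem opTensor_smul_smul (c d : ℂ) (a : L →L[ℂ] L') (b : M →L[ℂ] M') :
    opTensor (c • a) (d • b) = (c * d) • opTensor a b := by
  simp only [← opTensorₗ_apply, map_smul, LinearMap.smul_apply, smul_smul, mul_comm]

variable [CompleteSpace L] [CompleteSpace M]

variable (L M) in
/-- The homomorphism `a ↦ a ⊗ 1`. -/
def inlHom : (L →L[ℂ] L) →⋆ₐ[ℂ] (HTensor L M →L[ℂ] HTensor L M) where
  toFun a := opTensor a 1
  map_one' := opTensor_one
  map_mul' a b := by rw [opTensor_mul, one_mul]
  map_zero' := by rw [← opTensorₗ_apply, map_zero, LinearMap.zero_apply]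
  map_add' a b := by simp only [← opTensorₗ_apply, map_add, LinearMap.add_apply]
  commutes' c := by
    rw [Algebra.algebraMap_eq_smul_one, Algebra.algebraMap_eq_smul_one, ← opTensorₗ_apply, map_smul,
      LinearMap.smul_apply, opTensorₗ_apply, opTensor_one]
  map_star' a := by rw [opTensor_star, star_one]

variable (L M) in
/-- The homomorphism `b ↦ 1 ⊗ b`. -/
def inrHom : (M →L[ℂ] M) →⋆ₐ[ℂ] (HTensor L M →L[ℂ] HTensor L M) where
  toFun b := opTensor 1 b
  map_one' := opTensor_one
  map_mul' a b := by rw [opTensor_mul, one_mul]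
  map_zero' := by rw [← opTensorₗ_apply, map_zero]
  map_add' a b := by simp only [← opTensorₗ_apply, map_add]
  commutes' c := by
    rw [Algebra.algebraMap_eq_smul_one, Algebra.algebraMap_eq_smul_one, ← opTensorₗ_apply, map_smul,
      opTensorₗ_apply, opTensor_one]
  map_star' a := by rw [opTensor_star, star_one]

theorem inlHom_apply (a : L →L[ℂ] L) : inlHom L M a = opTensor a 1 := rfl

theorem inrHom_apply (b : M →L[ℂ] M) : inrHom L M b = opTensor 1 b := rfl

theorem commute_inlHom_inrHom (a : L →L[ℂ] L) (b : M →L[ℂ] M) :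
    Commute (inlHom L M a) (inrHom L M b) := by
  rw [commute_iff_eq, inlHom_apply, inrHom_apply, opTensor_mul, opTensor_mul]
  simp only [mul_one, one_mul]

theorem inrHom_injective [Nontrivial L] : Function.Injective (inrHom L M) := by
  obtain ⟨ξ, hξ⟩ := exists_ne (0 : L)
  refine (injective_iff_map_eq_zero _).2 fun b hb => ContinuousLinearMap.ext fun η => ?_
  have hzero : vecTensor ξ (b η) = 0 :=
    (opTensor_vecTensor 1 b ξ η).symm.trans (DFunLike.congr_fun hb _)
  have hinner := inner_vecTensor ξ ξ (b η) (b η)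
  rw [hzero, inner_zero_left, eq_comm, mul_eq_zero] at hinner
  exact inner_self_eq_zero.1 (hinner.resolve_left (inner_self_ne_zero.2 hξ))

end OperatorTensor

section Braiding

variable {L M : Type*}
  [NormedAddCommGroup L] [InnerProductSpace ℂ L] [CompleteSpace L]
  [NormedAddCommGroup M] [InnerProductSpace ℂ M] [CompleteSpace M]

instance : IsScalarTower ℂ (L →L[ℂ] L) L := ⟨fun _ _ _ => rfl⟩

theorem commute_inlRep_inrRep {G H : Type*} [Monoid G] [Monoid H] (π : G →* unitary (L →L[ℂ] L))
    (σ : H →* unitary (M →L[ℂ] M)) (g : G) (h : H) :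
    Commute (mapRep (inlHom L M) π g : HTensor L M →L[ℂ] HTensor L M) (mapRep (inrHom L M) σ h) :=
  commute_inlHom_inrHom _ _

theorem coe_tensor {N : ℕ} (π : CyclicRep N L) (σ : CyclicRep N M) (g : Multiplicative (ZMod N)) :
    (π.tensor σ g : HTensor L M →L[ℂ] HTensor L M) = opTensor (π g : L →L[ℂ] L) (σ g : M →L[ℂ] M) :=
  rfl

theorem op_ext_of_isHomogeneous (hω : IsPrimitiveRoot ω N) (π : CyclicRep N L)
    (σ : CyclicRep N M) {K : Type*} [NormedAddCommGroup K] [InnerProductSpace ℂ K]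
    {S T : HTensor L M →L[ℂ] K}
    (h : ∀ p q ξ η, IsHomogeneous ω (smulRep π L) p ξ → IsHomogeneous ω (smulRep σ M) q η →
      S (vecTensor ξ η) = T (vecTensor ξ η)) : S = T := by
  have hST : (vecTensorₗ L M).compr₂ S.toLinearMap = (vecTensorₗ L M).compr₂ T.toLinearMap :=
    linearMap_ext_of_isHomogeneous hω (smulRep π L) fun p ξ hξ =>
      linearMap_ext_of_isHomogeneous hω (smulRep σ M) fun q η hη => h p q ξ η hξ hη
  exact op_ext fun ξ η => LinearMap.congr_fun₂ hST ξ η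

/-- The unitary operator that acts by `ω ^ (p q)` on `ξ ⊗ η` for `ξ` of degree `p` and `η` of
degree `q`; it is the braiding followed by the flip. -/
def braidUnitary (ω : ℂ) (π : CyclicRep N L) (σ : CyclicRep N M) :
    HTensor L M →L[ℂ] HTensor L M :=
  bichar ω (mapRep (inlHom L M) π) (mapRep (inrHom L M) σ)

theorem braidUnitary_vecTensor (hω : IsPrimitiveRoot ω N) (π : CyclicRep N L) (σ : CyclicRep N M)
    {p : ZMod N} {ξ : L} (hξ : IsHomogeneous ω (smulRep π L) p ξ) (η : M) :
    braidUnitary ω π σ (vecTensor ξ η) = vecTensor ξ ((σ (.ofAdd p) : M →L[ℂ] M) η) := by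
  have hξη : IsHomogeneous ω (smulRep (mapRep (inlHom L M) π) (HTensor L M)) p
      (vecTensor ξ η) := fun t => by
    change opTensor _ 1 (vecTensorₗ L M ξ η) = _ • vecTensorₗ L M ξ η
    rw [opTensor_vecTensorₗ]
    have : (π (.ofAdd t) : L →L[ℂ] L) ξ = _ := hξ t
    rw [this, map_smul, LinearMap.smul_apply]
    rfl
  refine (bichar_smul hω (commute_inlRep_inrRep π σ) hξη).trans ?_
  exact opTensor_vecTensor _ _ _ _

theorem star_braidUnitary (hω : IsPrimitiveRoot ω N) (π : CyclicRep N L) (σ : CyclicRep N M) :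
    star (braidUnitary ω π σ) = braidUnitary ω π (σ.comp invMonoidHom) :=
  star_bichar hω (commute_inlRep_inrRep π σ)

theorem braiding_eq (hω : IsPrimitiveRoot ω N) (π : CyclicRep N L) (σ : CyclicRep N M) :
    braiding ω π σ = tensorFlip L M ∘L braidUnitary ω π σ := by
  refine op_ext_of_isHomogeneous hω π σ fun p q ξ η hξ hη => ?_
  have hσ : (σ (.ofAdd p) : M →L[ℂ] M) η = rootPow ω (p * q) • η := hη p
  rw [(braiding_vecTensor hω π σ hξ hη).1, ContinuousLinearMap.comp_apply,
    braidUnitary_vecTensor hω π σ hξ, tensorFlip_vecTensor, hσ]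
  simp only [← vecTensorₗ_apply, map_smul, LinearMap.smul_apply]

theorem dualBraiding_eq (hω : IsPrimitiveRoot ω N) (π : CyclicRep N L) (σ : CyclicRep N M) :
    dualBraiding ω π σ = star (braidUnitary ω π σ) ∘L tensorFlip M L := by
  refine op_ext_of_isHomogeneous hω σ π fun q p η ξ hη hξ => ?_
  have hσ : (σ (.ofAdd (-p)) : M →L[ℂ] M) η = rootPow ω (-(p * q)) • η := by
    rw [← neg_mul]
    exact hη (-p)
  rw [(braiding_vecTensor hω π σ hξ hη).2, ContinuousLinearMap.comp_apply, tensorFlip_vecTensor,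
    star_braidUnitary hω, braidUnitary_vecTensor hω π _ hξ]
  change _ = vecTensor ξ ((σ (.ofAdd (-p)) : M →L[ℂ] M) η)
  rw [hσ]
  simp only [← vecTensorₗ_apply, map_smul]

theorem rightOp_eq (hω : IsPrimitiveRoot ω N) (π : CyclicRep N L) (σ : CyclicRep N M)
    (y : M →L[ℂ] M) :
    rightOp ω π σ y = star (braidUnitary ω π σ) * inrHom L M y * braidUnitary ω π σ := by
  have hflip : tensorFlip M L ∘L opTensor y 1 ∘L tensorFlip L M = inrHom L M y :=
    op_ext fun ξ η => by
      simp only [ContinuousLinearMap.comp_apply, tensorFlip_vecTensor, opTensor_vecTensor,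
        inrHom_apply, one_apply_eq_self]
  rw [rightOp, braiding_eq hω, dualBraiding_eq hω, ← hflip]
  rfl

theorem braidUnitary_mem_unitary (hω : IsPrimitiveRoot ω N) (π : CyclicRep N L)
    (σ : CyclicRep N M) : braidUnitary ω π σ ∈ unitary (HTensor L M →L[ℂ] HTensor L M) :=
  bichar_mem_unitary hω (commute_inlRep_inrRep π σ)

/-- The embedding `j₂` of operators on the second factor, as a homomorphism. -/
def rightOpHom (hω : IsPrimitiveRoot ω N) (π : CyclicRep N L) (σ : CyclicRep N M) :
    (M →L[ℂ] M) →⋆ₐ[ℂ] (HTensor L M →L[ℂ] HTensor L M) :=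
  (conjHom (star ⟨braidUnitary ω π σ, braidUnitary_mem_unitary hω π σ⟩)).comp (inrHom L M)

theorem rightOpHom_apply (hω : IsPrimitiveRoot ω N) (π : CyclicRep N L) (σ : CyclicRep N M)
    (y : M →L[ℂ] M) : rightOpHom hω π σ y = rightOp ω π σ y := by
  rw [rightOp_eq hω, rightOpHom, StarAlgHom.comp_apply, conjHom_apply, Unitary.coe_star, star_star]

theorem rightOpHom_injective [Nontrivial L] (hω : IsPrimitiveRoot ω N) (π : CyclicRep N L)
    (σ : CyclicRep N M) : Function.Injective (rightOpHom hω π σ) :=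
  (conjHom_injective _).comp inrHom_injective

theorem rightOp_of_isHomogeneous (hω : IsPrimitiveRoot ω N) (π : CyclicRep N L)
    {σ : CyclicRep N M} {e : ZMod N} {y : M →L[ℂ] M} (hy : IsHomogeneous ω (conjRep σ) e y) :
    rightOp ω π σ y = opTensor (π (.ofAdd (-e)) : L →L[ℂ] L) y := by
  rw [rightOp_eq hω, braidUnitary, star_bichar_conj_of_isHomogeneous_right hω
    (commute_inlRep_inrRep π σ) (hy.mapRep (inrHom L M)) fun g => commute_inlHom_inrHom _ _,
    coe_mapRep, inlHom_apply, inrHom_apply, opTensor_mul, mul_one, one_mul]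

theorem commute_inlRep_braidUnitary (π : CyclicRep N L) (σ : CyclicRep N M)
    (g : Multiplicative (ZMod N)) :
    Commute (inlHom L M (π g : L →L[ℂ] L)) (braidUnitary ω π σ) :=
  commute_bichar (commute_coe_rep (mapRep (inlHom L M) π) g) (commute_inlRep_inrRep π σ g)

theorem commute_inlRep_rightOp (hω : IsPrimitiveRoot ω N) (π : CyclicRep N L) (σ : CyclicRep N M)
    (g : Multiplicative (ZMod N)) (y : M →L[ℂ] M) :
    Commute (inlHom L M (π g : L →L[ℂ] L)) (rightOp ω π σ y) := by
  rw [rightOp_eq hω, star_braidUnitary hω]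
  exact ((commute_inlRep_braidUnitary π _ g).mul_right (commute_inlHom_inrHom _ y)).mul_right
    (commute_inlRep_braidUnitary π σ g)

theorem IsHomogeneous.opTensor (hω : IsPrimitiveRoot ω N) {π : CyclicRep N L} {σ : CyclicRep N M}
    {d e : ZMod N} {a : L →L[ℂ] L} {b : M →L[ℂ] M} (ha : IsHomogeneous ω (conjRep π) d a)
    (hb : IsHomogeneous ω (conjRep σ) e b) :
    IsHomogeneous ω (conjRep (π.tensor σ)) (d + e) (opTensor a b) :=
  isHomogeneous_conjRep_iff.2 fun t => by
    rw [coe_tensor, opTensor_mul, opTensor_mul, isHomogeneous_conjRep_iff.1 ha,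
      isHomogeneous_conjRep_iff.1 hb, opTensor_smul_smul, ← rootPow_add hω, mul_add]

theorem IsHomogeneous.leftOp (hω : IsPrimitiveRoot ω N) {π : CyclicRep N L} (σ : CyclicRep N M)
    {d : ZMod N} {x : L →L[ℂ] L} (hx : IsHomogeneous ω (conjRep π) d x) :
    IsHomogeneous ω (conjRep (π.tensor σ)) d (leftOp M x) := by
  rw [← add_zero d]
  exact hx.opTensor hω (isHomogeneous_conjRep_zero_iff.2 fun _ => Commute.one_right _)

theorem IsHomogeneous.rightOp (hω : IsPrimitiveRoot ω N) (π : CyclicRep N L) {σ : CyclicRep N M}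
    {e : ZMod N} {y : M →L[ℂ] M} (hy : IsHomogeneous ω (conjRep σ) e y) :
    IsHomogeneous ω (conjRep (π.tensor σ)) e (rightOp ω π σ y) := by
  rw [rightOp_of_isHomogeneous hω π hy, ← zero_add e]
  exact (isHomogeneous_conjRep_zero_iff.2 fun _ => commute_coe_rep π _ _).opTensor hω
    (zero_add e ▸ hy)

theorem leftOp_mul_rightOp_of_isHomogeneous (hω : IsPrimitiveRoot ω N) {π : CyclicRep N L}
    (σ : CyclicRep N M) {d : ZMod N} {x : L →L[ℂ] L} (hx : IsHomogeneous ω (conjRep π) d x)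
    (y : M →L[ℂ] M) :
    leftOp M x * rightOp ω π σ y = rightOp ω π σ (conjRep σ (.ofAdd d) y) * leftOp M x := by
  simp only [← rightOpHom_apply hω]
  induction y using isHomogeneous_induction hω (conjRep σ) with
  | add y z hy hz => simp only [map_add, mul_add, add_mul, hy, hz]
  | homogeneous e y hy =>
    rw [hy, map_smul, rightOpHom_apply, rightOp_of_isHomogeneous hω π hy, leftOp, smul_mul_assoc,
      opTensor_mul, opTensor_mul, isHomogeneous_conjRep_iff.1 hx (-e), ← one_smul ℂ (y * 1),
      opTensor_smul_smul, smul_smul, mul_one, ← rootPow_add hω, mul_one, one_mul, neg_mul, mul_comm,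
      add_neg_cancel, rootPow_zero, one_smul]

end Braiding

/-! ### Coactions of `C(ℤ/N)` -/

section Coaction

variable {X : Type*} [CStarAlgebra X]

theorem CyclicCoaction.hom_zero (ρ : CyclicCoaction N X) (x : X) : ρ.hom x 0 = x := by
  let ε : X →⋆ₐ[ℂ] X := (evalAt X 0).comp ρ.hom
  have hclosed : IsClosed {h : ZMod N → X | ∀ t, ε (h t) = h t} := by
    simp only [Set.ofPred_forall]
    exact isClosed_iInter fun t =>
      isClosed_eq ((map_continuous ε).comp (continuous_apply t)) (continuous_apply t)
  have hspan : (Submodule.span ℂ {y : ZMod N → X | ∃ (x : X) (f : ZMod N → ℂ),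
      y = ρ.hom x * fun t => algebraMap ℂ X (f t)} : Set (ZMod N → X)) ⊆
        {h | ∀ t, ε (h t) = h t} := fun h hh t => by
    induction hh using Submodule.span_induction with
    | mem h hh =>
      obtain ⟨x, f, rfl⟩ := hh
      have hx : ε (ρ.hom x t) = ρ.hom x t :=
        (ρ.coassoc x 0 t).trans (congrArg (ρ.hom x) (zero_add t))
      rw [Pi.mul_apply, map_mul, hx, AlgHomClass.commutes]
    | zero => exact map_zero ε
    | add h k _ _ hh hk => rw [Pi.add_apply, map_add, hh, hk]
    | smul c h _ hh => rw [Pi.smul_apply, map_smul, hh]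
  have hconst : (fun _ => x) ∈ {h : ZMod N → X | ∀ t, ε (h t) = h t} :=
    closure_minimal hspan hclosed (ρ.podles ▸ Set.mem_univ _)
  exact hconst 0

/-- The action `t ↦ ρ_t` of `ℤ/N` given by a coaction of `C(ℤ/N)`. -/
def CyclicCoaction.rep (ρ : CyclicCoaction N X) : Representation ℂ (Multiplicative (ZMod N)) X where
  toFun g := ((evalAt X g.toAdd).comp ρ.hom : X →ₐ[ℂ] X)
  map_one' := LinearMap.ext ρ.hom_zero
  map_mul' g h := LinearMap.ext fun x => (ρ.coassoc x g.toAdd h.toAdd).symm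

theorem CyclicCoaction.rep_apply (ρ : CyclicCoaction N X) (t : ZMod N) (x : X) :
    ρ.rep (.ofAdd t) x = ρ.hom x t := rfl

variable {L : Type*} [NormedAddCommGroup L] [InnerProductSpace ℂ L] [CompleteSpace L]
  {ρ : CyclicCoaction N X}

theorem EquivariantRep.hom_rep (r : EquivariantRep ρ L) (g : Multiplicative (ZMod N)) (x : X) :
    r.hom (ρ.rep g x) = conjRep r.rep g (r.hom x) :=
  r.equivariant g.toAdd x

theorem IsHomogeneous.equivariantRep {d : ZMod N} {x : X} (hx : IsHomogeneous ω ρ.rep d x)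
    (r : EquivariantRep ρ L) : IsHomogeneous ω (conjRep r.rep) d (r.hom x) := fun t => by
  rw [← r.hom_rep, hx, map_smul]

end Coaction

section Characters

/-- The character `t ↦ ω ^ (t k)` of `ℤ/N`, as a unitary element of `C(ℤ/N)` depending
multiplicatively on `k`. -/
def character (hω : IsPrimitiveRoot ω N) :
    Multiplicative (ZMod N) →* unitary (ZMod N → ℂ) where
  toFun k := ⟨fun t => rootPow ω (t * k.toAdd), by
    rw [Unitary.mem_iff_self_mul_star]
    exact funext fun t => rootPow_mul_conj hω _⟩
  map_one' := Subtype.ext <| funext fun t => by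
    change rootPow ω (t * 0) = 1
    rw [mul_zero, rootPow_zero]
  map_mul' k l := Subtype.ext <| funext fun t => by
    change rootPow ω (t * (k.toAdd + l.toAdd)) = _
    rw [mul_add, rootPow_add hω]
    rfl

theorem character_apply (hω : IsPrimitiveRoot ω N) (k t : ZMod N) :
    (character hω (.ofAdd k) : ZMod N → ℂ) t = rootPow ω (t * k) := rfl

theorem isHomogeneous_character (hω : IsPrimitiveRoot ω N) (k : ZMod N) :
    IsHomogeneous ω (cyclicCoaction N).rep k (character hω (.ofAdd k) : ZMod N → ℂ) := fun t =>
  funext fun s => by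
    rw [Pi.smul_apply, smul_eq_mul, character_apply, ← rootPow_add hω, ← add_mul, add_comm t]
    rfl

theorem IsHomogeneous.eq_smul_character (hω : IsPrimitiveRoot ω N) {d : ZMod N} {f : ZMod N → ℂ}
    (hf : IsHomogeneous ω (cyclicCoaction N).rep d f) :
    f = f 0 • (character hω (.ofAdd d) : ZMod N → ℂ) := by
  funext t
  have h : f (0 + t) = rootPow ω (t * d) * f 0 := congrFun (hf t) 0
  rw [Pi.smul_apply, smul_eq_mul, character_apply, mul_comm, ← h, zero_add]

theorem character_one (hω : IsPrimitiveRoot ω N) :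
    (character hω (.ofAdd 1) : ZMod N → ℂ) = zFun N ω :=
  funext fun t => by rw [character_apply, mul_one, zFun]

theorem zFun_hom_ext (hω : IsPrimitiveRoot ω N) {D : Type*} [Ring D] [StarRing D] [Algebra ℂ D]
    {φ ψ : (ZMod N → ℂ) →⋆ₐ[ℂ] D} (h : φ (zFun N ω) = ψ (zFun N ω)) : φ = ψ :=
  StarAlgHom.ext fun f => by
    induction f using isHomogeneous_induction hω (cyclicCoaction N).rep with
    | add f g hf hg => rw [map_add, map_add, hf, hg]
    | homogeneous d f hf =>
      rw [hf.eq_smul_character hω, coe_eq_pow, character_one, map_smul, map_smul, map_pow, map_pow,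
        h]

end Characters

/-! ### Crossed products by covariant pairs -/

section CrossedProduct

variable {G : Type*} [Group G] {A B D : Type*} [Ring A] [StarRing A] [Algebra ℂ A]
  [Ring B] [StarRing B] [Algebra ℂ B] [Ring D] [StarRing D] [Algebra ℂ D]

/-- The pair of `j : A → B` and `v : G → U(B)` is covariant for the action `α` of `G` on `A`, that
is, `v g` implements `α g` on the image of `j`. -/
def IsCovariant (α : Representation ℂ G A) (j : A →⋆ₐ[ℂ] B) (v : G →* unitary B) : Prop :=
  ∀ g a, (v g : B) * j a = j (α g a) * v g

theorem IsCovariant.comp {α : Representation ℂ G A} {j : A →⋆ₐ[ℂ] B} {v : G →* unitary B}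
    (h : IsCovariant α j v) (f : B →⋆ₐ[ℂ] D) :
    IsCovariant α (f.comp j) (mapRep f v) := fun g a => by
  rw [coe_mapRep, StarAlgHom.comp_apply, StarAlgHom.comp_apply, ← map_mul, h, map_mul]

variable [Fintype G]

/-- The map `x ↦ ∑ g, j(x_g) v_g` from the crossed product of `A` by the finite group `G`, whose
underlying vector space is `G → A`. -/
def crossedSum (j : A →⋆ₐ[ℂ] B) (v : G →* unitary B) : (G → A) →ₗ[ℂ] B :=
  ∑ g, LinearMap.mulRight ℂ (v g : B) ∘ₗ (j : A →ₐ[ℂ] B).toLinearMap ∘ₗ LinearMap.proj g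

variable {j : A →⋆ₐ[ℂ] B} {v : G →* unitary B} {j' : A →⋆ₐ[ℂ] D} {v' : G →* unitary D}

theorem crossedSum_apply (x : G → A) : crossedSum j v x = ∑ g, j (x g) * v g := by
  simp only [crossedSum, LinearMap.sum_apply]
  rfl

theorem map_crossedSum (f : B →⋆ₐ[ℂ] D) (x : G → A) :
    f (crossedSum j v x) = crossedSum (f.comp j) (mapRep f v) x := by
  simp only [crossedSum_apply, map_sum, map_mul, StarAlgHom.comp_apply, coe_mapRep]

variable [DecidableEq G] {α : Representation ℂ G A}

theorem crossedSum_single (g : G) (a : A) : crossedSum j v (Pi.single g a) = j a * v g := by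
  rw [crossedSum_apply, Finset.sum_eq_single g]
  · rw [Pi.single_eq_same]
  · intro h _ hne
    rw [Pi.single_eq_of_ne hne, map_zero, zero_mul]
  · exact fun hg => absurd (Finset.mem_univ g) hg

theorem crossedSum_single_one (c : ℂ) :
    crossedSum j v (Pi.single 1 (algebraMap ℂ A c)) = algebraMap ℂ B c := by
  rw [crossedSum_single, map_one, AlgHomClass.commutes, OneMemClass.coe_one, mul_one]

theorem IsCovariant.crossedSum_mul (h : IsCovariant α j v) (x y : G → A) :
    crossedSum j v x * crossedSum j v y =
      crossedSum j v (∑ g, ∑ k, Pi.single (g * k) (x g * α g (y k))) := by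
  simp only [map_sum, crossedSum_single]
  rw [crossedSum_apply, crossedSum_apply, Finset.sum_mul_sum]
  refine Finset.sum_congr rfl fun g _ => Finset.sum_congr rfl fun k _ => ?_
  rw [mul_assoc, ← mul_assoc (v g : B), h, map_mul, map_mul, Submonoid.coe_mul]
  simp only [mul_assoc]

theorem IsCovariant.star_crossedSum (h : IsCovariant α j v) (x : G → A) :
    star (crossedSum j v x) = crossedSum j v (∑ g, Pi.single g⁻¹ (α g⁻¹ (star (x g)))) := by
  simp only [map_sum, crossedSum_single]
  rw [crossedSum_apply, star_sum]
  refine Finset.sum_congr rfl fun g _ => ?_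
  rw [star_mul, ← coe_map_inv, ← map_star, h]

/-- The `*`-algebra spanned by the products `j(a) v_g` of a covariant pair. -/
def IsCovariant.range [StarModule ℂ B] (h : IsCovariant α j v) : StarSubalgebra ℂ B where
  carrier := Set.range (crossedSum j v)
  mul_mem' := by
    rintro _ _ ⟨x, rfl⟩ ⟨y, rfl⟩
    exact ⟨_, (h.crossedSum_mul x y).symm⟩
  add_mem' := by
    rintro _ _ ⟨x, rfl⟩ ⟨y, rfl⟩
    exact ⟨x + y, map_add _ x y⟩
  algebraMap_mem' c := ⟨_, crossedSum_single_one c⟩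
  star_mem' := by
    rintro _ ⟨x, rfl⟩
    exact ⟨_, (h.star_crossedSum x).symm⟩

theorem IsCovariant.hom_mem_range [StarModule ℂ B] (h : IsCovariant α j v) (a : A) :
    j a ∈ h.range :=
  ⟨Pi.single 1 a, by rw [crossedSum_single, map_one, OneMemClass.coe_one, mul_one]⟩

theorem IsCovariant.coe_mem_range [StarModule ℂ B] (h : IsCovariant α j v) (g : G) :
    (v g : B) ∈ h.range :=
  ⟨Pi.single g 1, by rw [crossedSum_single, map_one, one_mul]⟩

/-- The homomorphism out of the crossed product given by a covariant pair, when the crossed product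
is realized on `B` by the covariant pair `(j, v)`. -/
def crossedLift (h : IsCovariant α j v) (hb : Function.Bijective (crossedSum j v))
    (h' : IsCovariant α j' v') : B →⋆ₐ[ℂ] D :=
  let e := LinearEquiv.ofBijective (crossedSum j v) hb
  have he x : crossedSum j' v' (e.symm (crossedSum j v x)) = crossedSum j' v' x :=
    congrArg _ (e.symm_apply_apply x)
  have commutes c : crossedSum j' v' (e.symm (algebraMap ℂ B c)) = algebraMap ℂ D c := by
    rw [← crossedSum_single_one (j := j) (v := v), he, crossedSum_single_one]
  { toFun := fun b => crossedSum j' v' (e.symm b)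
    map_one' := by simpa only [map_one] using commutes 1
    map_mul' := hb.2.forall₂.2 fun x y => by rw [h.crossedSum_mul, he, he, he, h'.crossedSum_mul]
    map_zero' := by rw [map_zero, map_zero]
    map_add' := fun b c => by rw [map_add, map_add]
    commutes' := commutes
    map_star' := hb.2.forall.2 fun x => by rw [h.star_crossedSum, he, he, h'.star_crossedSum] }

theorem crossedLift_mul (h : IsCovariant α j v) (hb : Function.Bijective (crossedSum j v))
    (h' : IsCovariant α j' v') (a : A) (g : G) : crossedLift h hb h' (j a * v g) = j' a * v' g := by
  rw [← crossedSum_single, ← crossedSum_single]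
  exact congrArg (crossedSum j' v')
    ((LinearEquiv.ofBijective (crossedSum j v) hb).symm_apply_apply _)

theorem crossedLift_hom (h : IsCovariant α j v) (hb : Function.Bijective (crossedSum j v))
    (h' : IsCovariant α j' v') (a : A) : crossedLift h hb h' (j a) = j' a := by
  simpa only [map_one, OneMemClass.coe_one, mul_one] using crossedLift_mul h hb h' a 1

theorem crossedLift_coe (h : IsCovariant α j v) (hb : Function.Bijective (crossedSum j v))
    (h' : IsCovariant α j' v') (g : G) : crossedLift h hb h' (v g) = v' g := by
  simpa only [map_one, one_mul] using crossedLift_mul h hb h' 1 g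

end CrossedProduct

section DualAction

variable {A B : Type*} [CStarAlgebra A] [CStarAlgebra B] {j : A →⋆ₐ[ℂ] B}
  {v w : Multiplicative (ZMod N) →* unitary B}

theorem continuous_spectralPart (k : ZMod N) : Continuous (spectralPart ω (conjRep w) k) := by
  have h : ⇑(spectralPart ω (conjRep w) k) = fun b =>
      (N : ℂ)⁻¹ • ∑ t, rootPow ω (-(t * k)) • (w (.ofAdd t) * b * star (w (.ofAdd t) : B)) :=
    funext fun b => spectralPart_apply k b
  rw [h]
  fun_prop

theorem spectralPart_crossedSum (hω : IsPrimitiveRoot ω N)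
    (hv : ∀ k, IsHomogeneous ω (conjRep w) k (v (.ofAdd k) : B))
    (hj : ∀ a, IsHomogeneous ω (conjRep w) 0 (j a)) (x : Multiplicative (ZMod N) → A) (k : ZMod N) :
    spectralPart ω (conjRep w) k (crossedSum j v x) = j (x (.ofAdd k)) * v (.ofAdd k) := by
  have h g : IsHomogeneous ω (conjRep w) g.toAdd (j (x g) * v g) :=
    zero_add g.toAdd ▸ (hj (x g)).mul hω (hv g.toAdd)
  rw [crossedSum_apply, map_sum, Finset.sum_congr rfl fun g _ => (h g).spectralPart_eq hω k]
  exact Finset.sum_ite_eq_of_mem' _ _ _ (Finset.mem_univ (Multiplicative.ofAdd k))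

theorem crossedSum_injective (hω : IsPrimitiveRoot ω N)
    (hv : ∀ k, IsHomogeneous ω (conjRep w) k (v (.ofAdd k) : B))
    (hj : ∀ a, IsHomogeneous ω (conjRep w) 0 (j a)) (hinj : Function.Injective j) :
    Function.Injective (crossedSum j v) := fun x y hxy => funext fun k => hinj <| by
  have h := congrArg (spectralPart ω (conjRep w) k.toAdd) hxy
  rw [spectralPart_crossedSum hω hv hj, spectralPart_crossedSum hω hv hj] at h
  exact (Unitary.toUnits (v k)).isUnit.mul_right_cancel h

theorem isClosed_range_crossedSum (hω : IsPrimitiveRoot ω N)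
    (hv : ∀ k, IsHomogeneous ω (conjRep w) k (v (.ofAdd k) : B))
    (hj : ∀ a, IsHomogeneous ω (conjRep w) 0 (j a)) (hinj : Function.Injective j) :
    IsClosed (Set.range (crossedSum j v)) := by
  have hrange : Set.range (crossedSum j v) =
      ⋂ k, {b | spectralPart ω (conjRep w) k b * star (v (.ofAdd k) : B) ∈ Set.range j} := by
    refine Set.Subset.antisymm (Set.range_subset_iff.2 fun x => Set.mem_iInter.2 fun k => ?_)
      fun b hb => ?_
    · rw [Set.mem_ofPred_eq, spectralPart_crossedSum hω hv hj, mul_assoc,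
        Unitary.mul_star_self_of_mem (v _).2, mul_one]
      exact ⟨_, rfl⟩
    · choose a ha using Set.mem_iInter.1 hb
      refine ⟨fun g => a g.toAdd, ?_⟩
      rw [crossedSum_apply, ← sum_spectralPart hω b (α := conjRep w)]
      refine Fintype.sum_equiv Multiplicative.toAdd _ _ fun g => ?_
      rw [ha, ofAdd_toAdd, mul_assoc, Unitary.coe_star_mul_self, mul_one]
  rw [hrange]
  exact isClosed_iInter fun k =>
    (NonUnitalStarAlgHom.isometry j hinj).isClosedEmbedding.isClosed_range.preimage
      ((continuous_spectralPart k).mul continuous_const)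

end DualAction

/-! ### Braided tensor products -/

section BraidedTensor

variable {L M : Type*}
  [NormedAddCommGroup L] [InnerProductSpace ℂ L] [CompleteSpace L]
  [NormedAddCommGroup M] [InnerProductSpace ℂ M] [CompleteSpace M]
  {π : CyclicRep N L} {σ : CyclicRep N M}
  {X : StarSubalgebra ℂ (L →L[ℂ] L)} {Y : StarSubalgebra ℂ (M →L[ℂ] M)}

theorem braidedTensor_le {S : StarSubalgebra ℂ (HTensor L M →L[ℂ] HTensor L M)}
    (hS : IsClosed (S : Set (HTensor L M →L[ℂ] HTensor L M))) (hX : ∀ x ∈ X, leftOp M x ∈ S)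
    (hY : ∀ y ∈ Y, rightOp ω π σ y ∈ S) : braidedTensor ω π σ X Y ≤ S :=
  StarSubalgebra.topologicalClosure_minimal
    (StarAlgebra.adjoin_le
      (Set.union_subset (Set.image_subset_iff.2 hX) (Set.image_subset_iff.2 hY))) hS

theorem braidedTensor.hom_ext {D : Type*} [CStarAlgebra D]
    {φ ψ : braidedTensor ω π σ X Y →⋆ₐ[ℂ] D}
    (hX : ∀ x : X, φ (braidedTensor.left x) = ψ (braidedTensor.left x))
    (hY : ∀ y : Y, φ (braidedTensor.right y) = ψ (braidedTensor.right y)) : φ = ψ := by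
  refine StarAlgHom.ext_topologicalClosure (map_continuous φ) (map_continuous ψ)
    (StarAlgHom.ext_adjoin ?_)
  rintro ⟨_, _⟩ (⟨x, hx, rfl⟩ | ⟨y, hy, rfl⟩)
  exacts [hX ⟨x, hx⟩, hY ⟨y, hy⟩]

variable (ω π σ X Y) in
/-- The embedding `j₁ : X → X ⊠ Y`, as a homomorphism. -/
def braidedTensor.leftHom : X →⋆ₐ[ℂ] braidedTensor ω π σ X Y :=
  ((inlHom L M).comp X.subtype).codRestrict _ fun x => (braidedTensor.left x).2

variable (π σ X Y) in
/-- The embedding `j₂ : Y → X ⊠ Y`, as a homomorphism. -/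
def braidedTensor.rightHom (hω : IsPrimitiveRoot ω N) : Y →⋆ₐ[ℂ] braidedTensor ω π σ X Y :=
  ((rightOpHom hω π σ).comp Y.subtype).codRestrict _ fun y =>
    rightOpHom_apply hω π σ (y : M →L[ℂ] M) ▸ (braidedTensor.right y).2

theorem braidedTensor.rightHom_apply (hω : IsPrimitiveRoot ω N) (y : Y) :
    braidedTensor.rightHom π σ X Y hω y = braidedTensor.right y :=
  Subtype.ext (rightOpHom_apply hω π σ y.1)

theorem left_mul_right_of_isHomogeneous (hω : IsPrimitiveRoot ω N) {d : ZMod N} {x : X}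
    (hx : IsHomogeneous ω (conjRep π) d (x : L →L[ℂ] L)) {y y' : Y}
    (hy : (y' : M →L[ℂ] M) = conjRep σ (.ofAdd d) y) :
    (braidedTensor.left x * braidedTensor.right y : braidedTensor ω π σ X Y) =
      braidedTensor.right y' * braidedTensor.left x := by
  refine Subtype.ext ((leftOp_mul_rightOp_of_isHomogeneous hω σ hx y.1).trans ?_)
  rw [← hy]
  rfl

end BraidedTensor

section BoxTensor

variable {X Y : Type*} [CStarAlgebra X] [CStarAlgebra Y]
  {ρ : CyclicCoaction N X} {τ : CyclicCoaction N Y} {L M : Type*}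
  [NormedAddCommGroup L] [InnerProductSpace ℂ L] [CompleteSpace L]
  [NormedAddCommGroup M] [InnerProductSpace ℂ M] [CompleteSpace M]

/-- The embedding `j₁ : X → X ⊠ Y`, as a homomorphism. -/
def j₁Hom (ω : ℂ) (r : EquivariantRep ρ L) (s : EquivariantRep τ M) :
    X →⋆ₐ[ℂ] boxTensor ω r s :=
  (braidedTensor.leftHom ω r.rep s.rep r.hom.range s.hom.range).comp r.hom.rangeRestrict

/-- The embedding `j₂ : Y → X ⊠ Y`, as a homomorphism. -/
def j₂Hom (hω : IsPrimitiveRoot ω N) (r : EquivariantRep ρ L) (s : EquivariantRep τ M) :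
    Y →⋆ₐ[ℂ] boxTensor ω r s :=
  (braidedTensor.rightHom r.rep s.rep r.hom.range s.hom.range hω).comp s.hom.rangeRestrict

variable {r : EquivariantRep ρ L} {s : EquivariantRep τ M}

theorem j₁Hom_apply (x : X) : j₁Hom ω r s x = j₁ ω r s x := rfl

theorem j₂Hom_apply (hω : IsPrimitiveRoot ω N) (y : Y) : j₂Hom hω r s y = j₂ ω r s y :=
  braidedTensor.rightHom_apply hω _

theorem boxTensor_hom_ext {D : Type*} [CStarAlgebra D] {φ ψ : boxTensor ω r s →⋆ₐ[ℂ] D}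
    (hX : ∀ x, φ (j₁ ω r s x) = ψ (j₁ ω r s x)) (hY : ∀ y, φ (j₂ ω r s y) = ψ (j₂ ω r s y)) :
    φ = ψ := by
  refine braidedTensor.hom_ext ?_ ?_
  · rintro ⟨_, x, rfl⟩
    exact hX x
  · rintro ⟨_, y, rfl⟩
    exact hY y

theorem j₁_mul_j₂_of_isHomogeneous (hω : IsPrimitiveRoot ω N) {d : ZMod N} {x : X}
    (hx : IsHomogeneous ω ρ.rep d x) (y : Y) :
    j₁ ω r s x * j₂ ω r s y = j₂ ω r s (τ.rep (.ofAdd d) y) * j₁ ω r s x :=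
  left_mul_right_of_isHomogeneous hω (hx.equivariantRep r) (s.hom_rep _ y)

theorem IsHomogeneous.j₁ (hω : IsPrimitiveRoot ω N) {d : ZMod N} {x : X}
    (hx : IsHomogeneous ω ρ.rep d x) (r : EquivariantRep ρ L) (s : EquivariantRep τ M) :
    IsHomogeneous ω (conjRep (r.rep.tensor s.rep)) d (Anyonic.j₁ ω r s x).1 :=
  (hx.equivariantRep r).leftOp hω s.rep

theorem IsHomogeneous.j₂ (hω : IsPrimitiveRoot ω N) {e : ZMod N} {y : Y}
    (hy : IsHomogeneous ω τ.rep e y) (r : EquivariantRep ρ L) (s : EquivariantRep τ M) :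
    IsHomogeneous ω (conjRep (r.rep.tensor s.rep)) e (Anyonic.j₂ ω r s y).1 :=
  (hy.equivariantRep s).rightOp hω r.rep

end BoxTensor

section SmashProduct

variable {X : Type*} [CStarAlgebra X] {ρ : CyclicCoaction N X} {L M : Type*}
  [NormedAddCommGroup L] [InnerProductSpace ℂ L] [CompleteSpace L]
  [NormedAddCommGroup M] [InnerProductSpace ℂ M] [CompleteSpace M]

theorem isCovariant_rightHom_comp (hω : IsPrimitiveRoot ω N)
    (r : EquivariantRep (cyclicCoaction N) L)
    {σ : CyclicRep N M} {Y : StarSubalgebra ℂ (M →L[ℂ] M)} {φ : X →⋆ₐ[ℂ] Y}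
    (hφ : ∀ g x, (φ (ρ.rep g x) : M →L[ℂ] M) = conjRep σ g (φ x : M →L[ℂ] M)) :
    IsCovariant ρ.rep ((braidedTensor.rightHom r.rep σ r.hom.range Y hω).comp φ)
      (mapRep ((braidedTensor.leftHom ω r.rep σ r.hom.range Y).comp r.hom.rangeRestrict)
        (character hω)) := fun k x => by
  rw [StarAlgHom.comp_apply, StarAlgHom.comp_apply, braidedTensor.rightHom_apply,
    braidedTensor.rightHom_apply]
  exact left_mul_right_of_isHomogeneous hω
    ((isHomogeneous_character hω k.toAdd).equivariantRep r) (hφ k x)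

/-- The characters of `ℤ/N` in the first factor of `C(ℤ/N) ⊠ X`. -/
def boxCharacter (hω : IsPrimitiveRoot ω N) (r : EquivariantRep (cyclicCoaction N) L)
    (s : EquivariantRep ρ M) : Multiplicative (ZMod N) →* unitary (boxTensor ω r s) :=
  mapRep (j₁Hom ω r s) (character hω)

variable {r : EquivariantRep (cyclicCoaction N) L} {s : EquivariantRep ρ M}

theorem coe_boxCharacter (hω : IsPrimitiveRoot ω N) (k : Multiplicative (ZMod N)) :
    (boxCharacter hω r s k : boxTensor ω r s) = j₁ ω r s (character hω k) := rfl

theorem boxCharacter_one (hω : IsPrimitiveRoot ω N) :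
    (boxCharacter hω r s (.ofAdd 1) : boxTensor ω r s) = j₁ ω r s (zFun N ω) := by
  rw [coe_boxCharacter, character_one]

theorem isCovariant_j₂Hom (hω : IsPrimitiveRoot ω N) (r : EquivariantRep (cyclicCoaction N) L)
    (s : EquivariantRep ρ M) : IsCovariant ρ.rep (j₂Hom hω r s) (boxCharacter hω r s) :=
  isCovariant_rightHom_comp hω r s.hom_rep

theorem nontrivial_of_equivariantRep (r : EquivariantRep (cyclicCoaction N) L) : Nontrivial L := by
  by_contra h
  rw [not_nontrivial_iff_subsingleton] at h
  exact one_ne_zero (r.injective (Subsingleton.elim (r.hom 1) (r.hom 0)))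

variable (r s) in
theorem crossedSum_boxTensor_bijective (hω : IsPrimitiveRoot ω N) :
    Function.Bijective (crossedSum (j₂Hom hω r s) (boxCharacter hω r s)) := by
  have := nontrivial_of_equivariantRep r
  let J : X →⋆ₐ[ℂ] HTensor L M →L[ℂ] HTensor L M := (boxTensor ω r s).subtype.comp (j₂Hom hω r s)
  let v := mapRep (boxTensor ω r s).subtype (boxCharacter hω r s)
  let w := mapRep (inlHom L M) r.rep
  have hcov : IsCovariant ρ.rep J v := (isCovariant_j₂Hom hω r s).comp _
  have hJinj : Function.Injective J := fun x y hxy => s.injective <|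
    rightOpHom_injective hω r.rep s.rep hxy
  have hv k : IsHomogeneous ω (conjRep w) k (v (.ofAdd k) : HTensor L M →L[ℂ] HTensor L M) :=
    ((isHomogeneous_character hω k).equivariantRep r).mapRep (inlHom L M)
  have hJ x : IsHomogeneous ω (conjRep w) 0 (J x) := isHomogeneous_conjRep_zero_iff.2 fun g =>
    rightOpHom_apply hω r.rep s.rep (s.hom x) ▸ commute_inlRep_rightOp hω r.rep s.rep g (s.hom x)
  have hle : boxTensor ω r s ≤ hcov.range := by
    refine braidedTensor_le (isClosed_range_crossedSum hω hv hJ hJinj) ?_ ?_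
    · rintro _ ⟨f, rfl⟩
      change inlHom L M (r.hom f) ∈ hcov.range
      induction f using isHomogeneous_induction hω (cyclicCoaction N).rep with
      | add f g hf hg =>
        rw [map_add, map_add]
        exact add_mem hf hg
      | homogeneous d f hf =>
        rw [hf.eq_smul_character hω, map_smul, map_smul]
        exact SMulMemClass.smul_mem _ (hcov.coe_mem_range (.ofAdd d))
    · rintro _ ⟨x, rfl⟩
      exact rightOpHom_apply hω r.rep s.rep (s.hom x) ▸ hcov.hom_mem_range x
  refine ⟨fun x y hxy => crossedSum_injective hω hv hJ hJinj ?_, fun b => ?_⟩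
  · rw [← map_crossedSum, ← map_crossedSum, hxy]
  · obtain ⟨x, hx⟩ := hle b.2
    exact ⟨x, Subtype.ext ((map_crossedSum _ x).trans hx)⟩

end SmashProduct

/-! ### The universal property of the bosonization -/

section AnyonicUnitaries

/-- The map `Mₙ(A) → Mₙ(B)` applying a `*`-homomorphism to each entry. -/
def starMapMatrix {n A B : Type*} [Fintype n] [DecidableEq n] [Ring A] [StarRing A] [Algebra ℂ A]
    [Ring B] [StarRing B] [Algebra ℂ B] (f : A →⋆ₐ[ℂ] B) : Matrix n n A →⋆ₐ[ℂ] Matrix n n B where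
  __ := (f : A →ₐ[ℂ] B).mapMatrix
  map_star' m := Matrix.ext fun i j => map_star f (m j i)

variable {A B : Type*} [Ring A] [StarRing A] [Algebra ℂ A] [Ring B] [StarRing B] [Algebra ℂ B]
  {m : Matrix (ZMod N) (ZMod N) A}

theorem IsAnyonicUnitary.map (hm : IsAnyonicUnitary ω m) (f : A →⋆ₐ[ℂ] B) :
    IsAnyonicUnitary ω (m.map f) :=
  ⟨Unitary.map_mem (starMapMatrix f) hm.1,
    conjMatrix_map ω f m ▸ Unitary.map_mem (starMapMatrix f) hm.2⟩

theorem mem_unitary_of_map_mem {f : A →⋆ₐ[ℂ] B} (hf : Function.Injective f) {a : A}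
    (ha : f a ∈ unitary B) : a ∈ unitary A := by
  rw [Unitary.mem_iff] at ha ⊢
  simp only [← map_star, ← map_mul] at ha
  exact ⟨hf (ha.1.trans (map_one f).symm), hf (ha.2.trans (map_one f).symm)⟩

theorem IsAnyonicUnitary.of_map {f : A →⋆ₐ[ℂ] B} (hf : Function.Injective f)
    (hm : IsAnyonicUnitary ω (m.map f)) : IsAnyonicUnitary ω m := by
  have hinj : Function.Injective (starMapMatrix (n := ZMod N) f) := Matrix.map_injective hf
  rw [IsAnyonicUnitary, ← conjMatrix_map] at hm
  exact ⟨mem_unitary_of_map_mem hinj hm.1, mem_unitary_of_map_mem hinj hm.2⟩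

end AnyonicUnitaries

section FreeUnitary

variable {D : Type*} [CStarAlgebra D]

theorem FreeUnitary.mem_range_of_forall_mem_range {f : D →⋆ₐ[ℂ] FreeUnitary N ω}
    (hf : Function.Injective f) (hu : ∀ i j, ∃ d, f d = FreeUnitary.u N ω i j)
    (x : FreeUnitary N ω) : x ∈ f.range := by
  choose u hu using hu
  have hmap : (Matrix.of u).map f = FreeUnitary.u N ω := Matrix.ext hu
  have hD : IsAnyonicUnitary ω (Matrix.of u) :=
    .of_map hf (hmap.symm ▸ FreeUnitary.isAnyonicUnitary N ω)
  have h : f.comp (FreeUnitary.lift ω _ hD) = StarAlgHom.id ℂ _ :=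
    FreeUnitary.hom_ext ω fun i j => (congrArg f (FreeUnitary.lift_u ω _ hD i j)).trans (hu i j)
  exact ⟨_, DFunLike.congr_fun h x⟩

theorem FreeUnitary.mem_of_isClosed {S : StarSubalgebra ℂ (FreeUnitary N ω)}
    (hS : IsClosed (S : Set (FreeUnitary N ω))) (hu : ∀ i j, FreeUnitary.u N ω i j ∈ S)
    (x : FreeUnitary N ω) : x ∈ S := by
  let _ : CStarAlgebra S := StarSubalgebra.cstarAlgebra S (h_closed := hS)
  obtain ⟨y, rfl⟩ := FreeUnitary.mem_range_of_forall_mem_range (f := S.subtype)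
    Subtype.val_injective (fun i j => ⟨⟨_, hu i j⟩, rfl⟩) x
  exact y.2

theorem FreeUnitary.isHomogeneous_u (hω : IsPrimitiveRoot ω N) (i j : ZMod N) :
    IsHomogeneous ω (freeUnitaryCoaction hω).rep (j - i) (FreeUnitary.u N ω i j) :=
  rotation_u hω i j

theorem FreeUnitary.hom_rep_of_isHomogeneous (hω : IsPrimitiveRoot ω N)
    {f : FreeUnitary N ω →⋆ₐ[ℂ] D} {v : Multiplicative (ZMod N) →* unitary D}
    (h : ∀ i j, IsHomogeneous ω (conjRep v) (j - i) (f (FreeUnitary.u N ω i j)))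
    (t : ZMod N) (x : FreeUnitary N ω) :
    f ((freeUnitaryCoaction hω).hom x t) = conjRep v (.ofAdd t) (f x) := by
  have hcomp : f.comp ((evalAt _ t).comp (freeUnitaryCoaction hω).hom) =
      (conjHom (v (.ofAdd t))).comp f := FreeUnitary.hom_ext ω fun i j => by
    have hu : f ((freeUnitaryCoaction hω).hom (FreeUnitary.u N ω i j) t) = _ :=
      congrArg f (FreeUnitary.isHomogeneous_u hω i j t)
    exact hu.trans ((map_smul f _ _).trans (h i j t).symm)
  exact DFunLike.congr_fun hcomp x

end FreeUnitary

section Universal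

theorem BosonizationRelations.isCovariant (hω : IsPrimitiveRoot ω N) {D : Type*} [CStarAlgebra D]
    {z : D} {u : Matrix (ZMod N) (ZMod N) D} (h : BosonizationRelations ω z u)
    {v : Multiplicative (ZMod N) →* _root_.unitary D} (hv : (v (.ofAdd 1) : D) = z) :
    IsCovariant (freeUnitaryCoaction hω).rep (FreeUnitary.lift ω u h.unitary) v := fun g x => by
  have hu i j : IsHomogeneous ω (conjRep v) (j - i)
      (FreeUnitary.lift ω u h.unitary (FreeUnitary.u N ω i j)) := by
    rw [isHomogeneous_conjRep_iff_generator hω, hv, FreeUnitary.lift_u]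
    exact h.comm i j
  have hg := FreeUnitary.hom_rep_of_isHomogeneous hω hu g.toAdd x
  rw [conjRep_apply, ofAdd_toAdd] at hg
  refine Eq.symm ((congrArg (· * (v g : D)) hg).trans ?_)
  rw [mul_assoc, Unitary.coe_star_mul_self, mul_one]

variable {L : Type u} {M : Type v} [NormedAddCommGroup L] [InnerProductSpace ℂ L] [CompleteSpace L]
  [NormedAddCommGroup M] [InnerProductSpace ℂ M] [CompleteSpace M]

variable (hω : IsPrimitiveRoot ω N) (r : EquivariantRep (cyclicCoaction N) L)
  (s : EquivariantRep (freeUnitaryCoaction hω) M)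

theorem bosonizationRelations_boxTensor :
    BosonizationRelations ω (j₁ ω r s (zFun N ω))
      (Matrix.of fun i j => j₂ ω r s (FreeUnitary.u N ω i j)) where
  mul_star := by
    rw [← boxCharacter_one hω]
    exact Unitary.mul_star_self_of_mem (boxCharacter hω r s _).2
  star_mul := by
    rw [← boxCharacter_one hω]
    exact Unitary.star_mul_self_of_mem (boxCharacter hω r s _).2
  pow := by
    rw [← boxCharacter_one hω, ← SubmonoidClass.coe_pow, ← map_pow, ← ofAdd_nsmul, nsmul_one,
      ZMod.natCast_self, ofAdd_zero, map_one]
    rfl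
  comm i j := by
    have h := isCovariant_j₂Hom hω r s (.ofAdd 1) (FreeUnitary.u N ω i j)
    rwa [FreeUnitary.isHomogeneous_u, one_mul, map_smul, smul_mul_assoc, boxCharacter_one,
      j₂Hom_apply] at h
  unitary := by
    have h := (FreeUnitary.isAnyonicUnitary N ω).map (j₂Hom hω r s)
    rwa [show (FreeUnitary.u N ω).map (j₂Hom hω r s) = Matrix.of fun i j => _ from
      Matrix.ext fun i j => j₂Hom_apply hω _] at h

variable {hω r s}

theorem bosonization_hom_ext {D : Type*} [CStarAlgebra D] {φ ψ : boxTensor ω r s →⋆ₐ[ℂ] D}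
    (hz : φ (j₁ ω r s (zFun N ω)) = ψ (j₁ ω r s (zFun N ω)))
    (hu : ∀ i j, φ (j₂ ω r s (FreeUnitary.u N ω i j)) = ψ (j₂ ω r s (FreeUnitary.u N ω i j))) :
    φ = ψ := by
  refine boxTensor_hom_ext (fun f => ?_) fun x => ?_
  · have h : φ.comp (j₁Hom ω r s) = ψ.comp (j₁Hom ω r s) := zFun_hom_ext hω hz
    exact DFunLike.congr_fun h f
  · have h : φ.comp (j₂Hom hω r s) = ψ.comp (j₂Hom hω r s) := FreeUnitary.hom_ext ω fun i j => by
      rw [StarAlgHom.comp_apply, StarAlgHom.comp_apply, j₂Hom_apply, hu]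
    simpa only [StarAlgHom.comp_apply, j₂Hom_apply] using DFunLike.congr_fun h x

variable (hω r s)

theorem topologicalClosure_adjoin_boxTensor :
    (StarAlgebra.adjoin ℂ ({j₁ ω r s (zFun N ω)} ∪
      {b | ∃ i j, b = j₂ ω r s (FreeUnitary.u N ω i j)})).topologicalClosure = ⊤ := by
  set S := (StarAlgebra.adjoin ℂ ({j₁ ω r s (zFun N ω)} ∪
    {b | ∃ i j, b = j₂ ω r s (FreeUnitary.u N ω i j)})).topologicalClosure
  have hsub : _ ⊆ (S : Set (boxTensor ω r s)) :=
    (StarAlgebra.subset_adjoin ℂ _).trans (StarSubalgebra.le_topologicalClosure _)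
  have hz : j₁ ω r s (zFun N ω) ∈ S := hsub (.inl rfl)
  have hclosed : IsClosed (S.comap (j₂Hom hω r s) : Set (FreeUnitary N ω)) :=
    (StarSubalgebra.isClosed_topologicalClosure _).preimage (map_continuous (j₂Hom hω r s))
  have hj₂ x : j₂Hom hω r s x ∈ S := FreeUnitary.mem_of_isClosed (S := S.comap (j₂Hom hω r s))
    hclosed (fun i j => hsub (.inr ⟨i, j, j₂Hom_apply hω _⟩)) x
  refine eq_top_iff.2 fun b _ => ?_
  obtain ⟨x, rfl⟩ := (crossedSum_boxTensor_bijective r s hω).2 b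
  rw [crossedSum_apply]
  refine sum_mem fun g _ => mul_mem (hj₂ _) ?_
  rw [← ofAdd_toAdd g, coe_eq_pow, boxCharacter_one]
  exact pow_mem hz _

theorem isUniversalBosonization_boxTensor :
    IsUniversalBosonization.{max u v, w} ω (j₁ ω r s (zFun N ω))
      (Matrix.of fun i j => j₂ ω r s (FreeUnitary.u N ω i j)) where
  relations := bosonizationRelations_boxTensor hω r s
  generates := topologicalClosure_adjoin_boxTensor hω r s
  universal D _ z' u' h := by
    have hv := powRep_one (Unitary.mem_iff.2 ⟨h.star_mul, h.mul_star⟩) h.pow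
    let φ := crossedLift (isCovariant_j₂Hom hω r s) (crossedSum_boxTensor_bijective r s hω)
      (h.isCovariant hω hv)
    have hz : φ (j₁ ω r s (zFun N ω)) = z' := by
      rw [← boxCharacter_one hω, crossedLift_coe, hv]
    have hu i j : φ (j₂ ω r s (FreeUnitary.u N ω i j)) = u' i j := by
      rw [← j₂Hom_apply hω, crossedLift_hom, FreeUnitary.lift_u]
    exact ⟨φ, ⟨hz, hu⟩, fun ψ hψ => bosonization_hom_ext (hψ.1.trans hz.symm)
      fun i j => (hψ.2 i j).trans (hu i j).symm⟩

end Universal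

section FreeUnitaryComult

theorem IsAnyonicUnitary.mul (hω : IsPrimitiveRoot ω N) {B : Type*} [Ring B] [StarRing B]
    [Algebra ℂ B] [StarModule ℂ B] {a b : Matrix (ZMod N) (ZMod N) B} (ha : IsAnyonicUnitary ω a)
    (hb : IsAnyonicUnitary ω b)
    (hab : ∀ i k j, a i k * b k j = rootPow ω ((k - i) * (j - k)) • (b k j * a i k)) :
    IsAnyonicUnitary ω (a * b) := by
  have hconj : conjMatrix ω (a * b) = conjMatrix ω a * conjMatrix ω b := by
    ext i j
    simp only [conjMatrix, Matrix.of_apply, Matrix.mul_apply, star_sum, Finset.smul_sum]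
    refine Finset.sum_congr rfl fun k _ => ?_
    rw [hab, star_smul, star_mul, star_rootPow hω, smul_smul, smul_mul_smul_comm,
      ← rootPow_add hω, ← rootPow_add hω]
    congr 2
    ring
  exact ⟨mul_mem ha.1 hb.1, hconj ▸ mul_mem ha.2 hb.2⟩

variable {M : Type*} [NormedAddCommGroup M] [InnerProductSpace ℂ M] [CompleteSpace M]

theorem isAnyonicUnitary_boxTensor_mul (hω : IsPrimitiveRoot ω N)
    (s : EquivariantRep (freeUnitaryCoaction hω) M) :
    IsAnyonicUnitary ω
      ((FreeUnitary.u N ω).map (j₁Hom ω s s) * (FreeUnitary.u N ω).map (j₂Hom hω s s)) := by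
  have hu := FreeUnitary.isAnyonicUnitary N ω
  refine (hu.map _).mul hω (hu.map _) fun i k j => ?_
  rw [Matrix.map_apply, Matrix.map_apply, j₁Hom_apply, j₂Hom_apply,
    j₁_mul_j₂_of_isHomogeneous hω (FreeUnitary.isHomogeneous_u hω i k),
    FreeUnitary.isHomogeneous_u hω k j, ← j₂Hom_apply hω, ← j₂Hom_apply hω, map_smul,
    smul_mul_assoc]

theorem isHomogeneous_boxTensor_mul (hω : IsPrimitiveRoot ω N)
    (s : EquivariantRep (freeUnitaryCoaction hω) M) (i k j : ZMod N) :
    IsHomogeneous ω (conjRep (s.rep.tensor s.rep)) (j - i)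
      (j₁ ω s s (FreeUnitary.u N ω i k) * j₂ ω s s (FreeUnitary.u N ω k j) :
        boxTensor ω s s).1 := by
  rw [← sub_add_sub_cancel' k i j]
  exact ((FreeUnitary.isHomogeneous_u hω i k).j₁ hω s s).mul hω
    ((FreeUnitary.isHomogeneous_u hω k j).j₂ hω s s)

theorem exists_isFreeUnitaryComult (hω : IsPrimitiveRoot ω N)
    (s : EquivariantRep (freeUnitaryCoaction hω) M) : ∃ Δ, IsFreeUnitaryComult hω s Δ := by
  let Δ := FreeUnitary.lift ω _ (isAnyonicUnitary_boxTensor_mul hω s)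
  have hΔ i j : Δ (FreeUnitary.u N ω i j) =
      ∑ k, j₁ ω s s (FreeUnitary.u N ω i k) * j₂ ω s s (FreeUnitary.u N ω k j) := by
    rw [FreeUnitary.lift_u, Matrix.mul_apply]
    simp only [Matrix.map_apply, j₁Hom_apply, j₂Hom_apply]
  refine ⟨Δ, hΔ, FreeUnitary.hom_rep_of_isHomogeneous hω
    (f := (boxTensor ω s s).subtype.comp Δ) (v := s.rep.tensor s.rep) fun i j => ?_⟩
  rw [StarAlgHom.comp_apply, hΔ, map_sum]
  exact .sum fun k _ => isHomogeneous_boxTensor_mul hω s i k j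

theorem IsFreeUnitaryComult.unique {hω : IsPrimitiveRoot ω N}
    {s : EquivariantRep (freeUnitaryCoaction hω) M} {Δ Δ' : FreeUnitary N ω →⋆ₐ[ℂ] boxTensor ω s s}
    (h : IsFreeUnitaryComult hω s Δ) (h' : IsFreeUnitaryComult hω s Δ') : Δ' = Δ :=
  FreeUnitary.hom_ext ω fun i j => (h'.1 i j).trans (h.1 i j).symm

end FreeUnitaryComult

/-! ### The homomorphism `ψ` -/

section Dense

variable {E F V W : Type*}
  [NormedAddCommGroup E] [InnerProductSpace ℂ E] [NormedAddCommGroup F] [InnerProductSpace ℂ F]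
  [NormedAddCommGroup V] [InnerProductSpace ℂ V] [NormedAddCommGroup W] [InnerProductSpace ℂ W]

/-- The isometry `V ⊗ W → E ⊗ F` from an algebraic to a completed tensor product given by isometries
`V → E` and `W → F`. -/
def tensorEmbMap (f : V →ₗᵢ[ℂ] E) (g : W →ₗᵢ[ℂ] F) : V ⊗[ℂ] W →ₗᵢ[ℂ] HTensor E F :=
  (tensorEmb E F).comp (TensorProduct.mapIsometry f g)

theorem denseRange_tensorEmbMap {f : V →ₗᵢ[ℂ] E} {g : W →ₗᵢ[ℂ] F} (hf : DenseRange f)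
    (hg : DenseRange g) : DenseRange (tensorEmbMap f g) := by
  let S : Submodule ℂ (HTensor E F) := (tensorEmbMap f g).toLinearMap.range.topologicalClosure
  have hvec (x : E) (y : F) : vecTensor x y ∈ S :=
    map_mem_closure₂ continuous_vecTensor (hf x) (hg y) <| by
      rintro _ ⟨a, rfl⟩ _ ⟨b, rfl⟩
      exact ⟨a ⊗ₜ b, rfl⟩
  have hemb (x : E ⊗[ℂ] F) : tensorEmb E F x ∈ S := by
    induction x using TensorProduct.induction_on with
    | zero => exact map_zero (tensorEmb E F) ▸ S.zero_mem
    | tmul a b => exact hvec a b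
    | add a b ha hb => exact map_add (tensorEmb E F) a b ▸ S.add_mem ha hb
  exact fun x => closure_minimal (Set.range_subset_iff.2 hemb)
    (Submodule.isClosed_topologicalClosure _) (denseRange_tensorEmb x)

end Dense

section Shuffle

set_option maxSynthPendingDepth 5

variable {X L M K : Type*}
  [NormedAddCommGroup X] [InnerProductSpace ℂ X] [NormedAddCommGroup L] [InnerProductSpace ℂ L]
  [NormedAddCommGroup M] [InnerProductSpace ℂ M] [NormedAddCommGroup K] [InnerProductSpace ℂ K]

variable (X L M K) in
/-- The isometry `x ⊗ (a ⊗ (b ⊗ c)) ↦ (a ⊗ b) ⊗ (x ⊗ c)` of algebraic tensor products. -/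
def shuffleIsometry :
    X ⊗[ℂ] (L ⊗[ℂ] (M ⊗[ℂ] K)) ≃ₗᵢ[ℂ] (L ⊗[ℂ] M) ⊗[ℂ] (X ⊗[ℂ] K) :=
  (((LinearIsometryEquiv.lTensor X (TensorProduct.assocIsometry ℂ L M K).symm).trans
    (TensorProduct.assocIsometry ℂ X (L ⊗[ℂ] M) K).symm).trans
      (LinearIsometryEquiv.rTensor K (TensorProduct.commIsometry ℂ X (L ⊗[ℂ] M)))).trans
        (TensorProduct.assocIsometry ℂ (L ⊗[ℂ] M) X K)

variable (X L M K) in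
/-- The embedding of the algebraic tensor product in `X ⊗ (L ⊗ (M ⊗ K))`. -/
def nestedEmb : X ⊗[ℂ] (L ⊗[ℂ] (M ⊗[ℂ] K)) →ₗᵢ[ℂ] HTensor X (HTensor L (HTensor M K)) :=
  tensorEmbMap .id (tensorEmbMap .id (tensorEmb M K))

theorem denseRange_nestedEmb : DenseRange (nestedEmb X L M K) :=
  denseRange_tensorEmbMap denseRange_id (denseRange_tensorEmbMap denseRange_id denseRange_tensorEmb)

variable (X L M K) in
/-- The unitary `x ⊗ (a ⊗ (b ⊗ c)) ↦ (a ⊗ b) ⊗ (x ⊗ c)`. -/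
def shuffle : HTensor X (HTensor L (HTensor M K)) ≃ₗᵢ[ℂ] HTensor (HTensor L M) (HTensor X K) :=
  LinearEquiv.extendOfIsometry (shuffleIsometry X L M K).toLinearEquiv
    (nestedEmb X L M K).toLinearMap (tensorEmbMap (tensorEmb L M) (tensorEmb X K)).toLinearMap
    denseRange_nestedEmb (denseRange_tensorEmbMap denseRange_tensorEmb denseRange_tensorEmb)
    fun x => by
      change ‖tensorEmbMap (tensorEmb L M) (tensorEmb X K) (shuffleIsometry X L M K x)‖ =
        ‖nestedEmb X L M K x‖
      rw [LinearIsometry.norm_map, LinearIsometry.norm_map, LinearIsometryEquiv.norm_map]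

theorem shuffle_nestedEmb (x : X ⊗[ℂ] (L ⊗[ℂ] (M ⊗[ℂ] K))) :
    shuffle X L M K (nestedEmb X L M K x) =
      tensorEmbMap (tensorEmb L M) (tensorEmb X K) (shuffleIsometry X L M K x) :=
  LinearEquiv.extendOfIsometry_eq ..

theorem shuffle_vecTensor (x : X) (a : L) (b : M) (c : K) :
    shuffle X L M K (vecTensor x (vecTensor a (vecTensor b c))) =
      vecTensor (vecTensor a b) (vecTensor x c) :=
  shuffle_nestedEmb (x ⊗ₜ (a ⊗ₜ (b ⊗ₜ c)))

theorem conj_shuffle_opTensor (R : X →L[ℂ] X) (S : L →L[ℂ] L) (T : M →L[ℂ] M) (U : K →L[ℂ] K) :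
    (shuffle X L M K).conjStarAlgEquiv (opTensor R (opTensor S (opTensor T U))) =
      opTensor (opTensor S T) (opTensor R U) := by
  suffices h : (shuffle X L M K).toLinearEquiv.toLinearMap ∘ₗ
      (opTensor R (opTensor S (opTensor T U))).toLinearMap ∘ₗ (nestedEmb X L M K).toLinearMap =
      (opTensor (opTensor S T) (opTensor R U)).toLinearMap ∘ₗ
        (shuffle X L M K).toLinearEquiv.toLinearMap ∘ₗ (nestedEmb X L M K).toLinearMap by
    have h' : ⇑(shuffle X L M K) ∘ ⇑(opTensor R (opTensor S (opTensor T U))) =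
        ⇑(opTensor (opTensor S T) (opTensor R U)) ∘ ⇑(shuffle X L M K) :=
      denseRange_nestedEmb.equalizer
        ((shuffle X L M K).continuous.comp (ContinuousLinearMap.continuous _))
        ((ContinuousLinearMap.continuous _).comp (shuffle X L M K).continuous)
        (funext (LinearMap.congr_fun h))
    ext ξ
    rw [LinearIsometryEquiv.conjStarAlgEquiv_apply_apply]
    refine (congrFun h' _).trans ?_
    rw [Function.comp_apply, LinearIsometryEquiv.apply_symm_apply]
  ext x a b c
  change shuffle X L M K (opTensor R (opTensor S (opTensor T U))
      (vecTensor x (vecTensor a (vecTensor b c)))) =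
    opTensor (opTensor S T) (opTensor R U)
      (shuffle X L M K (vecTensor x (vecTensor a (vecTensor b c))))
  simp only [shuffle_vecTensor, opTensor_vecTensor]

variable [CompleteSpace X]

variable (X L M K) in
/-- The homomorphism `a ⊗ (b ⊗ c) ↦ (a ⊗ b) ⊗ (1 ⊗ c)` of operators, where `1` acts on `X`. -/
def legHom : (HTensor L (HTensor M K) →L[ℂ] HTensor L (HTensor M K)) →⋆ₐ[ℂ]
    (HTensor (HTensor L M) (HTensor X K) →L[ℂ] HTensor (HTensor L M) (HTensor X K)) :=
  (shuffle X L M K).conjStarAlgEquiv.toStarAlgHom.comp (inrHom X (HTensor L (HTensor M K)))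

theorem legHom_opTensor (S : L →L[ℂ] L) (T : M →L[ℂ] M) (U : K →L[ℂ] K) :
    legHom X L M K (opTensor S (opTensor T U)) = opTensor (opTensor S T) (opTensor 1 U) :=
  conj_shuffle_opTensor 1 S T U

end Shuffle

section Implementation

variable {K L : Type*}
  [NormedAddCommGroup K] [InnerProductSpace ℂ K] [CompleteSpace K]
  [NormedAddCommGroup L] [InnerProductSpace ℂ L] [CompleteSpace L]

theorem commute_tensor_inrRep {N : ℕ} (τ : CyclicRep N K) {κ μ : CyclicRep N L}
    (hκμ : ∀ g h, Commute (κ g : L →L[ℂ] L) (μ h)) (g h : Multiplicative (ZMod N)) :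
    Commute (τ.tensor κ g : HTensor K L →L[ℂ] HTensor K L) (mapRep (inrHom K L) μ h) := by
  rw [coe_tensor, coe_mapRep, inrHom_apply]
  exact commute_opTensor (Commute.one_right _) (hκμ g h)

/-- Conjugation by two bicharacter unitaries on `K ⊗ L`: the first one turns `a ⊗ 1` into
`a ⊗ c ^ d` for `a` of degree `d`, the second one absorbs the action `τ` of `ℤ/N` on the first
factor into the action `κ` on the second one. -/
def twistHom (hω : IsPrimitiveRoot ω N) (τ : CyclicRep N K) (c : CyclicRep N L)
    {κ μ : CyclicRep N L} (hκμ : ∀ g h, Commute (κ g : L →L[ℂ] L) (μ h)) :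
    (HTensor K L →L[ℂ] HTensor K L) →⋆ₐ[ℂ] (HTensor K L →L[ℂ] HTensor K L) :=
  (conjBichar hω (commute_tensor_inrRep τ hκμ)).comp (conjBichar hω (commute_inlRep_inrRep τ c))

theorem twistHom_leftOp (hω : IsPrimitiveRoot ω N) {τ : CyclicRep N K} {c κ μ : CyclicRep N L}
    (hκμ : ∀ g h, Commute (κ g : L →L[ℂ] L) (μ h))
    (hc : ∀ k, IsHomogeneous ω (conjRep κ) (-k) (c (.ofAdd k) : L →L[ℂ] L))
    (hcμ : ∀ g h, Commute (c g : L →L[ℂ] L) (μ h)) {d : ZMod N} {a : K →L[ℂ] K}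
    (ha : IsHomogeneous ω (conjRep τ) d a) :
    twistHom hω τ c hκμ (leftOp L a) = opTensor a (c (.ofAdd d) : L →L[ℂ] L) := by
  have hτκ : ∀ g, Commute (τ.tensor κ g : HTensor K L →L[ℂ] HTensor K L)
      (opTensor a (c (.ofAdd d) : L →L[ℂ] L)) :=
    isHomogeneous_conjRep_zero_iff.1 (add_neg_cancel d ▸ ha.opTensor hω (hc d))
  have hμ g : Commute (mapRep (inrHom K L) μ g : HTensor K L →L[ℂ] HTensor K L)
      (opTensor a (c (.ofAdd d) : L →L[ℂ] L)) := by
    rw [coe_mapRep, inrHom_apply]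
    exact commute_opTensor (Commute.one_left a) (hcμ _ _).symm
  rw [twistHom, StarAlgHom.comp_apply, leftOp, ← inlHom_apply, conjBichar_of_isHomogeneous_left hω _
    (ha.mapRep (inlHom K L)) fun g => (commute_inlHom_inrHom _ _).symm, coe_mapRep, inlHom_apply,
    inrHom_apply, opTensor_mul, mul_one, one_mul, conjBichar_of_commute hω _ hτκ hμ]

theorem twistHom_opTensor (hω : IsPrimitiveRoot ω N) (τ : CyclicRep N K) {c κ μ : CyclicRep N L}
    (hκμ : ∀ g h, Commute (κ g : L →L[ℂ] L) (μ h)) {e : ZMod N} {b : L →L[ℂ] L}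
    (hb : IsHomogeneous ω (conjRep μ) e b) (hcb : ∀ g, Commute (c g : L →L[ℂ] L) b)
    (hκb : ∀ g, Commute (κ g : L →L[ℂ] L) b) :
    twistHom hω τ c hκμ (opTensor (τ (.ofAdd (-e)) : K →L[ℂ] K) b) =
      opTensor 1 (b * (κ (.ofAdd e) : L →L[ℂ] L)) := by
  have hτ g : Commute (mapRep (inlHom K L) τ g : HTensor K L →L[ℂ] HTensor K L)
      (opTensor (τ (.ofAdd (-e)) : K →L[ℂ] K) b) := by
    rw [coe_mapRep, inlHom_apply]
    exact commute_opTensor (commute_coe_rep τ _ _) (Commute.one_left _)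
  have hc g : Commute (mapRep (inrHom K L) c g : HTensor K L →L[ℂ] HTensor K L)
      (opTensor (τ (.ofAdd (-e)) : K →L[ℂ] K) b) := by
    rw [coe_mapRep, inrHom_apply]
    exact commute_opTensor (Commute.one_left _) (hcb g)
  have hτκ g : Commute (τ.tensor κ g : HTensor K L →L[ℂ] HTensor K L)
      (opTensor (τ (.ofAdd (-e)) : K →L[ℂ] K) b) := by
    rw [coe_tensor]
    exact commute_opTensor (commute_coe_rep τ _ _) (hκb g)
  have hμ : IsHomogeneous ω (conjRep (mapRep (inrHom K L) μ)) e
      (opTensor (τ (.ofAdd (-e)) : K →L[ℂ] K) b) := by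
    refine isHomogeneous_conjRep_iff.2 fun t => ?_
    rw [coe_mapRep, inrHom_apply, opTensor_mul, opTensor_mul, isHomogeneous_conjRep_iff.1 hb,
      one_mul, mul_one, ← opTensorₗ_apply, ← opTensorₗ_apply, map_smul]
  rw [twistHom, StarAlgHom.comp_apply, conjBichar_of_commute hω _ hτ hc,
    conjBichar_of_isHomogeneous_right hω _ hμ hτκ, coe_tensor, opTensor_mul, ofAdd_neg, coe_map_inv,
    Unitary.coe_star_mul_self]

variable {M : Type*} [NormedAddCommGroup M] [InnerProductSpace ℂ M] [CompleteSpace M]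

/-- The homomorphism on `B(L ⊗ (M ⊗ M))` that implements `ψ`. -/
def psiHom (hω : IsPrimitiveRoot ω N) (π c : CyclicRep N L) (σ : CyclicRep N M) :
    (HTensor L (HTensor M M) →L[ℂ] HTensor L (HTensor M M)) →⋆ₐ[ℂ]
      (HTensor (HTensor L M) (HTensor L M) →L[ℂ] HTensor (HTensor L M) (HTensor L M)) :=
  (twistHom (L := HTensor L M) hω (π.tensor σ) (mapRep (inlHom L M) c)
    (commute_inlRep_inrRep (π.comp invMonoidHom) σ)).comp (legHom L L M M)

variable {π c : CyclicRep N L}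

theorem psiHom_of_legHom_eq (hω : IsPrimitiveRoot ω N) {σ : CyclicRep N M}
    (hc : ∀ k, IsHomogeneous ω (conjRep π) k (c (.ofAdd k) : L →L[ℂ] L)) {d : ZMod N}
    {T : HTensor L (HTensor M M) →L[ℂ] HTensor L (HTensor M M)} {a : HTensor L M →L[ℂ] HTensor L M}
    (hT : legHom L L M M T = leftOp (HTensor L M) a)
    (ha : IsHomogeneous ω (conjRep (π.tensor σ)) d a) :
    psiHom hω π c σ T = opTensor a (leftOp M (c (.ofAdd d) : L →L[ℂ] L)) := by
  have hcinv k : IsHomogeneous ω (conjRep (mapRep (inlHom L M) (π.comp invMonoidHom))) (-k)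
      (mapRep (inlHom L M) c (.ofAdd k) : HTensor L M →L[ℂ] HTensor L M) := by
    refine IsHomogeneous.mapRep (isHomogeneous_conjRep_iff.2 fun t => ?_) (inlHom L M)
    rw [mul_neg, ← neg_mul]
    exact isHomogeneous_conjRep_iff.1 (hc k) (-t)
  rw [psiHom, StarAlgHom.comp_apply, hT]
  exact twistHom_leftOp hω _ hcinv (commute_inlRep_inrRep c σ) ha

theorem psiHom_leftOp (hω : IsPrimitiveRoot ω N) (σ : CyclicRep N M)
    (hc : ∀ k, IsHomogeneous ω (conjRep π) k (c (.ofAdd k) : L →L[ℂ] L)) {d : ZMod N}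
    {a : L →L[ℂ] L} (ha : IsHomogeneous ω (conjRep π) d a) :
    psiHom hω π c σ (leftOp (HTensor M M) a) =
      opTensor (leftOp M a) (leftOp M (c (.ofAdd d) : L →L[ℂ] L)) := by
  refine psiHom_of_legHom_eq hω hc ?_ (ha.leftOp hω σ)
  rw [leftOp, ← opTensor_one, legHom_opTensor, opTensor_one]
  rfl

theorem psiHom_rightOp_leftOp (hω : IsPrimitiveRoot ω N) {σ : CyclicRep N M}
    (hc : ∀ k, IsHomogeneous ω (conjRep π) k (c (.ofAdd k) : L →L[ℂ] L)) {d : ZMod N}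
    {b : M →L[ℂ] M} (hb : IsHomogeneous ω (conjRep σ) d b) :
    psiHom hω π c σ (rightOp ω π (σ.tensor σ) (leftOp M b)) =
      opTensor (rightOp ω π σ b) (leftOp M (c (.ofAdd d) : L →L[ℂ] L)) := by
  refine psiHom_of_legHom_eq hω hc ?_ (hb.rightOp hω π)
  rw [rightOp_of_isHomogeneous hω π (hb.leftOp hω σ), rightOp_of_isHomogeneous hω π hb, leftOp,
    legHom_opTensor, opTensor_one]
  rfl

theorem psiHom_rightOp_rightOp (hω : IsPrimitiveRoot ω N) {σ : CyclicRep N M} (b : M →L[ℂ] M) :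
    psiHom hω π c σ (rightOp ω π (σ.tensor σ) (rightOp ω σ σ b)) =
      opTensor 1 (rightOp ω π σ b) := by
  simp only [← rightOpHom_apply hω, ← inrHom_apply]
  induction b using isHomogeneous_induction hω (conjRep σ) with
  | add b b' hb hb' => simp only [map_add, hb, hb']
  | homogeneous e b hb =>
    have hπ : (mapRep (inlHom L M) (π.comp invMonoidHom) (.ofAdd e) :
        HTensor L M →L[ℂ] HTensor L M) = inlHom L M (π (.ofAdd (-e)) : L →L[ℂ] L) := rfl
    have hrightOp : rightOpHom hω π σ b =
        inrHom L M b * mapRep (inlHom L M) (π.comp invMonoidHom) (.ofAdd e) := by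
      rw [rightOpHom_apply, rightOp_of_isHomogeneous hω π hb, hπ, ← (commute_inlHom_inrHom _ _).eq,
        inlHom_apply, inrHom_apply, opTensor_mul, mul_one, one_mul]
    rw [hrightOp, rightOpHom_apply, rightOpHom_apply, psiHom, StarAlgHom.comp_apply,
      rightOp_of_isHomogeneous hω π (hb.rightOp hω σ), rightOp_of_isHomogeneous hω σ hb,
      legHom_opTensor, ← coe_tensor, ← inrHom_apply, inrHom_apply (inrHom L M b * _)]
    exact twistHom_opTensor hω _ _ (hb.mapRep (inrHom L M)) (fun g => commute_inlHom_inrHom _ _)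
      fun g => commute_inlHom_inrHom _ _

end Implementation

section Psi

variable {X : Type*} [CStarAlgebra X] {ρ : CyclicCoaction N X} {L M : Type*}
  [NormedAddCommGroup L] [InnerProductSpace ℂ L] [CompleteSpace L]
  [NormedAddCommGroup M] [InnerProductSpace ℂ M] [CompleteSpace M]

theorem opTensor_mem_spatialTensor {S : StarSubalgebra ℂ (L →L[ℂ] L)}
    {T : StarSubalgebra ℂ (M →L[ℂ] M)} (a : S) (b : T) :
    opTensor (a : L →L[ℂ] L) (b : M →L[ℂ] M) ∈ spatialTensor S T :=
  StarSubalgebra.le_topologicalClosure _ (StarAlgebra.subset_adjoin ℂ _ ⟨a, a.2, b, b.2, rfl⟩)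

theorem sum_opTensor_of_isHomogeneous (hω : IsPrimitiveRoot ω N) {d : ZMod N} {x : X}
    (hx : IsHomogeneous ω ρ.rep d x) (f : X →⋆ₐ[ℂ] (L →L[ℂ] L))
    (g : (ZMod N → ℂ) →⋆ₐ[ℂ] (M →L[ℂ] M)) :
    ∑ t, opTensor (f (ρ.hom x t)) (g (Pi.single t 1)) =
      opTensor (f x) (g (character hω (.ofAdd d))) := by
  rw [pi_eq_sum_univ' (character hω (.ofAdd d) : ZMod N → ℂ), map_sum]
  simp only [← opTensorₗ_apply, map_sum, map_smul]
  refine Finset.sum_congr rfl fun t _ => ?_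
  rw [← ρ.rep_apply, hx, map_smul, map_smul, LinearMap.smul_apply, character_apply]

theorem eq_sum_opTensor_of_isHomogeneous (hω : IsPrimitiveRoot ω N) {f : X →⋆ₐ[ℂ] (L →L[ℂ] L)}
    {g : (ZMod N → ℂ) →⋆ₐ[ℂ] (M →L[ℂ] M)} {F : X →⋆ₐ[ℂ] (HTensor L M →L[ℂ] HTensor L M)}
    (h : ∀ d x, IsHomogeneous ω ρ.rep d x → F x = opTensor (f x) (g (character hω (.ofAdd d))))
    (x : X) : F x = ∑ t, opTensor (f (ρ.hom x t)) (g (Pi.single t 1)) := by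
  induction x using isHomogeneous_induction hω ρ.rep with
  | add x y hx hy =>
    rw [map_add, hx, hy, ← Finset.sum_add_distrib]
    simp only [← opTensorₗ_apply, map_add, Pi.add_apply, LinearMap.add_apply]
  | homogeneous d x hx => rw [h d x hx, sum_opTensor_of_isHomogeneous hω hx]

/-- The homomorphism `ψ`, into all bounded operators. -/
def bosonizationHom (hω : IsPrimitiveRoot ω N) (r : EquivariantRep (cyclicCoaction N) L)
    (s : EquivariantRep ρ M) :
    (HTensor L (HTensor M M) →L[ℂ] HTensor L (HTensor M M)) →⋆ₐ[ℂ]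
      (HTensor (HTensor L M) (HTensor L M) →L[ℂ] HTensor (HTensor L M) (HTensor L M)) :=
  psiHom hω r.rep (mapRep r.hom (character hω)) s.rep

variable (hω : IsPrimitiveRoot ω N) (r : EquivariantRep (cyclicCoaction N) L)
  (s : EquivariantRep ρ M)

theorem bosonizationHom_leftOp (f : ZMod N → ℂ) :
    bosonizationHom hω r s (leftOp (HTensor M M) (r.hom f)) =
      ∑ t, opTensor (j₁ ω r s ((cyclicCoaction N).hom f t)).1 (j₁ ω r s (Pi.single t 1)).1 :=
  eq_sum_opTensor_of_isHomogeneous hω (f := (boxTensor ω r s).subtype.comp (j₁Hom ω r s))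
    (g := (boxTensor ω r s).subtype.comp (j₁Hom ω r s))
    (F := ((bosonizationHom hω r s).comp (inlHom L (HTensor M M))).comp r.hom)
    (fun _ _ hf => psiHom_leftOp hω s.rep
      (fun k => (isHomogeneous_character hω k).equivariantRep r) (hf.equivariantRep r)) f

theorem bosonizationHom_rightOp_j₁ (x : X) :
    bosonizationHom hω r s (rightOp ω r.rep (s.rep.tensor s.rep) (j₁ ω s s x).1) =
      ∑ t, opTensor (j₂ ω r s (ρ.hom x t)).1 (j₁ ω r s (Pi.single t 1)).1 := by
  simp only [← rightOpHom_apply hω, ← j₂Hom_apply hω]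
  refine eq_sum_opTensor_of_isHomogeneous hω (f := (boxTensor ω r s).subtype.comp (j₂Hom hω r s))
    (g := (boxTensor ω r s).subtype.comp (j₁Hom ω r s))
    (F := ((bosonizationHom hω r s).comp (rightOpHom hω r.rep (s.rep.tensor s.rep))).comp
      ((inlHom M M).comp s.hom)) (fun _ x hx => ?_) x
  simp only [StarAlgHom.comp_apply, rightOpHom_apply, j₂Hom_apply]
  exact psiHom_rightOp_leftOp hω
    (fun k => (isHomogeneous_character hω k).equivariantRep r) (hx.equivariantRep s)

theorem bosonizationHom_rightOp_j₂ (x : X) :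
    bosonizationHom hω r s (rightOp ω r.rep (s.rep.tensor s.rep) (j₂ ω s s x).1) =
      opTensor 1 (j₂ ω r s x).1 :=
  psiHom_rightOp_rightOp hω (s.hom x)

theorem tripleTensor_le_comap_bosonizationHom :
    tripleTensor ω r s ≤ (spatialTensor (boxTensor ω r s) (boxTensor ω r s)).comap
      (bosonizationHom hω r s) := by
  let S := spatialTensor (boxTensor ω r s) (boxTensor ω r s)
  have hS : IsClosed (bosonizationHom hω r s ⁻¹' S) :=
    (StarSubalgebra.isClosed_topologicalClosure _).preimage (map_continuous _)
  have hright : boxTensor ω s s ≤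
      (S.comap (bosonizationHom hω r s)).comap (rightOpHom hω r.rep (s.rep.tensor s.rep)) := by
    refine braidedTensor_le
      (hS.preimage (map_continuous (rightOpHom hω r.rep (s.rep.tensor s.rep)))) ?_ ?_
    · rintro _ ⟨x, rfl⟩
      rw [StarSubalgebra.mem_comap, rightOpHom_apply, StarSubalgebra.mem_comap]
      exact bosonizationHom_rightOp_j₁ hω r s x ▸
        sum_mem fun t _ => opTensor_mem_spatialTensor _ _
    · rintro _ ⟨x, rfl⟩
      rw [StarSubalgebra.mem_comap, rightOpHom_apply, StarSubalgebra.mem_comap]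
      exact bosonizationHom_rightOp_j₂ hω r s x ▸ opTensor_mem_spatialTensor 1 _
  refine braidedTensor_le hS ?_ fun y hy => ?_
  · rintro _ ⟨f, rfl⟩
    rw [StarSubalgebra.mem_comap]
    exact bosonizationHom_leftOp hω r s f ▸ sum_mem fun t _ => opTensor_mem_spatialTensor _ _
  · exact rightOpHom_apply hω r.rep _ y ▸ hright hy

end Psi

/-! ### The comultiplication of the bosonization -/

section Functoriality

variable {X : Type*} [CStarAlgebra X] {ρ : CyclicCoaction N X} {L M K : Type*}
  [NormedAddCommGroup L] [InnerProductSpace ℂ L] [CompleteSpace L]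
  [NormedAddCommGroup M] [InnerProductSpace ℂ M] [CompleteSpace M]
  [NormedAddCommGroup K] [InnerProductSpace ℂ K] [CompleteSpace K]
  {σ : CyclicRep N K} {Y : StarSubalgebra ℂ (K →L[ℂ] K)} {φ : X →⋆ₐ[ℂ] Y}

theorem exists_boxTensor_hom (hω : IsPrimitiveRoot ω N) (r : EquivariantRep (cyclicCoaction N) L)
    (s : EquivariantRep ρ M)
    (hφ : ∀ g x, (φ (ρ.rep g x) : K →L[ℂ] K) = conjRep σ g (φ x : K →L[ℂ] K)) :
    ∃ Φ : boxTensor ω r s →⋆ₐ[ℂ] braidedTensor ω r.rep σ r.hom.range Y,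
      (∀ f, Φ (j₁ ω r s f) = braidedTensor.left (r.hom.rangeRestrict f)) ∧
        ∀ x, Φ (j₂ ω r s x) = braidedTensor.right (φ x) := by
  have hcov := isCovariant_rightHom_comp hω r hφ
  have hb := crossedSum_boxTensor_bijective r s hω
  refine ⟨crossedLift (isCovariant_j₂Hom hω r s) hb hcov, fun f => ?_, fun x => ?_⟩
  · have hz := crossedLift_coe (isCovariant_j₂Hom hω r s) hb hcov (.ofAdd 1)
    rw [boxCharacter_one, coe_mapRep, character_one] at hz
    have h : (crossedLift (isCovariant_j₂Hom hω r s) hb hcov).comp (j₁Hom ω r s) =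
        (braidedTensor.leftHom ω r.rep σ r.hom.range Y).comp r.hom.rangeRestrict :=
      zFun_hom_ext hω hz
    exact DFunLike.congr_fun h f
  · rw [← j₂Hom_apply hω, crossedLift_hom, StarAlgHom.comp_apply, braidedTensor.rightHom_apply]

end Functoriality

section BoxHom

variable {X Y D : Type*} [CStarAlgebra X] [CStarAlgebra Y] [CStarAlgebra D]
  {ρ : CyclicCoaction N X} {τ : CyclicCoaction N Y} {L M : Type*}
  [NormedAddCommGroup L] [InnerProductSpace ℂ L] [CompleteSpace L]
  [NormedAddCommGroup M] [InnerProductSpace ℂ M] [CompleteSpace M]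
  {r : EquivariantRep ρ L} {s : EquivariantRep τ M} {φ : boxTensor ω r s →⋆ₐ[ℂ] D}
  {f : X →⋆ₐ[ℂ] D} {g : Y →⋆ₐ[ℂ] D}

theorem boxTensor_hom_j₁ (hω : IsPrimitiveRoot ω N)
    (h : ∀ x y, φ (j₁ ω r s x * j₂ ω r s y) = f x * g y) (x : X) : φ (j₁ ω r s x) = f x := by
  simpa only [← j₂Hom_apply hω, map_one, mul_one] using h x 1

theorem boxTensor_hom_j₂ (h : ∀ x y, φ (j₁ ω r s x * j₂ ω r s y) = f x * g y) (y : Y) :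
    φ (j₂ ω r s y) = g y := by
  simpa only [← j₁Hom_apply, map_one, one_mul] using h 1 y

end BoxHom

section Bosonization

variable {X : Type*} [CStarAlgebra X] {ρ : CyclicCoaction N X} {L M : Type*}
  [NormedAddCommGroup L] [InnerProductSpace ℂ L] [CompleteSpace L]
  [NormedAddCommGroup M] [InnerProductSpace ℂ M] [CompleteSpace M]

instance (S : StarSubalgebra ℂ (L →L[ℂ] L)) (T : StarSubalgebra ℂ (M →L[ℂ] M)) :
    CStarAlgebra (spatialTensor S T) :=
  StarSubalgebra.cstarAlgebra _ (h_closed := StarSubalgebra.isClosed_topologicalClosure _)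

/-- The embedding of the first factor into `C(ℤ/N) ⊠ (X ⊠ X)`. -/
def tripleLeft (ω : ℂ) (r : EquivariantRep (cyclicCoaction N) L) (s : EquivariantRep ρ M) :
    (ZMod N → ℂ) →⋆ₐ[ℂ] tripleTensor ω r s :=
  (braidedTensor.leftHom ω r.rep (s.rep.tensor s.rep) r.hom.range (boxTensor ω s s)).comp
    r.hom.rangeRestrict

/-- The embedding of `X ⊠ X` into `C(ℤ/N) ⊠ (X ⊠ X)`. -/
def tripleRight (hω : IsPrimitiveRoot ω N) (r : EquivariantRep (cyclicCoaction N) L)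
    (s : EquivariantRep ρ M) : boxTensor ω s s →⋆ₐ[ℂ] tripleTensor ω r s :=
  braidedTensor.rightHom r.rep (s.rep.tensor s.rep) r.hom.range (boxTensor ω s s) hω

variable {r : EquivariantRep (cyclicCoaction N) L} {s : EquivariantRep ρ M}

theorem tripleRight_apply (hω : IsPrimitiveRoot ω N) (y : boxTensor ω s s) :
    tripleRight hω r s y = braidedTensor.right y :=
  braidedTensor.rightHom_apply hω y

theorem tripleTensor_hom_ext (hω : IsPrimitiveRoot ω N) {D : Type*} [CStarAlgebra D]
    {φ ψ : tripleTensor ω r s →⋆ₐ[ℂ] D}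
    (h₁ : ∀ f, φ (tripleLeft ω r s f) = ψ (tripleLeft ω r s f))
    (h₂ : ∀ x, φ (tripleRight hω r s (j₁ ω s s x)) = ψ (tripleRight hω r s (j₁ ω s s x)))
    (h₃ : ∀ x, φ (tripleRight hω r s (j₂ ω s s x)) = ψ (tripleRight hω r s (j₂ ω s s x))) :
    φ = ψ := by
  refine braidedTensor.hom_ext ?_ fun y => ?_
  · rintro ⟨_, f, rfl⟩
    exact h₁ f
  · rw [← tripleRight_apply hω]
    exact DFunLike.congr_fun (boxTensor_hom_ext (φ := φ.comp (tripleRight hω r s))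
      (ψ := ψ.comp (tripleRight hω r s)) h₂ h₃) y

theorem exists_isBosonizationComult (hω : IsPrimitiveRoot ω N)
    (r : EquivariantRep (cyclicCoaction N) L) (s : EquivariantRep ρ M)
    {Δ : X →⋆ₐ[ℂ] boxTensor ω s s}
    (hΔ : ∀ t x, (Δ (ρ.hom x t)).1 =
      (s.rep.tensor s.rep).op t * (Δ x).1 * star ((s.rep.tensor s.rep).op t)) :
    ∃ Δ_B, IsBosonizationComult ω r s Δ Δ_B := by
  obtain ⟨Φ, hΦ₁, hΦ₂⟩ := exists_boxTensor_hom hω r s (φ := Δ) (σ := s.rep.tensor s.rep)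
    fun g x => hΔ g.toAdd x
  let Ψ := ((bosonizationHom hω r s).comp (tripleTensor ω r s).subtype).codRestrict
    (spatialTensor (boxTensor ω r s) (boxTensor ω r s)) fun T =>
      tripleTensor_le_comap_bosonizationHom hω r s T.2
  exact ⟨Ψ.comp Φ, Φ, Ψ, fun f x => by rw [map_mul, hΦ₁, hΦ₂], bosonizationHom_leftOp hω r s,
    bosonizationHom_rightOp_j₁ hω r s, bosonizationHom_rightOp_j₂ hω r s, rfl⟩

variable {Δ : X →⋆ₐ[ℂ] boxTensor ω s s}
  {Δ_B Δ_B' : boxTensor ω r s →⋆ₐ[ℂ] spatialTensor (boxTensor ω r s) (boxTensor ω r s)}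

theorem IsBosonizationComult.exists_hom (hω : IsPrimitiveRoot ω N)
    (h : IsBosonizationComult ω r s Δ Δ_B) :
    ∃ Ψ : tripleTensor ω r s →⋆ₐ[ℂ] spatialTensor (boxTensor ω r s) (boxTensor ω r s),
      (∀ f, Δ_B (j₁ ω r s f) = Ψ (tripleLeft ω r s f)) ∧
      (∀ x, Δ_B (j₂ ω r s x) = Ψ (tripleRight hω r s (Δ x))) ∧
      (∀ f, (Ψ (tripleLeft ω r s f)).1 =
        ∑ t, opTensor (j₁Hom ω r s ((cyclicCoaction N).hom f t)).1
          (j₁Hom ω r s (Pi.single t 1)).1) ∧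
      (∀ x, (Ψ (tripleRight hω r s (j₁ ω s s x))).1 =
        ∑ t, opTensor (j₂Hom hω r s (ρ.hom x t)).1 (j₁Hom ω r s (Pi.single t 1)).1) ∧
      ∀ x, (Ψ (tripleRight hω r s (j₂ ω s s x))).1 = opTensor 1 (j₂Hom hω r s x).1 := by
  obtain ⟨Φ, Ψ, hΦ, hΨ₁, hΨ₂, hΨ₃, rfl⟩ := h
  have hΦ' f x : Φ (j₁ ω r s f * j₂ ω r s x) =
      tripleLeft ω r s f * ((tripleRight hω r s).comp Δ) x := by
    rw [hΦ, StarAlgHom.comp_apply, tripleRight_apply]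
    rfl
  refine ⟨Ψ, fun f => ?_, fun x => ?_, hΨ₁, fun x => ?_, fun x => ?_⟩
  · rw [StarAlgHom.comp_apply, boxTensor_hom_j₁ hω hΦ']
  · rw [StarAlgHom.comp_apply, boxTensor_hom_j₂ hΦ', StarAlgHom.comp_apply]
  · rw [tripleRight_apply, hΨ₂]
    simp only [j₂Hom_apply]
    rfl
  · rw [tripleRight_apply, hΨ₃, j₂Hom_apply]

theorem IsBosonizationComult.unique (hω : IsPrimitiveRoot ω N)
    (h : IsBosonizationComult ω r s Δ Δ_B) (h' : IsBosonizationComult ω r s Δ Δ_B') :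
    Δ_B' = Δ_B := by
  obtain ⟨Ψ, hj₁, hj₂, hΨ₁, hΨ₂, hΨ₃⟩ := h.exists_hom hω
  obtain ⟨Ψ', hj₁', hj₂', hΨ₁', hΨ₂', hΨ₃'⟩ := h'.exists_hom hω
  have hΨ : Ψ' = Ψ := tripleTensor_hom_ext hω
    (fun f => Subtype.ext ((hΨ₁' f).trans (hΨ₁ f).symm))
    (fun x => Subtype.ext ((hΨ₂' x).trans (hΨ₂ x).symm))
    fun x => Subtype.ext ((hΨ₃' x).trans (hΨ₃ x).symm)
  exact boxTensor_hom_ext (fun f => by rw [hj₁, hj₁', hΨ]) fun x => by rw [hj₂, hj₂', hΨ]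

theorem IsBosonizationComult.apply_j₁ (hω : IsPrimitiveRoot ω N)
    (h : IsBosonizationComult ω r s Δ Δ_B) {d : ZMod N} {f : ZMod N → ℂ}
    (hf : IsHomogeneous ω (cyclicCoaction N).rep d f) :
    (Δ_B (j₁ ω r s f)).1 =
      opTensor (j₁ ω r s f).1 (boxCharacter hω r s (.ofAdd d) : boxTensor ω r s).1 := by
  obtain ⟨Ψ, hj₁, -, hΨ, -⟩ := h.exists_hom hω
  rw [hj₁, hΨ]
  exact sum_opTensor_of_isHomogeneous hω hf ((boxTensor ω r s).subtype.comp (j₁Hom ω r s))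
    ((boxTensor ω r s).subtype.comp (j₁Hom ω r s))

theorem IsBosonizationComult.apply_j₂ (hω : IsPrimitiveRoot ω N)
    (h : IsBosonizationComult ω r s Δ Δ_B) {ι : Type*} [Fintype ι] {d : ι → ZMod N} {a b : ι → X}
    (ha : ∀ k, IsHomogeneous ω ρ.rep (d k) (a k)) {x : X}
    (hx : Δ x = ∑ k, j₁ ω s s (a k) * j₂ ω s s (b k)) :
    (Δ_B (j₂ ω r s x)).1 = ∑ k, opTensor (j₂ ω r s (a k)).1
      ((boxCharacter hω r s (.ofAdd (d k)) : boxTensor ω r s) * j₂ ω r s (b k) :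
        boxTensor ω r s).1 := by
  obtain ⟨Ψ, -, hj₂, -, hΨ₂, hΨ₃⟩ := h.exists_hom hω
  rw [hj₂, hx, map_sum, map_sum, AddSubmonoidClass.coe_finsetSum]
  refine Finset.sum_congr rfl fun k _ => ?_
  have hsum := sum_opTensor_of_isHomogeneous hω (ha k)
    ((boxTensor ω r s).subtype.comp (j₂Hom hω r s)) ((boxTensor ω r s).subtype.comp (j₁Hom ω r s))
  rw [map_mul, map_mul, MulMemClass.coe_mul, hΨ₂, hΨ₃]
  refine (congrArg (· * opTensor 1 (j₂Hom hω r s (b k)).1) hsum).trans ?_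
  rw [opTensor_mul, mul_one, ← j₂Hom_apply hω, ← j₂Hom_apply hω]
  rfl

end Bosonization

end Anyonic

end

theorem theorem3 (N : ℕ) [NeZero N] (ω : ℂ) (hω : IsPrimitiveRoot ω N)
    {L : Type u} [NormedAddCommGroup L] [InnerProductSpace ℂ L] [CompleteSpace L]
    (r : EquivariantRep (cyclicCoaction N) L)
    {M : Type v} [NormedAddCommGroup M] [InnerProductSpace ℂ M] [CompleteSpace M]
    (s : EquivariantRep (freeUnitaryCoaction hω) M) :
    let z : boxTensor ω r s := j₁ ω r s (zFun N ω)
    let u : Matrix (ZMod N) (ZMod N) (boxTensor ω r s) :=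
      Matrix.of fun i j => j₂ ω r s (FreeUnitary.u N ω i j)
    IsUniversalBosonization.{max u v, w} ω z u ∧
    ∃ (Δ : FreeUnitary N ω →⋆ₐ[ℂ] boxTensor ω s s)
      (Δ_B : boxTensor ω r s →⋆ₐ[ℂ] spatialTensor (boxTensor ω r s) (boxTensor ω r s)),
      IsFreeUnitaryComult hω s Δ ∧ (∀ Δ', IsFreeUnitaryComult hω s Δ' → Δ' = Δ) ∧
      IsBosonizationComult ω r s Δ Δ_B ∧
      (∀ Δ_B', IsBosonizationComult ω r s Δ Δ_B' → Δ_B' = Δ_B) ∧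
      (Δ_B z).1 = opTensor z.1 z.1 ∧
      ∀ i j, (Δ_B (u i j)).1 =
        ∑ k : ZMod N, opTensor (u i k).1 (z ^ (k - i).val * u k j).1 := by
  have hchar k : (boxCharacter hω r s (.ofAdd k) : boxTensor ω r s) = j₁ ω r s (zFun N ω) ^ k.val :=
    (coe_eq_pow _ k).trans (congrArg (· ^ k.val) (boxCharacter_one hω))
  have hz : IsHomogeneous ω (cyclicCoaction N).rep 1 (zFun N ω) :=
    character_one hω ▸ isHomogeneous_character hω 1
  obtain ⟨Δ, hΔ⟩ := exists_isFreeUnitaryComult hω s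
  obtain ⟨Δ_B, hΔ_B⟩ := exists_isBosonizationComult hω r s hΔ.2
  refine ⟨isUniversalBosonization_boxTensor hω r s, Δ, Δ_B, hΔ, fun _ h => hΔ.unique h, hΔ_B,
    fun _ h => hΔ_B.unique hω h, ?_, fun i j => ?_⟩
  · rw [hΔ_B.apply_j₁ hω hz, boxCharacter_one]
  · simp only [Matrix.of_apply, ← hchar]
    exact hΔ_B.apply_j₂ hω (fun k => FreeUnitary.isHomogeneous_u hω i k) (hΔ.1 i j)
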